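/- Let $N\ge 1$ be an integer, let $\hbar,m,\epsilon_0,L,L_z,\omega>0$ and $e\in\mathbb R$, and put $S=L^2$, $V=L^2L_z$, $$\omega_p=\sqrt{\frac{e^2N}{m\epsilon_0V}},\quad \widetilde\omega=\sqrt{\omega^2+\omega_p^2},\quad g_0=\frac{e\hbar}{m}\Big(\frac{\hbar}{2\epsilon_0V\widetilde\omega}\Big)^{1/2},\quad \gamma=\frac{\omega_p^2}{\omega^2+\omega_p^2}.$$ Consider $N$ spin-$\tfrac12$ electrons on the torus $(\mathbb R/L\mathbb Z)^2$ and two oscillators $\lambda=1,2$ (one cavity mode with polarizations $\varepsilon_1=\mathbf e_x$, $\varepsilon_2=\mathbf e_y$), with ladder operators $a_\lambda|n\rangle=\sqrt n\,|n-1\rangle$, $a_\lambda^\dagger|n\rangle=\sqrt{n+1}\,|n+1\rangle$. The Hilbert space consists of the square-integrable functions $\Psi(r_1\sigma_1,\dots,r_N\sigma_N;\nu_1,\nu_2)$ of positions, spins and photon numbers that are antisymmetric in the electrons. The Hamiltonian is $$H=\sum_{j=1}^N\Big[-\frac{\hbar^2}{2m}\nabla_j^2+\frac{\mathrm i e\hbar}{m}\mathbf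 A\cdot\nabla_j\Big]+H_p,\qquad H_p=\frac{Ne^2}{2m}\mathbf A^2+\sum_{\lambda=1}^2\hbar\omega\big(a_\lambda^\dagger a_\lambda+\tfrac12\big),$$ $$\mathbf A=\Big(\frac{\hbar}{\epsilon_0V}\Big)^{1/2}\sum_{\lambda=1}^2\frac{\varepsilon_\lambda}{\sqrt{2\omega}}(a_\lambda+a_\lambda^\dagger).$$ As an operator, $H$ is the closure of this expression on the antisymmetric wave functions that are smooth in the positions and vanish for all but finitely many $(\nu_1,\nu_2)$. Photonic operator identities below are identities of linear maps on the space of all number-state amplitudes. For pairwise distinct orbitals $q_j=(k_j,s_j)$, $k_j\in\frac{2\pi}{L}\mathbb Z^2$, $s_j$ a spin label, let $\Phi_q$ be the normalized Slater determinant of the plane waves $e^{\mathrm i k_j\cdot r}\delta_{\sigma s_j}/\sqrt S$, and let $K=\sum_jk_j$. Then: 1. $\gamma=\frac{2mN}{\hbar^2}\frac{g_0^2}{\hbar\widetilde\omega}=\frac{\omega_p^2}{\widetilde\omega^2}$ and $0\le\gamma<1$. 2. The operators $b_\lambda=\frac{1}{2\sqrt{\omega\widetilde\omega}}[a_\lambda(\widetilde\omega+\omega)+a_\lambda^\dagger(\widetilde\omega-\omega)]$,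 $b_\lambda^\dagger=\frac{1}{2\sqrt{\omega\widetilde\omega}}[a_\lambda(\widetilde\omega-\omega)+a_\lambda^\dagger(\widetilde\omega+\omega)]$ satisfy the bosonic commutation relations, and $$H_p=\sum_\lambda\Big[\hbar\omega\big(a_\lambda^\dagger a_\lambda+\tfrac12\big)+\frac{\hbar\omega_p^2}{4\omega}(a_\lambda+a_\lambda^\dagger)^2\Big]=\sum_\lambda\hbar\widetilde\omega\big(b_\lambda^\dagger b_\lambda+\tfrac12\big),\quad \mathbf A=\Big(\frac{\hbar}{\epsilon_0V}\Big)^{1/2}\sum_\lambda\frac{\varepsilon_\lambda}{\sqrt{2\widetilde\omega}}(b_\lambda+b_\lambda^\dagger).$$ 3. On a product of $\Phi_q$ with a photon state, the differential expression $H$ acts on the photon factor as $\sum_\lambda[\hbar\widetilde\omega(b_\lambda^\dagger b_\lambda+\frac12)-g_0(b_\lambda+b_\lambda^\dagger)\,\varepsilon_\lambda\cdot K]+\sum_j\frac{\hbar^2k_j^2}{2m}$. With $c_\lambda=b_\lambda-\frac{g_0\,\varepsilon_\lambda\cdot K}{\hbar\widetilde\omega}$ and $c_\lambda^\dagger=b_\lambda^\dagger-\frac{g_0\,\varepsilon_\lambda\cdot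 K}{\hbar\widetilde\omega}$, which again satisfy the bosonic commutation relations, this equals $\sum_\lambda[\hbar\widetilde\omega(c_\lambda^\dagger c_\lambda+\frac12)-\frac{g_0^2}{\hbar\widetilde\omega}(\varepsilon_\lambda\cdot K)^2]+\sum_j\frac{\hbar^2k_j^2}{2m}$. 4. For each value $\kappa$ of $\varepsilon_\lambda\cdot K$ (indeed each $\kappa\in\mathbb R$) there is a normalized one-oscillator state $|0,\kappa\rangle_\lambda$ annihilated by $c_\lambda$, and every state annihilated by $c_\lambda$ is a multiple of it. For any choice of these states put $|n,\kappa\rangle_\lambda=(c_\lambda^\dagger)^n|0,\kappa\rangle_\lambda/\sqrt{n!}$, $n\in\mathbb N=\{0,1,2,\dots\}$; then $c_\lambda^\dagger c_\lambda|n,\kappa\rangle_\lambda=n|n,\kappa\rangle_\lambda$. 5. For all $n_1,n_2\in\mathbb N$ the state $\Phi_q\prod_\lambda|n_\lambda,\varepsilon_\lambda\cdot K\rangle_\lambda$ has norm one, lies in the domain of $H$, and is an eigenvector of $H$ (and of the differential expression) with eigenvalue $$E_{n,q}=\sum_{\lambda=1}^2\Big[\hbar\widetilde\omega\big(n_\lambda+\tfrac12\big)-\frac{\gamma}{N}\frac{(\varepsilon_\lambda\cdot\hbar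 K)^2}{2m}\Big]+\sum_{j=1}^N\frac{\hbar^2k_j^2}{2m}.$$ 6. These eigenstates are complete: taking one of them for each set of $N$ distinct orbitals (listed in any order) and each $(n_1,n_2)\in\mathbb N^2$ gives an orthonormal basis of the Hilbert space. The operator $H$ is self-adjoint, and its set of eigenvalues is exactly the set of all $E_{n,q}$ with pairwise distinct orbitals $q_1,\dots,q_N$ and $n\in\mathbb N^2$. -/

import Mathlib

open MeasureTheory
open scoped ContDiff

namespace CavityQED

noncomputable section

/-- The physical data: `N ≥ 1` electrons of charge `e` and mass `mass` on a square of side `L` with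
periodic boundary conditions, between mirrors at distance `Lz`, and one cavity mode of bare
frequency `freq`. -/
structure Params where
  N : ℕ
  hbar : ℝ
  mass : ℝ
  charge : ℝ
  eps0 : ℝ
  L : ℝ
  Lz : ℝ
  freq : ℝ
  N_pos : 0 < N
  hbar_pos : 0 < hbar
  mass_pos : 0 < mass
  eps0_pos : 0 < eps0
  L_pos : 0 < L
  Lz_pos : 0 < Lz
  freq_pos : 0 < freq

namespace Params

variable (P : Params)

instance : Fact (0 < P.L) := ⟨P.L_pos⟩

/-- The cavity volume `V = L² Lz`. -/
def V : ℝ := P.L ^ 2 * P.Lz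

/-- The diamagnetic shift (plasma frequency) `ω_p = √(e² N / (m ε₀ V))`. -/
def plasmaFreq : ℝ := Real.sqrt (P.charge ^ 2 * P.N / (P.mass * P.eps0 * P.V))

/-- The dressed frequency `ω̃ = √(ω² + ω_p²)`. -/
def dressedFreq : ℝ := Real.sqrt (P.freq ^ 2 + P.plasmaFreq ^ 2)

/-- The single-particle coupling `g₀ = (e ħ / m) √(ħ / (2 ε₀ V ω̃))`. -/
def g0 : ℝ :=
  P.charge * P.hbar / P.mass * Real.sqrt (P.hbar / (P.eps0 * P.V * (2 * P.dressedFreq)))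

/-- The collective coupling `γ = ω_p² / (ω² + ω_p²)`. -/
def gamma : ℝ := P.plasmaFreq ^ 2 / (P.freq ^ 2 + P.plasmaFreq ^ 2)

end Params

/-! ### Photons

A photon state of one oscillator is given by its number-state amplitudes `ℕ → ℂ`, one of the two
polarizations by `Occ → ℂ`.  The ladder operators are the usual ones, acting on amplitudes. -/

/-- Photon numbers of the two polarizations. -/
abbrev Occ : Type := Fin 2 → ℕ

/-- `a |n⟩ = √n |n - 1⟩` on the amplitudes of one oscillator. -/
def ann : Module.End ℂ (ℕ → ℂ) where
  toFun f n := (Real.sqrt (n + 1) : ℂ) * f (n + 1)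
  map_add' f g := by ext n; simp [mul_add]
  map_smul' z f := by ext n; simp [mul_left_comm]

/-- `a† |n⟩ = √(n + 1) |n + 1⟩` on the amplitudes of one oscillator
(for `n = 0` the factor `√n` vanishes). -/
def cre : Module.End ℂ (ℕ → ℂ) where
  toFun f n := (Real.sqrt n : ℂ) * f (n - 1)
  map_add' f g := by ext n; simp [mul_add]
  map_smul' z f := by ext n; simp [mul_left_comm]

/-- A one-oscillator operator acting on the polarization `l` of the two-polarization field. -/
def onMode (l : Fin 2) (T : Module.End ℂ (ℕ → ℂ)) : Module.End ℂ (Occ → ℂ) where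
  toFun f n := T (fun k => f (Function.update n l k)) (n l)
  map_add' f g := by
    ext n
    exact congrFun (T.map_add (fun k => f (Function.update n l k))
      (fun k => g (Function.update n l k))) (n l)
  map_smul' z f := by
    ext n
    exact congrFun (T.map_smul z (fun k => f (Function.update n l k))) (n l)

/-- The polarization vectors `ε₁ = e_x`, `ε₂ = e_y`. -/
def pol (l : Fin 2) : Fin 2 → ℝ := Pi.single l 1

namespace Params

variable (P : Params)

/-- The Bogoliubov-transformed annihilation operator
`b = (a (ω̃ + ω) + a† (ω̃ - ω)) / (2 √(ω ω̃))` of one oscillator. -/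
def bAnn : Module.End ℂ (ℕ → ℂ) :=
  ((1 / (2 * Real.sqrt (P.freq * P.dressedFreq)) : ℝ) : ℂ) •
    (((P.dressedFreq + P.freq : ℝ) : ℂ) • ann + ((P.dressedFreq - P.freq : ℝ) : ℂ) • cre)

/-- `b† = (a (ω̃ - ω) + a† (ω̃ + ω)) / (2 √(ω ω̃))`. -/
def bCre : Module.End ℂ (ℕ → ℂ) :=
  ((1 / (2 * Real.sqrt (P.freq * P.dressedFreq)) : ℝ) : ℂ) •
    (((P.dressedFreq - P.freq : ℝ) : ℂ) • ann + ((P.dressedFreq + P.freq : ℝ) : ℂ) • cre)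

/-- The coherent shift `g₀ κ / (ħ ω̃)` at the value `κ = ε_λ · K`. -/
def shift (κ : ℝ) : ℝ := P.g0 * κ / (P.hbar * P.dressedFreq)

/-- `c = b - g₀ κ / (ħ ω̃)` with `κ = ε_λ · K`. -/
def cAnn (κ : ℝ) : Module.End ℂ (ℕ → ℂ) := P.bAnn - (P.shift κ : ℂ) • 1

/-- `c† = b† - g₀ κ / (ħ ω̃)` with `κ = ε_λ · K`. -/
def cCre (κ : ℝ) : Module.End ℂ (ℕ → ℂ) := P.bCre - (P.shift κ : ℂ) • 1

/-- `v` is a normalized oscillator state annihilated by `c`, that is, a ground state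
`|0, κ⟩` of `ħ ω̃ (c† c + 1/2)`. -/
def IsDressedVacuum (κ : ℝ) (v : ℕ → ℂ) : Prop :=
  HasSum (fun n => ‖v n‖ ^ 2) 1 ∧ P.cAnn κ v = 0

/-- The displaced number state `|n, κ⟩ = (c†)ⁿ |0, κ⟩ / √(n!)` over the vacuum `v = |0, κ⟩`. -/
def dressedState (κ : ℝ) (v : ℕ → ℂ) (n : ℕ) : ℕ → ℂ :=
  ((1 / Real.sqrt (n.factorial) : ℝ) : ℂ) • ((P.cCre κ) ^ n) v

/-- The component `i` of the quantized vector potential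
`A = √(ħ / (ε₀ V)) ∑_λ ε_λ / √(2 ω) (a_λ + a†_λ)`. -/
def vecPot (i : Fin 2) : Module.End ℂ (Occ → ℂ) :=
  ((Real.sqrt (P.hbar / (P.eps0 * P.V)) : ℝ) : ℂ) •
    ∑ l : Fin 2, ((pol l i / Real.sqrt (2 * P.freq) : ℝ) : ℂ) • (onMode l ann + onMode l cre)

/-- The photonic part `N e² / (2 m) A² + ∑_λ ħ ω (a†_λ a_λ + 1/2)` of the Hamiltonian. -/
def photonHam : Module.End ℂ (Occ → ℂ) :=
  ((P.N * P.charge ^ 2 / (2 * P.mass) : ℝ) : ℂ) • (∑ i : Fin 2, P.vecPot i * P.vecPot i) +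
    ∑ l : Fin 2, ((P.hbar * P.freq : ℝ) : ℂ) •
      (onMode l cre * onMode l ann + (1 / 2 : ℂ) • 1)

/-! ### Electrons -/

/-- Positions of the electrons on the flat torus `(ℝ / L ℤ)²`. -/
abbrev Pos : Type := Fin P.N → Fin 2 → AddCircle P.L

/-- Spins of the electrons. -/
abbrev Spins : Type := Fin P.N → Fin 2

/-- Wave functions `Ψ(r₁σ₁, …, r_Nσ_N; n₁, n₂)`. -/
abbrev Wave : Type := P.Pos → P.Spins → Occ → ℂ

/-- A single-particle state: `n ∈ ℤ²`, with wave vector `k = 2πn/L`, and a spin. -/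
abbrev Orbital : Type := (Fin 2 → ℤ) × Fin 2

/-- The wave vector `k = 2πn/L`. -/
def waveVec (q : Orbital) (i : Fin 2) : ℝ := 2 * Real.pi * (q.1 i : ℝ) / P.L

/-- The collective momentum `K = ∑_j k_j`. -/
def totalWaveVec (q : Fin P.N → Orbital) (i : Fin 2) : ℝ := ∑ j, P.waveVec (q j) i

/-- `ε_λ · K`. -/
def polK (q : Fin P.N → Orbital) (l : Fin 2) : ℝ := ∑ i, pol l i * P.totalWaveVec q i

/-- `∑_j ħ² k_j² / (2 m)`. -/
def kinetic (q : Fin P.N → Orbital) : ℝ :=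
  ∑ j, P.hbar ^ 2 * (∑ i, P.waveVec (q j) i ^ 2) / (2 * P.mass)

/-- The plane wave `e^{i k · r} / √S`, `S = L²`, with spin; `fourier n x` is
`e^{2πi n x / L}` on the circle of length `L`. -/
def planeWave (q : Orbital) (r : Fin 2 → AddCircle P.L) (σ : Fin 2) : ℂ :=
  if σ = q.2 then (∏ i, fourier (q.1 i) (r i)) / (Real.sqrt (P.L ^ 2) : ℂ) else 0

/-- The Slater determinant of the single-particle states `q₁, …, q_N`. -/
def slater (q : Fin P.N → Orbital) (x : P.Pos) (s : P.Spins) : ℂ :=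
  (1 / (Real.sqrt (P.N.factorial) : ℂ)) *
    (Matrix.of fun a j => P.planeWave (q a) (x j) (s j)).det

/-- The product of an electronic and a photonic state. -/
def tensor (Φ : P.Pos → P.Spins → ℂ) (χ : Occ → ℂ) : P.Wave := fun x s n => Φ x s * χ n

/-- The dressed photon state `∏_λ |n_λ, ε_λ · K⟩_λ`, for a choice `vac κ` of `|0, κ⟩`. -/
def photonState (vac : ℝ → ℕ → ℂ) (q : Fin P.N → Orbital) (n : Occ) : Occ → ℂ :=
  fun ν => ∏ l : Fin 2, P.dressedState (P.polK q l) (vac (P.polK q l)) (n l) (ν l)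

/-- The energy
`∑_λ [ħ ω̃ (n_λ + 1/2) - (γ/N) (ε_λ · ħ K)² / (2 m)] + ∑_j ħ² k_j² / (2 m)`. -/
def energy (q : Fin P.N → Orbital) (n : Occ) : ℝ :=
  (∑ l : Fin 2, (P.hbar * P.dressedFreq * ((n l : ℝ) + 1 / 2)
      - P.gamma / P.N * ((P.hbar * P.polK q l) ^ 2 / (2 * P.mass)))) + P.kinetic q

/-! ### The Hamiltonian as a differential expression -/

/-- The partial derivative with respect to the `i`-th coordinate of the `j`-th electron. -/
def partialD (j : Fin P.N) (i : Fin 2) (Ψ : P.Wave) : P.Wave := fun x s n =>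
  deriv (fun t : ℝ => Ψ (x + Pi.single j (Pi.single i (t : AddCircle P.L))) s n) 0

/-- A photonic operator acting on a wave function. -/
def act (T : Module.End ℂ (Occ → ℂ)) (Ψ : P.Wave) : P.Wave := fun x s => T (Ψ x s)

/-- The Hamiltonian
`∑_j [-(ħ²/2m) ∇_j² + (i e ħ/m) A · ∇_j] + (N e²/2m) A² + ∑_λ ħ ω (a†_λ a_λ + 1/2)`. -/
def ham (Ψ : P.Wave) : P.Wave :=
  (∑ j, (((-(P.hbar ^ 2 / (2 * P.mass)) : ℝ) : ℂ) • ∑ i, P.partialD j i (P.partialD j i Ψ)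
      + (Complex.I * ((P.charge * P.hbar / P.mass : ℝ) : ℂ)) •
          ∑ i, P.act (P.vecPot i) (P.partialD j i Ψ)))
    + P.act P.photonHam Ψ

/-- The Hamiltonian seen by the photons when the electrons are in the Slater determinant of `q`:
`∑_λ [ħ ω̃ (b†_λ b_λ + 1/2) - g₀ (b_λ + b†_λ) ε_λ · K] + ∑_j ħ² k_j² / (2 m)`. -/
def projHam (q : Fin P.N → Orbital) : Module.End ℂ (Occ → ℂ) :=
  (∑ l : Fin 2, (((P.hbar * P.dressedFreq : ℝ) : ℂ) •
        (onMode l P.bCre * onMode l P.bAnn + (1 / 2 : ℂ) • 1)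
      - ((P.g0 * P.polK q l : ℝ) : ℂ) • (onMode l P.bAnn + onMode l P.bCre)))
    + (P.kinetic q : ℂ) • 1

/-! ### The Hamiltonian on smooth wave functions with finitely many photons -/

/-- The projection `ℝ^{2N} → (ℝ / L ℤ)^{2N}`. -/
def toPos (y : Fin P.N → Fin 2 → ℝ) : P.Pos := fun j i => (y j i : AddCircle P.L)

/-- Wave functions that are smooth in the positions and have boundedly many photons. -/
def IsNice (Ψ : P.Wave) : Prop :=
  (∀ s n, ContDiff ℝ ∞ fun y => Ψ (P.toPos y) s n) ∧ {n | ∃ x s, Ψ x s n ≠ 0}.Finite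

/-- Antisymmetry under the exchange of the electrons (position and spin). -/
def IsAntisymm (Ψ : P.Wave) : Prop :=
  ∀ (π : Equiv.Perm (Fin P.N)) (x : P.Pos) (s : P.Spins) (n : Occ),
    Ψ (fun j => x (π j)) (fun j => s (π j)) n = ((Equiv.Perm.sign π : ℤ) : ℂ) * Ψ x s n

variable {P}

theorem IsNice.add {Ψ Φ : P.Wave} (h : P.IsNice Ψ) (k : P.IsNice Φ) : P.IsNice (Ψ + Φ) := by
  refine ⟨fun s n => (h.1 s n).add (k.1 s n), (h.2.union k.2).subset ?_⟩
  rintro n ⟨x, s, hn⟩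
  by_contra hc
  simp only [Set.mem_union, Set.mem_ofPred_eq, not_or, not_exists, not_not] at hc
  exact hn (by simp [hc.1 x s, hc.2 x s])

theorem IsNice.smul {Ψ : P.Wave} (z : ℂ) (h : P.IsNice Ψ) : P.IsNice (z • Ψ) := by
  refine ⟨fun s n => contDiff_const.mul (h.1 s n), h.2.subset ?_⟩
  rintro n ⟨x, s, hn⟩
  exact ⟨x, s, fun hc => hn (by simp [hc])⟩

theorem isNice_zero : P.IsNice (0 : P.Wave) :=
  ⟨fun _ _ => contDiff_const, by simp⟩

theorem IsNice.sum {ι : Type*} (F : Finset ι) {Ψ : ι → P.Wave} (h : ∀ a, P.IsNice (Ψ a)) :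
    P.IsNice (∑ a ∈ F, Ψ a) :=
  Finset.sum_induction _ P.IsNice (fun _ _ => IsNice.add) isNice_zero fun a _ => h a

theorem toPos_add (y : Fin P.N → Fin 2 → ℝ) (j : Fin P.N) (i : Fin 2) (t : ℝ) :
    P.toPos y + Pi.single j (Pi.single i (t : AddCircle P.L)) =
      P.toPos (y + t • (Pi.single j (Pi.single i 1) : Fin P.N → Fin 2 → ℝ)) := by
  ext a b
  by_cases ha : a = j
  · subst ha
    by_cases hb : b = i
    · subst hb; simp [toPos]
    · simp [toPos, hb]
  · simp [toPos, ha]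

theorem toPos_surjective : Function.Surjective P.toPos := by
  intro x
  choose y hy using fun j i => QuotientAddGroup.mk_surjective (x j i)
  exact ⟨y, by ext j i; exact hy j i⟩

theorem partialD_toPos {Ψ : P.Wave} (h : P.IsNice Ψ) (j : Fin P.N) (i : Fin 2)
    (y : Fin P.N → Fin 2 → ℝ) (s : P.Spins) (n : Occ) :
    HasDerivAt (fun t : ℝ => Ψ (P.toPos y + Pi.single j (Pi.single i (t : AddCircle P.L))) s n)
      (fderiv ℝ (fun y => Ψ (P.toPos y) s n) y (Pi.single j (Pi.single i 1))) 0 := by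
  simp only [toPos_add]
  have h1 : HasFDerivAt (fun y => Ψ (P.toPos y) s n)
      (fderiv ℝ (fun y => Ψ (P.toPos y) s n) y)
      (y + (0 : ℝ) • (Pi.single j (Pi.single i 1) : Fin P.N → Fin 2 → ℝ)) := by
    simpa using ((h.1 s n).differentiable (by simp) y).hasFDerivAt
  have h2 : HasDerivAt (fun t : ℝ => y + t • (Pi.single j (Pi.single i 1) : Fin P.N → Fin 2 → ℝ))
      (Pi.single j (Pi.single i 1)) 0 := by
    simpa using ((hasDerivAt_id (0 : ℝ)).smul_const
      (Pi.single j (Pi.single i 1) : Fin P.N → Fin 2 → ℝ)).const_add y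
  exact h1.comp_hasDerivAt (0 : ℝ) h2

theorem partialD_eq {Ψ : P.Wave} (h : P.IsNice Ψ) (j : Fin P.N) (i : Fin 2)
    (y : Fin P.N → Fin 2 → ℝ) (s : P.Spins) (n : Occ) :
    P.partialD j i Ψ (P.toPos y) s n =
      fderiv ℝ (fun y => Ψ (P.toPos y) s n) y (Pi.single j (Pi.single i 1)) :=
  (partialD_toPos h j i y s n).deriv

theorem IsNice.partialD {Ψ : P.Wave} (h : P.IsNice Ψ) (j : Fin P.N) (i : Fin 2) :
    P.IsNice (P.partialD j i Ψ) := by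
  refine ⟨fun s n => ?_, h.2.subset ?_⟩
  · simp only [partialD_eq h]
    exact ((h.1 s n).fderiv_right (m := ∞) (by simp)).clm_apply contDiff_const
  · rintro n ⟨x, s, hn⟩
    by_contra hc
    simp only [Set.mem_ofPred_eq, not_exists, not_not] at hc
    exact hn (by simp [Params.partialD, hc])

theorem partialD_add {Ψ Φ : P.Wave} (h : P.IsNice Ψ) (k : P.IsNice Φ) (j : Fin P.N) (i : Fin 2) :
    P.partialD j i (Ψ + Φ) = P.partialD j i Ψ + P.partialD j i Φ := by
  ext x s n
  obtain ⟨y, rfl⟩ := toPos_surjective x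
  exact ((partialD_toPos h j i y s n).add (partialD_toPos k j i y s n)).deriv.trans
    (by simp [partialD_eq h, partialD_eq k])

theorem partialD_smul (z : ℂ) (Ψ : P.Wave) (j : Fin P.N) (i : Fin 2) :
    P.partialD j i (z • Ψ) = z • P.partialD j i Ψ := by
  ext x s n
  simp [Params.partialD]

theorem act_add_wave (T : Module.End ℂ (Occ → ℂ)) (Ψ Φ : P.Wave) :
    P.act T (Ψ + Φ) = P.act T Ψ + P.act T Φ := by
  ext x s n
  exact congrFun (T.map_add (Ψ x s) (Φ x s)) n

theorem act_smul_wave (T : Module.End ℂ (Occ → ℂ)) (z : ℂ) (Ψ : P.Wave) :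
    P.act T (z • Ψ) = z • P.act T Ψ := by
  ext x s n
  exact congrFun (T.map_smul z (Ψ x s)) n

variable (P) in
/-- The photonic operators that preserve nice wave functions. -/
def preserving : Subalgebra ℂ (Module.End ℂ (Occ → ℂ)) where
  carrier := {T | ∀ Ψ, P.IsNice Ψ → P.IsNice (P.act T Ψ)}
  mul_mem' hS hT Ψ h := hS _ (hT Ψ h)
  add_mem' hS hT Ψ h := (hS Ψ h).add (hT Ψ h)
  algebraMap_mem' z _ h := h.smul z

theorem onMode_ann_mem (l : Fin 2) : onMode l ann ∈ P.preserving := by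
  intro Ψ h
  refine ⟨fun s n => contDiff_const.mul (h.1 s _), ?_⟩
  refine (h.2.image fun m => Function.update m l (m l - 1)).subset ?_
  rintro n ⟨x, s, hn⟩
  refine ⟨Function.update n l (n l + 1), ⟨x, s, fun hc => hn ?_⟩, by simp⟩
  simp [act, onMode, ann, hc]

theorem onMode_cre_mem (l : Fin 2) : onMode l cre ∈ P.preserving := by
  intro Ψ h
  refine ⟨fun s n => contDiff_const.mul (h.1 s _), ?_⟩
  refine (h.2.image fun m => Function.update m l (m l + 1)).subset ?_
  rintro n ⟨x, s, hn⟩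
  have hn0 : n l ≠ 0 := fun hc => hn (by simp [act, onMode, cre, hc])
  refine ⟨Function.update n l (n l - 1), ⟨x, s, fun hc => hn ?_⟩, ?_⟩
  · simp [act, onMode, cre, hc]
  · simp [Nat.sub_add_cancel (Nat.pos_of_ne_zero hn0)]

theorem vecPot_mem (i : Fin 2) : P.vecPot i ∈ P.preserving :=
  Subalgebra.smul_mem _ (Subalgebra.sum_mem _ fun l _ => Subalgebra.smul_mem _
    (Subalgebra.add_mem _ (onMode_ann_mem l) (onMode_cre_mem l)) _) _

theorem photonHam_mem : P.photonHam ∈ P.preserving :=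
  Subalgebra.add_mem _
    (Subalgebra.smul_mem _ (Subalgebra.sum_mem _ fun i _ =>
      Subalgebra.mul_mem _ (vecPot_mem i) (vecPot_mem i)) _)
    (Subalgebra.sum_mem _ fun l _ => Subalgebra.smul_mem _ (Subalgebra.add_mem _
      (Subalgebra.mul_mem _ (onMode_cre_mem l) (onMode_ann_mem l))
      (Subalgebra.smul_mem _ (Subalgebra.one_mem _) _)) _)

theorem IsNice.ham {Ψ : P.Wave} (h : P.IsNice Ψ) : P.IsNice (P.ham Ψ) :=
  (IsNice.sum _ fun j => ((IsNice.sum _ fun i => (h.partialD j i).partialD j i).smul _).add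
    ((IsNice.sum _ fun i => vecPot_mem i _ (h.partialD j i)).smul _)).add (photonHam_mem _ h)

theorem ham_add {Ψ Φ : P.Wave} (h : P.IsNice Ψ) (k : P.IsNice Φ) :
    P.ham (Ψ + Φ) = P.ham Ψ + P.ham Φ := by
  simp only [Params.ham, partialD_add h k, act_add_wave,
    fun j i => partialD_add (h.partialD j i) (k.partialD j i) j i, Finset.sum_add_distrib, smul_add]
  abel

theorem ham_smul (z : ℂ) (Ψ : P.Wave) : P.ham (z • Ψ) = z • P.ham Ψ := by
  simp only [Params.ham, partialD_smul, act_smul_wave, smul_add, Finset.smul_sum, smul_comm z]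

theorem partialD_perm {Ψ : P.Wave} (h : P.IsAntisymm Ψ) (j : Fin P.N) (i : Fin 2)
    (π : Equiv.Perm (Fin P.N)) (x : P.Pos) (s : P.Spins) (n : Occ) :
    P.partialD j i Ψ (fun a => x (π a)) (fun a => s (π a)) n =
      ((Equiv.Perm.sign π : ℤ) : ℂ) * P.partialD (π j) i Ψ x s n := by
  have e (t : ℝ) : (fun a => x (π a)) + Pi.single j (Pi.single i (t : AddCircle P.L)) =
      fun a => (x + Pi.single (π j) (Pi.single i (t : AddCircle P.L)) : P.Pos) (π a) := by
    ext a b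
    simp [Pi.single_apply]
  simp only [Params.partialD, e, h π]
  simp

theorem act_perm (T : Module.End ℂ (Occ → ℂ)) {Ψ Φ : P.Wave} (π : Equiv.Perm (Fin P.N))
    (x : P.Pos) (s : P.Spins)
    (h : ∀ n, Ψ (fun a => x (π a)) (fun a => s (π a)) n =
      ((Equiv.Perm.sign π : ℤ) : ℂ) * Φ x s n) (n : Occ) :
    P.act T Ψ (fun a => x (π a)) (fun a => s (π a)) n =
      ((Equiv.Perm.sign π : ℤ) : ℂ) * P.act T Φ x s n := by
  have e : Ψ (fun a => x (π a)) (fun a => s (π a)) =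
      ((Equiv.Perm.sign π : ℤ) : ℂ) • Φ x s := by
    ext n
    simpa using h n
  simp only [act, e, map_smul]
  simp

theorem partialD_partialD_perm {Ψ : P.Wave} (h : P.IsAntisymm Ψ) (j : Fin P.N) (i : Fin 2)
    (π : Equiv.Perm (Fin P.N)) (x : P.Pos) (s : P.Spins) (n : Occ) :
    P.partialD j i (P.partialD j i Ψ) (fun a => x (π a)) (fun a => s (π a)) n =
      ((Equiv.Perm.sign π : ℤ) : ℂ) * P.partialD (π j) i (P.partialD (π j) i Ψ) x s n := by
  have e (t : ℝ) : (fun a => x (π a)) + Pi.single j (Pi.single i (t : AddCircle P.L)) =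
      fun a => (x + Pi.single (π j) (Pi.single i (t : AddCircle P.L)) : P.Pos) (π a) := by
    ext a b
    simp [Pi.single_apply]
  conv_lhs => rw [Params.partialD]
  simp only [e, partialD_perm h]
  simp [Params.partialD]

theorem IsAntisymm.ham {Ψ : P.Wave} (h : P.IsAntisymm Ψ) : P.IsAntisymm (P.ham Ψ) := by
  intro π x s n
  simp only [Params.ham, Pi.add_apply, Finset.sum_apply, Pi.smul_apply, smul_eq_mul, mul_add,
    partialD_partialD_perm h, act_perm _ π x s (h π x s),
    fun j i T => act_perm T π x s (fun n => partialD_perm h j i π x s n), ← Finset.mul_sum]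
  congr 1
  rw [Finset.mul_sum]
  refine Eq.trans ?_ (Equiv.sum_comp π _)
  refine Finset.sum_congr rfl fun j _ => ?_
  ring

variable (P)

/-- The core: nice antisymmetric wave functions. -/
def core : Submodule ℂ P.Wave where
  carrier := {Ψ | P.IsNice Ψ ∧ P.IsAntisymm Ψ}
  zero_mem' := ⟨isNice_zero, fun _ _ _ _ => by simp⟩
  add_mem' h k := ⟨h.1.add k.1, fun π x s n => by
    simp [h.2 π x s n, k.2 π x s n, mul_add]⟩
  smul_mem' z Ψ h := ⟨h.1.smul z, fun π x s n => by
    simp [h.2 π x s n, mul_left_comm]⟩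

/-- The Hamiltonian on the core. -/
def hamCore : P.core →ₗ[ℂ] P.core where
  toFun Ψ := ⟨P.ham Ψ, Ψ.2.1.ham, Ψ.2.2.ham⟩
  map_add' Ψ Φ := Subtype.ext (ham_add Ψ.2.1 Φ.2.1)
  map_smul' z Ψ := Subtype.ext (ham_smul z Ψ.1)

/-! ### The Hilbert space and the Hamiltonian as an unbounded operator -/

/-- The configurations `(r, σ, n)`: positions, spins, photon numbers. -/
abbrev Conf : Type := P.Pos × P.Spins × Occ

/-- Lebesgue measure in the positions, counting measure in spins and photon numbers. -/
def confMeasure : Measure P.Conf := (volume : Measure P.Pos).prod Measure.count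

/-- Exchange of electrons. -/
def permConf (π : Equiv.Perm (Fin P.N)) (z : P.Conf) : P.Conf :=
  (fun j => z.1 (π j), fun j => z.2.1 (π j), z.2.2)

theorem measurePreserving_permConf (π : Equiv.Perm (Fin P.N)) :
    MeasurePreserving (P.permConf π) P.confMeasure P.confMeasure := by
  have h1 : MeasurePreserving (fun (x : P.Pos) (j : Fin P.N) => x (π j)) volume volume := by
    have := volume_measurePreserving_piCongrLeft
      (fun _ : Fin P.N => Fin 2 → AddCircle P.L) π.symm
    convert this using 1
    ext x j : 2
    conv_rhs => rw [← π.symm_apply_apply j, MeasurableEquiv.coe_piCongrLeft,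
      Equiv.piCongrLeft_apply_apply]
  let e : P.Spins × Occ ≃ P.Spins × Occ := (Equiv.arrowCongr π.symm (Equiv.refl _)).prodCongr
    (Equiv.refl _)
  have h2 : MeasurePreserving (fun d : P.Spins × Occ => ((fun j => d.1 (π j), d.2) : P.Spins × Occ))
      Measure.count Measure.count := by
    refine ⟨.of_discrete, ?_⟩
    ext A hA
    rw [Measure.map_apply .of_discrete hA]
    change Measure.count (e ⁻¹' A) = _
    rw [← e.image_symm_eq_preimage, Measure.count_injective_image e.symm.injective]
  exact h1.prod h2

/-- The Hilbert space: square-integrable wave functions that are antisymmetric under the exchange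
of electrons. -/
def hilbert : Submodule ℂ (Lp ℂ 2 P.confMeasure) where
  carrier := {f | ∀ π, (fun z => f (P.permConf π z)) =ᵐ[P.confMeasure]
    fun z => ((Equiv.Perm.sign π : ℤ) : ℂ) * f z}
  zero_mem' π := by
    have h0 := Lp.coeFn_zero ℂ 2 P.confMeasure
    filter_upwards [h0, (P.measurePreserving_permConf π).quasiMeasurePreserving.ae h0] with z h1 h2
    exact h2.trans ((mul_zero _).symm.trans (congrArg _ h1.symm))
  add_mem' {f g} hf hg π := by
    have h0 := Lp.coeFn_add f g
    filter_upwards [h0, (P.measurePreserving_permConf π).quasiMeasurePreserving.ae h0,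
      hf π, hg π] with z h1 h2 h3 h4
    refine h2.trans (Eq.trans ?_ (congrArg _ h1.symm))
    simp only [Pi.add_apply, h3, h4, mul_add]
  smul_mem' c f hf π := by
    have h0 := Lp.coeFn_smul c f
    filter_upwards [h0, (P.measurePreserving_permConf π).quasiMeasurePreserving.ae h0,
      hf π] with z h1 h2 h3
    simp [h1, h2, h3, mul_left_comm]

instance : CompleteSpace P.hilbert := by
  refine IsClosed.completeSpace_coe (hs := ?_)
  have : (P.hilbert : Set (Lp ℂ 2 P.confMeasure)) =
      ⋂ π : Equiv.Perm (Fin P.N), {f | Lp.compMeasurePreserving (P.permConf π)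
        (P.measurePreserving_permConf π) f = ((Equiv.Perm.sign π : ℤ) : ℂ) • f} := by
    ext f
    simp only [Set.mem_iInter, Set.mem_ofPred_eq, SetLike.mem_coe]
    refine forall_congr' fun π => ?_
    rw [Lp.ext_iff]
    have h1 := Lp.coeFn_compMeasurePreserving f (P.measurePreserving_permConf π)
    have h2 := Lp.coeFn_smul ((Equiv.Perm.sign π : ℤ) : ℂ) f
    exact ⟨fun h => h1.trans (h.trans h2.symm), fun h => h1.symm.trans (h.trans h2)⟩
  rw [this]
  exact isClosed_iInter fun π => isClosed_eq
    (Lp.isometry_compMeasurePreserving _).continuous (continuous_const_smul _)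

/-- A wave function on configuration space. -/
def onConf (Ψ : P.Wave) (z : P.Conf) : ℂ := Ψ z.1 z.2.1 z.2.2

variable {P}

theorem IsNice.continuous {Ψ : P.Wave} (h : P.IsNice Ψ) (s : P.Spins) (n : Occ) :
    Continuous fun x => Ψ x s n := by
  have hq : IsOpenQuotientMap P.toPos :=
    IsOpenQuotientMap.piMap fun _ => IsOpenQuotientMap.piMap fun _ =>
      QuotientAddGroup.isOpenQuotientMap_mk
  exact hq.continuous_comp_iff.1 (h.1 s n).continuous

theorem IsNice.memLp {Ψ : P.Wave} (h : P.IsNice Ψ) : MemLp (P.onConf Ψ) 2 P.confMeasure := by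
  have hm : Measurable (P.onConf Ψ) :=
    measurable_from_prod_countable_left fun d => (h.continuous d.1 d.2).measurable
  have hb : ∀ d : P.Spins × Occ, ∃ C, ∀ x, ‖Ψ x d.1 d.2‖ ≤ C := fun d => by
    obtain ⟨C, hC⟩ := isCompact_univ.exists_bound_of_continuousOn
      (h.continuous d.1 d.2).continuousOn
    exact ⟨C, fun x => hC x trivial⟩
  choose C hC using hb
  have hF : ((Set.univ : Set P.Spins) ×ˢ {n | ∃ x s, Ψ x s n ≠ 0}).Finite :=
    Set.finite_univ.prod h.2
  set F : Set (P.Spins × Occ) := (Set.univ : Set P.Spins) ×ˢ {n | ∃ x s, Ψ x s n ≠ 0} with hFd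
  let M : ℝ := ∑ d ∈ hF.toFinset, |C d|
  have hg : MemLp (Set.indicator ((Set.univ : Set P.Pos) ×ˢ F) fun _ => M) 2 P.confMeasure := by
    refine memLp_indicator_const 2 (MeasurableSet.univ.prod .of_discrete) M (Or.inr ?_)
    rw [confMeasure, Measure.prod_prod]
    exact ENNReal.mul_ne_top (measure_ne_top _ _)
      ((Measure.count_apply_lt_top.2 hF).ne)
  refine hg.mono hm.aestronglyMeasurable (Filter.Eventually.of_forall ?_)
  rintro ⟨x, d⟩
  by_cases hd : d ∈ F
  · rw [Set.indicator_of_mem (by exact ⟨trivial, hd⟩)]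
    calc ‖P.onConf Ψ (x, d)‖ ≤ C d := hC d x
      _ ≤ |C d| := le_abs_self _
      _ ≤ M := Finset.single_le_sum (f := fun d => |C d|) (fun _ _ => abs_nonneg _)
          (hF.mem_toFinset.2 hd)
      _ ≤ ‖M‖ := le_abs_self _
  · have : Ψ x d.1 d.2 = 0 := by
      by_contra hc
      exact hd ⟨trivial, x, d.1, hc⟩
    simp [onConf, this]

variable (P)

/-- The core as a subspace of the Hilbert space. -/
def toHilbert : P.core →ₗ[ℂ] P.hilbert where
  toFun Ψ := ⟨Ψ.2.1.memLp.toLp _, fun π => by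
    have h0 := Ψ.2.1.memLp.coeFn_toLp
    filter_upwards [h0, (P.measurePreserving_permConf π).quasiMeasurePreserving.ae h0] with z h1 h2
    rw [h1, h2]
    exact Ψ.2.2 π z.1 z.2.1 z.2.2⟩
  map_add' _ _ := rfl
  map_smul' _ _ := rfl

theorem toHilbert_injective : Function.Injective P.toHilbert := by
  rw [injective_iff_map_eq_zero]
  intro Ψ h0
  have h1 : P.onConf Ψ =ᵐ[P.confMeasure] 0 := by
    have h2 : (Ψ.2.1.memLp.toLp _ : Lp ℂ 2 P.confMeasure) = 0 := congrArg Subtype.val h0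
    exact Ψ.2.1.memLp.coeFn_toLp.symm.trans (h2 ▸ Lp.coeFn_zero ℂ 2 P.confMeasure)
  have h2 : ∀ᵐ x : P.Pos, ∀ d : P.Spins × Occ, Ψ.1 x d.1 d.2 = 0 := by
    filter_upwards [Measure.ae_ae_of_ae_prod h1] with x hx
    exact (Measure.ae_count_iff.1 hx)
  ext x s n
  have h3 : (fun x => Ψ.1 x s n) =ᵐ[volume] fun _ => 0 := by
    filter_upwards [h2] with x hx using hx (s, n)
  exact congrFun ((Continuous.ae_eq_iff_eq volume (Ψ.2.1.continuous s n) continuous_const).1 h3) x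

/-- The Hamiltonian on the core, as an operator with the core as its domain. -/
def hamMin : P.hilbert →ₗ.[ℂ] P.hilbert where
  domain := LinearMap.range P.toHilbert
  toFun := P.toHilbert ∘ₗ P.hamCore ∘ₗ
    (LinearEquiv.ofInjective P.toHilbert P.toHilbert_injective).symm.toLinearMap

/-- The Hamiltonian operator: the closure of the Hamiltonian on the core. -/
def hamOp : P.hilbert →ₗ.[ℂ] P.hilbert := P.hamMin.closure

/-- The element `f` of the Hilbert space is (the class of) the wave function `Ψ`. -/
def Represents (f : P.hilbert) (Ψ : P.Wave) : Prop :=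
  (f : Lp ℂ 2 P.confMeasure) =ᵐ[P.confMeasure] P.onConf Ψ

/-- `f` lies in the domain of the Hamiltonian and `H f = E f`. -/
def IsEigen (E : ℂ) (f : P.hilbert) : Prop :=
  ∃ h : f ∈ P.hamOp.domain, P.hamOp ⟨f, h⟩ = E • f

end Params

end

end CavityQED

open CavityQED CavityQED.Params

/-! The coupling is bilinear in the momenta and the field, and momenta are diagonal on plane waves.
On a Slater determinant `H` therefore reduces to a photon operator, `projHam q`, in which the
electrons enter only through `K` and the kinetic energy (`ham_tensor_slater`). This operator is
quadratic plus linear in the ladder operators. The Bogoliubov transformation absorbs the `A²` term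
into the frequency, and completing the square absorbs the linear term into a displacement
(`cre_mul_ann_dressed`, `number_shift`). What remains is a shifted number operator, whose
eigenstates are obtained by the usual ladder argument from a vacuum.

The operators `b`, `c` and their formal adjoints all have the form `squeeze x y s`, that is `x a + y
a† - s`; the conjugate exchanges `x` and `y`, and `x² - y² = 1` gives the commutator. The vacuum
solves a three-term recursion and decays geometrically because `|y| < x`. All photon analysis takes
place among rapidly decreasing sequences, where the ladder operators are everywhere defined,
formally adjoint and continuous, so no domain question arises.

Completeness of the dressed number states uses the symmetry of the situation: `a` is a `squeeze` of
`c` and `c†` (`ann_eq_squeeze`), so the same existence result for the vacuum expresses the bare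
vacuum, and then every bare number state, as a convergent series of dressed states
(`exists_superpose_eq_single`). On the electron side, completeness is Fourier analysis on the torus
together with antisymmetry (`eq_zero_of_coef`).

The operator theory is soft. If an operator acts diagonally in the weak sense against a Hilbert
basis, and the basis vectors with their images lie in the closure of its graph, then its closure is
the maximal diagonal operator with real eigenvalues (`graph_closure_eq_diagonalGraph`). That
operator is self-adjoint and has no further eigenvalues. The weak relation comes from integration by
parts on the torus (`waveCoef_ham`, `inner_slaterVec_hamCore`). Membership in the closure comes from
cutting off large photon numbers (`mem_closure_graph_hamMin`), which is needed because the dressed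
states need not have finitely many bare photons and so need not lie in the core. -/

namespace CavityQED

/-! ### Diagonal unbounded operators in a Hilbert basis. -/

section Diagonal

variable {H ι : Type*} [NormedAddCommGroup H] [InnerProductSpace ℂ H]

local notation "⟪" x ", " y "⟫" => inner ℂ x y

/-- The graph of the diagonal operator with eigenvalues `E` in the Hilbert basis `B`. -/
def diagonalGraph (B : HilbertBasis ι ℂ H) (E : ι → ℝ) : Submodule ℂ (H × H) where
  carrier := {p | ∀ i, ⟪B i, p.2⟫ = E i * ⟪B i, p.1⟫}
  zero_mem' i := by simp
  add_mem' h k i := by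
    rw [Prod.snd_add, Prod.fst_add, inner_add_right, inner_add_right, h i, k i, mul_add]
  smul_mem' c p h i := by
    change ⟪B i, c • p.2⟫ = E i * ⟪B i, c • p.1⟫
    rw [inner_smul_right, inner_smul_right, h i]; ring

variable {B : HilbertBasis ι ℂ H} {E : ι → ℝ}

theorem mem_diagonalGraph {p : H × H} :
    p ∈ diagonalGraph B E ↔ ∀ i, ⟪B i, p.2⟫ = E i * ⟪B i, p.1⟫ := Iff.rfl

theorem isClosed_diagonalGraph : IsClosed (diagonalGraph B E : Set (H × H)) := by
  have : (diagonalGraph B E : Set (H × H)) =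
      ⋂ i, {p : H × H | ⟪B i, p.2⟫ = E i * ⟪B i, p.1⟫} := by
    ext p; simp [mem_diagonalGraph]
  rw [this]
  exact isClosed_iInter fun i => isClosed_eq (by fun_prop) (by fun_prop)

theorem _root_.HilbertBasis.eq_of_inner_eq (B : HilbertBasis ι ℂ H) {x y : H}
    (h : ∀ i, ⟪B i, x⟫ = ⟪B i, y⟫) : x = y := by
  apply B.repr.injective
  ext i
  rw [B.repr_apply_apply, B.repr_apply_apply, h]

theorem diagonalGraph_snd_eq_zero {p : H × H} (h : p ∈ diagonalGraph B E) (h0 : p.1 = 0) :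
    p.2 = 0 :=
  B.eq_of_inner_eq fun i => by rw [h i, h0]; simp

theorem basis_mem_diagonalGraph (i : ι) : (B i, (E i : ℂ) • B i) ∈ diagonalGraph B E := by
  classical
  intro j
  rw [inner_smul_right, orthonormal_iff_ite.1 B.orthonormal]
  by_cases h : j = i <;> simp [h]

variable {T : H →ₗ.[ℂ] H}

/-- The basis expansions of `x` and `y` converge simultaneously, and for a pair in the diagonal
graph each partial sum is a linear combination of the pairs `(B i, E i • B i)`. Hence these pairs
already generate the maximal diagonal graph. -/
theorem closure_graph_eq_diagonalGraph (hT : T.graph ≤ diagonalGraph B E)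
    (hB : ∀ i, (B i, (E i : ℂ) • B i) ∈ T.graph.topologicalClosure) :
    T.graph.topologicalClosure = diagonalGraph B E := by
  refine le_antisymm (Submodule.topologicalClosure_minimal _ hT isClosed_diagonalGraph) ?_
  rintro ⟨x, y⟩ h
  have h1 := (B.hasSum_repr x).prodMk (B.hasSum_repr y)
  refine (Submodule.isClosed_topologicalClosure _).mem_of_tendsto h1
    (Filter.Eventually.of_forall fun s => ?_)
  refine Submodule.sum_mem _ fun i _ => ?_
  have h2 : B.repr y i = E i * B.repr x i := by
    rw [B.repr_apply_apply, B.repr_apply_apply]; exact h i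
  have h3 : (B.repr x i • B i, B.repr y i • B i) =
      B.repr x i • (B i, (E i : ℂ) • B i) := by
    rw [h2, Prod.smul_mk, smul_smul, mul_comm]
  simpa only [h3] using Submodule.smul_mem _ _ (hB i)

/-- The diagonal graph is closed and single-valued, so the closure of a graph inside it is again a
graph. -/
theorem isClosable_of_diagonal (hT : T.graph ≤ diagonalGraph B E) : T.IsClosable := by
  refine ⟨T.graph.topologicalClosure.toLinearPMap, ?_⟩
  rw [Submodule.toLinearPMap_graph_eq]
  intro p hp h0
  exact diagonalGraph_snd_eq_zero
    (Submodule.topologicalClosure_minimal _ hT isClosed_diagonalGraph hp) h0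

theorem graph_closure_eq_diagonalGraph (hT : T.graph ≤ diagonalGraph B E)
    (hB : ∀ i, (B i, (E i : ℂ) • B i) ∈ T.graph.topologicalClosure) :
    T.closure.graph = diagonalGraph B E :=
  (isClosable_of_diagonal hT).graph_closure_eq_closure_graph.symm.trans
    (closure_graph_eq_diagonalGraph hT hB)

/-- Testing an element of the adjoint against the basis pairs gives the diagonal relation, since `E`
is real. The converse is Parseval's identity, compared term by term. -/
theorem diagonalGraph_adjoint : (diagonalGraph B E).adjoint = diagonalGraph B E := by
  ext ⟨x, y⟩
  rw [Submodule.mem_adjoint_iff]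
  constructor
  · intro h i
    have := h _ _ (basis_mem_diagonalGraph (B := B) (E := E) i)
    rw [inner_smul_left, Complex.conj_ofReal] at this
    exact (sub_eq_zero.1 this).symm
  · intro h a b hab
    rw [sub_eq_zero, ← B.tsum_inner_mul_inner, ← B.tsum_inner_mul_inner]
    refine tsum_congr fun i => ?_
    have h1 : ⟪b, B i⟫ = E i * ⟪a, B i⟫ := by
      rw [← inner_conj_symm b, ← inner_conj_symm a, hab i]; simp
    rw [h1, h i]; ring

theorem isSelfAdjoint_of_graph_eq_diagonalGraph [CompleteSpace H] {A : H →ₗ.[ℂ] H}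
    (hA : A.graph = diagonalGraph B E) : IsSelfAdjoint A := by
  have hd : Dense (A.domain : Set H) := by
    have h1 : Submodule.span ℂ (Set.range B) ≤ A.domain := by
      rw [Submodule.span_le]
      rintro _ ⟨i, rfl⟩
      have h2 : (B i, (E i : ℂ) • B i) ∈ A.graph := hA ▸ basis_mem_diagonalGraph i
      exact LinearPMap.mem_domain_of_mem_graph h2
    exact (Submodule.dense_iff_topologicalClosure_eq_top.2 B.dense_span).mono h1
  rw [LinearPMap.isSelfAdjoint_def]
  apply LinearPMap.eq_of_eq_graph
  rw [LinearPMap.adjoint_graph_eq_graph_adjoint hd, hA, diagonalGraph_adjoint]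

/-- A nonzero vector has a nonzero coefficient `⟪B i, x⟫`, and cancelling it in the diagonal
relation at `i` leaves `z = E i`. -/
theorem exists_eq_of_smul_mem_diagonalGraph {x : H} {z : ℂ} (hx : x ≠ 0)
    (h : (x, z • x) ∈ diagonalGraph B E) : ∃ i, z = E i := by
  by_contra! hc
  refine hx (B.eq_of_inner_eq fun i => ?_)
  have h1 : z * ⟪B i, x⟫ = E i * ⟪B i, x⟫ := by rw [← inner_smul_right]; exact h i
  rw [inner_zero_right]
  by_contra h2
  exact hc i (mul_right_cancel₀ h2 h1)

end Diagonal

end CavityQED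

namespace CavityQED

/-! ### Rapidly decreasing sequences and formal adjoints on them. -/

section RapidDecay

open scoped ComplexConjugate

/-- An index type with a size function such that some power of the size has a summable inverse. -/
class HasSize (ι : Type*) where
  size : ι → ℕ
  exists_summable : ∃ p : ℕ, Summable fun i => (((size i : ℝ) + 1) ^ p)⁻¹

variable {ι : Type*} [HasSize ι]

/-- The weight `size + 1`. -/
def weight (i : ι) : ℝ := (HasSize.size i : ℝ) + 1

theorem one_le_weight (i : ι) : 1 ≤ weight i := by simp [weight]

theorem weight_pos (i : ι) : 0 < weight i := zero_lt_one.trans_le (one_le_weight i)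

/-- Sequences all of whose polynomially weighted sup-norms are finite. -/
def RapidDecay (f : ι → ℂ) : Prop := ∀ k : ℕ, ∃ B, ∀ i, weight i ^ k * ‖f i‖ ≤ B

theorem weight_pow_mul_le {f : ι → ℂ} {k k' : ℕ} (h : k ≤ k') {B : ℝ}
    (hf : ∀ i, weight i ^ k' * ‖f i‖ ≤ B) (i : ι) : weight i ^ k * ‖f i‖ ≤ B :=
  (mul_le_mul_of_nonneg_right (pow_le_pow_right₀ (one_le_weight i) h) (norm_nonneg _)).trans (hf i)

/-- Linear maps that are bounded with respect to the weighted sup-norms. -/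
def tempered (ι : Type*) [HasSize ι] : Subalgebra ℂ (Module.End ℂ (ι → ℂ)) where
  carrier := {T | ∀ k : ℕ, ∃ (k' : ℕ) (C : ℝ), ∀ (f : ι → ℂ) (B : ℝ),
    (∀ i, weight i ^ k' * ‖f i‖ ≤ B) → ∀ i, weight i ^ k * ‖T f i‖ ≤ C * B}
  mul_mem' {S T} hS hT k := by
    obtain ⟨k1, C1, h1⟩ := hS k
    obtain ⟨k2, C2, h2⟩ := hT k1
    exact ⟨k2, C1 * C2, fun f B hf i => by rw [mul_assoc]; exact h1 _ _ (h2 f B hf) i⟩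
  add_mem' {S T} hS hT k := by
    obtain ⟨k1, C1, h1⟩ := hS k
    obtain ⟨k2, C2, h2⟩ := hT k
    refine ⟨max k1 k2, C1 + C2, fun f B hf i => ?_⟩
    have e1 := h1 f B (weight_pow_mul_le (le_max_left _ _) hf) i
    have e2 := h2 f B (weight_pow_mul_le (le_max_right _ _) hf) i
    rw [add_mul]
    refine le_trans ?_ (add_le_add e1 e2)
    rw [← mul_add]
    exact mul_le_mul_of_nonneg_left (norm_add_le _ _) (pow_nonneg (weight_pos i).le _)
  algebraMap_mem' z k := by
    refine ⟨k, ‖z‖, fun f B hf i => ?_⟩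
    rw [Module.algebraMap_end_apply, Pi.smul_apply, norm_smul, mul_left_comm]
    exact mul_le_mul_of_nonneg_left (hf i) (norm_nonneg z)

theorem RapidDecay.map {T : Module.End ℂ (ι → ℂ)} (hT : T ∈ tempered ι) {f : ι → ℂ}
    (hf : RapidDecay f) : RapidDecay (T f) := by
  intro k
  obtain ⟨k', C, h⟩ := hT k
  obtain ⟨B, hB⟩ := hf k'
  exact ⟨C * B, h f B hB⟩

theorem RapidDecay.add {f g : ι → ℂ} (hf : RapidDecay f) (hg : RapidDecay g) :
    RapidDecay (f + g) := by
  intro k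
  obtain ⟨B, hB⟩ := hf k
  obtain ⟨D, hD⟩ := hg k
  refine ⟨B + D, fun i => le_trans ?_ (add_le_add (hB i) (hD i))⟩
  rw [← mul_add]
  exact mul_le_mul_of_nonneg_left (norm_add_le _ _) (pow_nonneg (weight_pos i).le _)

theorem RapidDecay.smul {f : ι → ℂ} (z : ℂ) (hf : RapidDecay f) : RapidDecay (z • f) := by
  have := hf.map ((tempered ι).algebraMap_mem z)
  rwa [Module.algebraMap_end_apply] at this

theorem RapidDecay.of_finite {f : ι → ℂ} (hf : {i | f i ≠ 0}.Finite) : RapidDecay f := by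
  intro k
  refine ⟨∑ i ∈ hf.toFinset, weight i ^ k * ‖f i‖, fun i => ?_⟩
  have hp : ∀ j : ι, 0 ≤ weight j ^ k * ‖f j‖ := fun j =>
    mul_nonneg (pow_nonneg (weight_pos j).le _) (norm_nonneg _)
  by_cases h : f i = 0
  · rw [h, norm_zero, mul_zero]
    exact Finset.sum_nonneg fun j _ => hp j
  · exact Finset.single_le_sum (f := fun j => weight j ^ k * ‖f j‖) (fun j _ => hp j)
      (hf.mem_toFinset.2 h)

theorem exists_summable_weight (ι : Type*) [HasSize ι] :
    ∃ p : ℕ, Summable fun i : ι => (weight i ^ p)⁻¹ :=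
  HasSize.exists_summable

theorem RapidDecay.summable {f : ι → ℂ} (hf : RapidDecay f) : Summable fun i => ‖f i‖ := by
  obtain ⟨p, hp⟩ := exists_summable_weight ι
  obtain ⟨B, hB⟩ := hf p
  refine Summable.of_nonneg_of_le (fun i => norm_nonneg _) (fun i => ?_) (hp.mul_left B)
  rw [← div_eq_mul_inv, le_div_iff₀' (pow_pos (weight_pos i) p)]
  exact hB i

theorem RapidDecay.mul {f g : ι → ℂ} (hf : RapidDecay f) (hg : RapidDecay g) :
    RapidDecay fun i => f i * g i := by
  intro k
  obtain ⟨B, hB⟩ := hf k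
  obtain ⟨D, hD⟩ := hg 0
  refine ⟨B * D, fun i => ?_⟩
  rw [norm_mul, ← mul_assoc]
  refine mul_le_mul (hB i) (by simpa using hD i) (norm_nonneg _) ?_
  exact (mul_nonneg (pow_nonneg (weight_pos i).le _) (norm_nonneg _)).trans (hB i)

theorem RapidDecay.conj {f : ι → ℂ} (hf : RapidDecay f) : RapidDecay fun i => conj (f i) := by
  simpa [RapidDecay] using hf

theorem RapidDecay.summable_sq {f : ι → ℂ} (hf : RapidDecay f) :
    Summable fun i => ‖f i‖ ^ 2 := by
  refine (hf.mul hf).summable.congr fun i => ?_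
  rw [norm_mul, sq]

/-- The sesquilinear pairing `∑ conj (f i) * g i`. -/
noncomputable def pair {ι : Type*} (f g : ι → ℂ) : ℂ := ∑' i, conj (f i) * g i

theorem summable_pair {f g : ι → ℂ} (hf : RapidDecay f) (hg : RapidDecay g) :
    Summable fun i => conj (f i) * g i :=
  (hf.conj.mul hg).summable.of_norm

theorem pair_conj {ι : Type*} (f g : ι → ℂ) : conj (pair f g) = pair g f := by
  rw [pair, pair, Complex.conj_tsum]
  exact tsum_congr fun i => by simp [mul_comm]

theorem pair_smul_left {ι : Type*} (z : ℂ) (f g : ι → ℂ) :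
    pair (z • f) g = conj z * pair f g := by
  rw [pair, pair, ← tsum_mul_left]
  exact tsum_congr fun i => by simp [mul_assoc]

theorem pair_smul_right {ι : Type*} (z : ℂ) (f g : ι → ℂ) :
    pair f (z • g) = z * pair f g := by
  rw [pair, pair, ← tsum_mul_left]
  exact tsum_congr fun i => by simp [mul_left_comm]

theorem pair_add_left {f f' g : ι → ℂ} (hf : RapidDecay f) (hf' : RapidDecay f')
    (hg : RapidDecay g) : pair (f + f') g = pair f g + pair f' g := by
  rw [pair, pair, pair, ← (summable_pair hf hg).tsum_add (summable_pair hf' hg)]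
  exact tsum_congr fun i => by simp [add_mul]

theorem pair_add_right {f g g' : ι → ℂ} (hf : RapidDecay f) (hg : RapidDecay g)
    (hg' : RapidDecay g') : pair f (g + g') = pair f g + pair f g' := by
  rw [pair, pair, pair, ← (summable_pair hf hg).tsum_add (summable_pair hf hg')]
  exact tsum_congr fun i => by simp [mul_add]

theorem pair_self_eq {ι : Type*} (f : ι → ℂ) : pair f f = ((∑' i, ‖f i‖ ^ 2 : ℝ) : ℂ) := by
  rw [pair, Complex.ofReal_tsum]
  exact tsum_congr fun i => by rw [RCLike.conj_mul]; simp

/-- `T` and `S` are tempered and formally adjoint to each other. -/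
structure IsAdj (T S : Module.End ℂ (ι → ℂ)) : Prop where
  left : T ∈ tempered ι
  right : S ∈ tempered ι
  pair_eq : ∀ f g, RapidDecay f → RapidDecay g → pair f (T g) = pair (S f) g

variable {T S T' S' : Module.End ℂ (ι → ℂ)}

theorem IsAdj.symm (h : IsAdj T S) : IsAdj S T :=
  ⟨h.right, h.left, fun f g hf hg => by
    rw [← pair_conj, ← h.pair_eq g f hg hf, pair_conj]⟩

theorem IsAdj.add (h : IsAdj T S) (h' : IsAdj T' S') : IsAdj (T + T') (S + S') :=
  ⟨add_mem h.left h'.left, add_mem h.right h'.right, fun f g hf hg => by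
    rw [LinearMap.add_apply, LinearMap.add_apply,
      pair_add_right hf (hg.map h.left) (hg.map h'.left),
      pair_add_left (hf.map h.right) (hf.map h'.right) hg, h.pair_eq f g hf hg,
      h'.pair_eq f g hf hg]⟩

theorem IsAdj.smul (z : ℝ) (h : IsAdj T S) : IsAdj ((z : ℂ) • T) ((z : ℂ) • S) :=
  ⟨Subalgebra.smul_mem _ h.left _, Subalgebra.smul_mem _ h.right _, fun f g hf hg => by
    rw [LinearMap.smul_apply, LinearMap.smul_apply, pair_smul_right, pair_smul_left,
      h.pair_eq f g hf hg, Complex.conj_ofReal]⟩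

theorem IsAdj.mul (h : IsAdj T S) (h' : IsAdj T' S') : IsAdj (T * T') (S' * S) :=
  ⟨mul_mem h.left h'.left, mul_mem h'.right h.right, fun f g hf hg => by
    rw [Module.End.mul_apply, Module.End.mul_apply, h.pair_eq f _ hf (hg.map h'.left),
      h'.pair_eq _ g (hf.map h.right) hg]⟩

theorem IsAdj.one : IsAdj (1 : Module.End ℂ (ι → ℂ)) 1 :=
  ⟨one_mem _, one_mem _, fun _ _ _ _ => rfl⟩

theorem IsAdj.sum {α : Type*} {T S : α → Module.End ℂ (ι → ℂ)} (F : Finset α)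
    (h : ∀ a, IsAdj (T a) (S a)) : IsAdj (∑ a ∈ F, T a) (∑ a ∈ F, S a) := by
  classical
  induction F using Finset.induction_on with
  | empty => simpa using IsAdj.smul 0 (IsAdj.one (ι := ι))
  | insert a F ha ih => rw [Finset.sum_insert ha, Finset.sum_insert ha]; exact (h a).add ih

/-- A lowering operator `T` and a raising operator `S` along the injection `σ`, with amplitudes
`a`. -/
structure IsLadder (σ : ι → ι) (a : ι → ℝ) (T S : Module.End ℂ (ι → ℂ)) : Prop where
  inj : Function.Injective σ
  size_le : ∀ i, HasSize.size i ≤ HasSize.size (σ i)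
  le_size : ∀ i, HasSize.size (σ i) ≤ HasSize.size i + 1
  abs_le : ∀ i, |a i| ≤ weight i
  lower : ∀ f i, T f i = a i * f (σ i)
  raise : ∀ f i, S f (σ i) = a i * f i
  raise_zero : ∀ f j, j ∉ Set.range σ → S f j = 0

/-- The weights at `i` and `σ i` are comparable and the amplitude is at most the weight, so lowering
and raising each cost one power of the weight. Adjointness is the reindexing of the sum along `σ`,
since raised sequences vanish off its range. -/
theorem IsLadder.isAdj {σ : ι → ι} {a : ι → ℝ} (h : IsLadder σ a T S) : IsAdj T S := by
  have hle : ∀ i, weight i ≤ weight (σ i) := fun i => by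
    have := h.size_le i
    simp only [weight]; gcongr
  have hge : ∀ i, weight (σ i) ≤ 2 * weight i := fun i => by
    have : (HasSize.size (σ i) : ℝ) ≤ HasSize.size i + 1 := by exact_mod_cast h.le_size i
    have h0 : (0 : ℝ) ≤ HasSize.size i := Nat.cast_nonneg _
    simp only [weight]; linarith
  refine ⟨fun k => ⟨k + 1, 1, fun f B hf i => ?_⟩, fun k => ⟨k + 1, 2 ^ k, fun f B hf j => ?_⟩,
    fun f g _ _ => ?_⟩
  · rw [h.lower, norm_mul, Complex.norm_real, Real.norm_eq_abs, one_mul, ← mul_assoc]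
    refine le_trans ?_ (hf (σ i))
    gcongr
    rw [pow_succ]
    have := (h.abs_le i).trans (hle i)
    have h1 := hle i
    have h2 := (weight_pos i).le
    have h3 := (weight_pos (σ i)).le
    gcongr
  · by_cases hj : j ∈ Set.range σ
    · obtain ⟨i, rfl⟩ := hj
      rw [h.raise, norm_mul, Complex.norm_real, Real.norm_eq_abs]
      calc weight (σ i) ^ k * (|a i| * ‖f i‖)
          ≤ (2 * weight i) ^ k * (weight i * ‖f i‖) := by
            have h1 := hge i
            have h2 := (weight_pos (σ i)).le
            have h3 := h.abs_le i
            have h4 := (weight_pos i).le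
            gcongr
        _ = 2 ^ k * (weight i ^ (k + 1) * ‖f i‖) := by rw [mul_pow, pow_succ]; ring
        _ ≤ 2 ^ k * B := by have := hf i; gcongr
    · rw [h.raise_zero f j hj, norm_zero, mul_zero]
      exact mul_nonneg (by positivity)
        ((mul_nonneg (pow_nonneg (weight_pos j).le _) (norm_nonneg _)).trans (hf j))
  · rw [pair, pair, ← h.inj.tsum_eq (f := fun j => conj (S f j) * g j)]
    · exact tsum_congr fun i => by rw [h.lower, h.raise]; simp [mul_assoc, mul_left_comm]
    · intro j hj
      by_contra hc
      exact hj (by simp [h.raise_zero f j hc])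

/-- Truncation to the indices of size at most `M`. -/
def truncate (M : ℕ) (f : ι → ℂ) : ι → ℂ := fun i => if HasSize.size i ≤ M then f i else 0

/-- This gives the convergence of both the truncated states and their images under the photon
Hamiltonian. The uniform constant in `tempered` turns smallness of the tail in a weighted sup-norm
into smallness of its image, and the summable inverse weight turns a sup bound into an `ℓ²` bound.
-/
theorem tendsto_map_truncate {T : Module.End ℂ (ι → ℂ)} (hT : T ∈ tempered ι) {f : ι → ℂ}
    (hf : RapidDecay f) :
    Filter.Tendsto (fun M => ∑' i, ‖T (f - truncate M f) i‖ ^ 2) Filter.atTop (nhds 0) := by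
  obtain ⟨p, hp⟩ := exists_summable_weight ι
  obtain ⟨k, C, h⟩ := hT p
  -- One power of the weight is kept in reserve: it is at least `M + 1` on the tail and yields the
  -- factor `1 / (M + 1)`.
  obtain ⟨B, hB⟩ := hf (k + 1)
  have hB0 : ∀ i : ι, 0 ≤ B := fun i =>
    (mul_nonneg (pow_nonneg (weight_pos i).le _) (norm_nonneg _)).trans (hB i)
  have h1 : ∀ (M : ℕ) (i : ι), weight i ^ k * ‖(f - truncate M f) i‖ ≤ B / (M + 1) := by
    intro M i
    have hM : (0 : ℝ) < M + 1 := by positivity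
    rw [le_div_iff₀ hM, Pi.sub_apply, truncate]
    split_ifs with hi
    · simpa using hB0 i
    · have : (M : ℝ) + 1 ≤ weight i := by
        rw [weight]
        exact_mod_cast Nat.succ_le_succ (not_le.1 hi).le
      rw [sub_zero]
      calc weight i ^ k * ‖f i‖ * (M + 1) ≤ weight i ^ k * ‖f i‖ * weight i := by
            have := (weight_pos i).le
            gcongr
        _ = weight i ^ (k + 1) * ‖f i‖ := by ring
        _ ≤ B := hB i
  have h2 : ∀ (M : ℕ) (i : ι), ‖T (f - truncate M f) i‖ ^ 2 ≤
      (C * (B / (M + 1))) ^ 2 * (weight i ^ p)⁻¹ := by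
    intro M i
    have h3 := h _ _ (h1 M) i
    have hw : 1 ≤ weight i ^ p := one_le_pow₀ (one_le_weight i)
    have hw0 : 0 < weight i ^ p := zero_lt_one.trans_le hw
    rw [← div_eq_mul_inv, le_div_iff₀ hw0]
    have h5 := mul_nonneg hw0.le (norm_nonneg (T (f - truncate M f) i))
    calc ‖T (f - truncate M f) i‖ ^ 2 * weight i ^ p
        ≤ ‖T (f - truncate M f) i‖ ^ 2 * (weight i ^ p) ^ 2 := by
          gcongr
          exact le_self_pow₀ hw (by norm_num)
      _ = (weight i ^ p * ‖T (f - truncate M f) i‖) ^ 2 := by ring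
      _ ≤ _ := by gcongr
  have h4 : Filter.Tendsto (fun M : ℕ => (C * (B / ((M : ℝ) + 1))) ^ 2 *
      ∑' i : ι, (weight i ^ p)⁻¹) Filter.atTop (nhds 0) := by
    have h5 : Filter.Tendsto (fun M : ℕ => B / ((M : ℝ) + 1)) Filter.atTop (nhds 0) := by
      simpa [div_eq_mul_inv] using tendsto_one_div_add_atTop_nhds_zero_nat.const_mul B
    simpa using ((h5.const_mul C).pow 2).mul_const (∑' i : ι, (weight i ^ p)⁻¹)
  refine squeeze_zero (fun M => tsum_nonneg fun i => by positivity) (fun M => ?_) h4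
  rw [← tsum_mul_left]
  have hs := hp.mul_left ((C * (B / ((M : ℝ) + 1))) ^ 2)
  exact (Summable.of_nonneg_of_le (fun i => by positivity) (h2 M) hs).tsum_le_tsum (h2 M) hs

end RapidDecay

end CavityQED

namespace CavityQED

/-! ### One oscillator: squeezed ladder operators, their vacuum and excited states. -/

section OneMode

open scoped ComplexConjugate

instance : HasSize ℕ where
  size n := n
  exists_summable := ⟨2, by
    have := (summable_nat_add_iff 1).2 (Real.summable_nat_pow_inv.2 (by norm_num : 1 < 2))
    simpa using this⟩

theorem weight_nat (n : ℕ) : weight n = n + 1 := rfl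

theorem ann_apply (f : ℕ → ℂ) (n : ℕ) : ann f n = (Real.sqrt (n + 1) : ℂ) * f (n + 1) := rfl

theorem cre_apply (f : ℕ → ℂ) (n : ℕ) : cre f n = (Real.sqrt n : ℂ) * f (n - 1) := rfl

theorem sqrt_le_add_one (n : ℕ) : |Real.sqrt ((n : ℝ) + 1)| ≤ (n : ℝ) + 1 := by
  rw [abs_of_nonneg (Real.sqrt_nonneg _)]
  exact Real.sqrt_le_iff.2 ⟨by positivity, by nlinarith [Nat.cast_nonneg (α := ℝ) n]⟩

theorem isLadder_ann_cre : IsLadder (· + 1) (fun n : ℕ => Real.sqrt (n + 1)) ann cre where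
  inj := add_left_injective 1
  size_le n := Nat.le_succ n
  le_size n := le_rfl
  abs_le n := sqrt_le_add_one n
  lower f n := rfl
  raise f n := by simp [cre_apply]
  raise_zero f j hj := by
    cases j with
    | zero => simp [cre_apply]
    | succ j => exact absurd ⟨j, rfl⟩ hj

theorem ofReal_sqrt_succ_mul_self (n : ℕ) :
    (Real.sqrt ((n : ℝ) + 1) : ℂ) * (Real.sqrt ((n : ℝ) + 1) : ℂ) = (n : ℂ) + 1 := by
  rw [← Complex.ofReal_mul, Real.mul_self_sqrt (by positivity)]; push_cast; rfl

theorem ofReal_sqrt_succ_ne_zero (n : ℕ) : (Real.sqrt ((n : ℝ) + 1) : ℂ) ≠ 0 := by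
  exact_mod_cast (Real.sqrt_pos.2 (by positivity)).ne'

theorem ann_mul_cre : ann * cre - cre * ann = 1 := by
  refine LinearMap.ext fun f => funext fun n => ?_
  cases n with
  | zero => simp [ann_apply, cre_apply]
  | succ n =>
    have h1 := ofReal_sqrt_succ_mul_self n
    have h2 := ofReal_sqrt_succ_mul_self (n + 1)
    push_cast at h1 h2
    simp only [LinearMap.sub_apply, Module.End.mul_apply, Pi.sub_apply, ann_apply, cre_apply,
      Module.End.one_apply]
    push_cast
    linear_combination (h2 - h1) * f (n + 1)

/-- The operator `x a + y a† - s`. -/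
noncomputable def squeeze (x y s : ℝ) : Module.End ℂ (ℕ → ℂ) :=
  (x : ℂ) • ann + (y : ℂ) • cre - (s : ℂ) • 1

theorem squeeze_apply (x y s : ℝ) (f : ℕ → ℂ) (n : ℕ) : squeeze x y s f n =
    x * (Real.sqrt (n + 1) * f (n + 1)) + y * (Real.sqrt n * f (n - 1)) - s * f n := rfl

theorem isAdj_squeeze (x y s : ℝ) : IsAdj (squeeze x y s) (squeeze y x s) := by
  have h := isLadder_ann_cre.isAdj
  have e : ∀ x y : ℝ, squeeze x y s =
      (x : ℂ) • ann + (y : ℂ) • cre + ((-s : ℝ) : ℂ) • 1 := fun x y => by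
    rw [squeeze, Complex.ofReal_neg]; module
  rw [e, e, add_comm ((y : ℂ) • ann)]
  exact ((h.smul x).add (h.symm.smul y)).add (IsAdj.one.smul _)

theorem squeeze_mul_sub (x y s x' y' s' : ℝ) :
    squeeze x y s * squeeze x' y' s' - squeeze x' y' s' * squeeze x y s =
      ((x * y' - y * x' : ℝ) : ℂ) • 1 := by
  have h : ann * cre = cre * ann + 1 := by rw [← ann_mul_cre]; abel
  simp only [squeeze, mul_add, add_mul, mul_sub, sub_mul, smul_mul_assoc, mul_smul_comm, one_mul,
    mul_one, h, smul_add]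
  push_cast
  module

/-- The state with `squeeze x y s v = 0` and `v 0 = 1`. -/
noncomputable def vacuumSeq (x y s : ℝ) : ℕ → ℝ
  | 0 => 1
  | 1 => s / x
  | n + 2 => (s * vacuumSeq x y s (n + 1) - y * (Real.sqrt (n + 1) * vacuumSeq x y s n)) /
      (x * Real.sqrt (n + 1 + 1))

/-- For large `n` the displacement term in the recursion carries a factor of order `1 / √n`, and
what is left contracts two steps at a time by `|y| / x < 1`. So the sequence is eventually dominated
by a geometric one. -/
theorem abs_vacuumSeq_le {x y : ℝ} (h : |y| < x) (s : ℝ) :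
    ∃ C r : ℝ, 0 < r ∧ r < 1 ∧ ∀ n, |vacuumSeq x y s n| ≤ C * r ^ n := by
  have hx : 0 < x := (abs_nonneg y).trans_lt h
  set ρ := |y| / x with hρ
  have hρ0 : 0 ≤ ρ := div_nonneg (abs_nonneg _) hx.le
  have hρ1 : ρ < 1 := (div_lt_one hx).2 h
  -- `r²` is the midpoint of `ρ` and `1`; the gap `r² - ρ > 0` is the room left for the displacement
  -- term.
  set r := Real.sqrt ((1 + ρ) / 2) with hr
  have hr2 : r ^ 2 = (1 + ρ) / 2 := Real.sq_sqrt (by linarith)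
  have hr0 : 0 < r := Real.sqrt_pos.2 (by linarith)
  have hr1 : r < 1 := by nlinarith
  have hη : 0 < r ^ 2 - ρ := by linarith
  -- Beyond `m` the coefficient of the displacement term is at most `r² - ρ`. The constant `C` below
  -- covers the indices under `m + 2`, and the recursion propagates the bound from there.
  obtain ⟨m, hm⟩ := exists_nat_gt ((|s| / x / (r ^ 2 - ρ)) ^ 2)
  set C := ∑ i ∈ Finset.range (m + 2), |vacuumSeq x y s i| / r ^ i with hC
  have hnn : ∀ i, 0 ≤ |vacuumSeq x y s i| / r ^ i := fun i => by positivity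
  have hC0 : 0 ≤ C := Finset.sum_nonneg fun i _ => hnn i
  refine ⟨C, r, hr0, hr1, fun n => ?_⟩
  induction n using Nat.strong_induction_on with
  | _ n ih =>
  by_cases hn : n < m + 2
  · rw [← div_le_iff₀ (pow_pos hr0 n)]
    exact Finset.single_le_sum (f := fun i => |vacuumSeq x y s i| / r ^ i) (fun i _ => hnn i)
      (Finset.mem_range.2 hn)
  · obtain ⟨n, rfl⟩ : ∃ k, n = k + 2 := ⟨n - 2, by omega⟩
    have hmn : (m : ℝ) ≤ n := by exact_mod_cast (by omega : m ≤ n)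
    have i1 := ih n (by omega)
    have i2 := ih (n + 1) (by omega)
    rw [vacuumSeq]
    set u := Real.sqrt ((n : ℝ) + 1 + 1)
    have hu : 0 < u := Real.sqrt_pos.2 (by positivity)
    have h1 : Real.sqrt ((n : ℝ) + 1) ≤ u := Real.sqrt_le_sqrt (by linarith)
    have h2 : |s| / x ≤ (r ^ 2 - ρ) * u := by
      rw [← div_le_iff₀' hη]
      exact Real.le_sqrt_of_sq_le (by linarith)
    have h3 : |s| ≤ (r ^ 2 - ρ) * u * x := (div_le_iff₀ hx).1 h2
    have hy : |y| = ρ * x := by rw [hρ, div_mul_cancel₀ _ hx.ne']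
    rw [abs_div, abs_of_pos (mul_pos hx hu), div_le_iff₀ (mul_pos hx hu)]
    calc |s * vacuumSeq x y s (n + 1) - y * (Real.sqrt (n + 1) * vacuumSeq x y s n)|
        ≤ |s| * |vacuumSeq x y s (n + 1)| + |y| * (Real.sqrt (n + 1) * |vacuumSeq x y s n|) := by
          refine (abs_sub _ _).trans_eq ?_
          rw [abs_mul, abs_mul, abs_mul, abs_of_nonneg (Real.sqrt_nonneg _)]
      _ ≤ ((r ^ 2 - ρ) * u * x) * (C * r ^ (n + 1)) + (ρ * x) * (u * (C * r ^ n)) := by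
          rw [hy]; gcongr
      _ ≤ ((r ^ 2 - ρ) * u * x) * (C * r ^ n) + (ρ * x) * (u * (C * r ^ n)) := by
          gcongr ?_ * (_ * ?_) + _
          exact pow_le_pow_of_le_one hr0.le hr1.le (Nat.le_succ n)
      _ = C * r ^ (n + 2) * (x * u) := by ring

theorem rapidDecay_of_geometric {f : ℕ → ℂ} {C r : ℝ} (hr0 : 0 < r) (hr1 : r < 1)
    (h : ∀ n, ‖f n‖ ≤ C * r ^ n) : RapidDecay f := by
  intro k
  have h1 : Filter.Tendsto (fun n : ℕ => ((n + 1 : ℕ) : ℝ) ^ k * r ^ (n + 1)) Filter.atTop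
      (nhds 0) :=
    (tendsto_pow_const_mul_const_pow_of_abs_lt_one k (by rwa [abs_of_pos hr0])).comp
      (Filter.tendsto_add_atTop_nat 1)
  obtain ⟨B, hB⟩ := h1.bddAbove_range
  refine ⟨C / r * B, fun n => ?_⟩
  have h2 : ((n + 1 : ℕ) : ℝ) ^ k * r ^ (n + 1) ≤ B := hB ⟨n, rfl⟩
  have hC : 0 ≤ C := by
    have := (norm_nonneg _).trans (h 0)
    simpa using this
  rw [weight_nat]
  calc ((n : ℝ) + 1) ^ k * ‖f n‖ ≤ ((n : ℝ) + 1) ^ k * (C * r ^ n) := by gcongr; exact h n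
    _ = C / r * (((n + 1 : ℕ) : ℝ) ^ k * r ^ (n + 1)) := by
      push_cast; field_simp; ring
    _ ≤ _ := by gcongr

theorem exists_vacuum {x y : ℝ} (h : |y| < x) (s : ℝ) :
    ∃ v : ℕ → ℂ, RapidDecay v ∧ v 0 = 1 ∧ squeeze x y s v = 0 := by
  have hx : 0 < x := (abs_nonneg y).trans_lt h
  obtain ⟨C, r, h0, h1, h2⟩ := abs_vacuumSeq_le h s
  refine ⟨fun n => (vacuumSeq x y s n : ℂ), rapidDecay_of_geometric h0 h1 (C := C) fun n => ?_,
    by simp [vacuumSeq], funext fun n => ?_⟩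
  · rw [Complex.norm_real]; exact h2 n
  · have hx' : (x : ℂ) ≠ 0 := by exact_mod_cast hx.ne'
    rw [squeeze_apply, Pi.zero_apply]
    cases n with
    | zero =>
      simp only [vacuumSeq]
      push_cast
      simp
      field_simp
      simp
    | succ n =>
      have hu := ofReal_sqrt_succ_ne_zero (n + 1)
      push_cast at hu
      simp only [vacuumSeq, Nat.add_sub_cancel]
      push_cast
      field_simp
      ring

/-- Since `x ≠ 0`, the equation at `n` determines `w (n + 1)` from the earlier amplitudes. The
kernel is thus at most one-dimensional among all sequences, square-summable or not. -/
theorem eq_zero_of_squeeze_eq_zero {x : ℝ} (hx : x ≠ 0) {y s : ℝ} {w : ℕ → ℂ}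
    (h : squeeze x y s w = 0) (h0 : w 0 = 0) : w = 0 := by
  have hx' : (x : ℂ) ≠ 0 := by exact_mod_cast hx
  funext n
  induction n using Nat.strong_induction_on with
  | _ n ih =>
  cases n with
  | zero => exact h0
  | succ n =>
    have h1 := congrFun h n
    have hu := ofReal_sqrt_succ_ne_zero n
    rw [squeeze_apply, ih n (Nat.lt_succ_self n)] at h1
    have h2 : (Real.sqrt n : ℂ) * w (n - 1) = 0 := by
      cases n with
      | zero => simp
      | succ n => rw [Nat.add_sub_cancel, ih n (by omega)]; simp
    rw [h2] at h1
    simpa [hx', hu] using h1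

theorem exists_eq_smul_vacuum {x : ℝ} (hx : x ≠ 0) {y s : ℝ} {v w : ℕ → ℂ}
    (hv : squeeze x y s v = 0) (hv0 : v 0 ≠ 0) (hw : squeeze x y s w = 0) :
    ∃ z : ℂ, w = z • v := by
  refine ⟨w 0 / v 0, sub_eq_zero.1 (eq_zero_of_squeeze_eq_zero (s := s) (y := y) hx ?_ ?_)⟩
  · rw [map_sub, map_smul, hv, hw]; simp
  · simp [hv0]

/-- The normalized excited states `Cⁿ v / √(n!)`. -/
noncomputable def excited {M : Type*} [AddCommGroup M] [Module ℂ M] (C : Module.End ℂ M) (v : M)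
    (n : ℕ) : M :=
  ((1 / Real.sqrt (n.factorial) : ℝ) : ℂ) • (C ^ n) v

section Excited

variable {M : Type*} [AddCommGroup M] [Module ℂ M] {A C : Module.End ℂ M} {v : M}

theorem excited_zero : excited C v 0 = v := by simp [excited]

theorem create_excited (n : ℕ) :
    C (excited C v n) = (Real.sqrt (n + 1) : ℂ) • excited C v (n + 1) := by
  rw [excited, excited, map_smul, smul_smul, pow_succ', Module.End.mul_apply,
    ← Complex.ofReal_mul, Nat.factorial_succ]
  congr 2
  have h1 : 0 < Real.sqrt ((n : ℝ) + 1) := Real.sqrt_pos.2 (by positivity)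
  have h2 : 0 < Real.sqrt (n.factorial : ℝ) := Real.sqrt_pos.2 (by positivity)
  push_cast
  rw [Real.sqrt_mul (by positivity)]
  field_simp

/-- Moving `A` past one factor `C` by the commutation relation gives the induction. At `n = 0` the
truncated `n - 1` is harmless because `√0 = 0`. -/
theorem annihilate_excited (h : A * C - C * A = 1) (hv : A v = 0) (n : ℕ) :
    A (excited C v n) = (Real.sqrt n : ℂ) • excited C v (n - 1) := by
  induction n with
  | zero => simp [excited_zero, hv]
  | succ n ih =>
    have hn := ofReal_sqrt_succ_ne_zero n
    have h1 : A (C (excited C v n)) = C (A (excited C v n)) + excited C v n := by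
      have h2 := LinearMap.congr_fun h (excited C v n)
      rw [LinearMap.sub_apply, Module.End.mul_apply, Module.End.mul_apply,
        Module.End.one_apply] at h2
      exact (eq_add_of_sub_eq' h2)
    have h3 : C (A (excited C v n)) = (n : ℂ) • excited C v n := by
      rw [ih, map_smul]
      cases n with
      | zero => simp
      | succ n =>
        rw [Nat.add_sub_cancel, create_excited, smul_smul]
        push_cast
        rw [ofReal_sqrt_succ_mul_self]
    rw [create_excited, map_smul, h3] at h1
    refine (smul_right_injective M hn) ?_
    dsimp only
    rw [h1, Nat.add_sub_cancel, smul_smul, Nat.cast_succ, ofReal_sqrt_succ_mul_self]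
    module

theorem number_excited (h : A * C - C * A = 1) (hv : A v = 0) (n : ℕ) :
    (C * A) (excited C v n) = (n : ℂ) • excited C v n := by
  rw [Module.End.mul_apply, annihilate_excited h hv, map_smul]
  cases n with
  | zero => simp
  | succ n =>
    rw [Nat.add_sub_cancel, create_excited, smul_smul]
    push_cast
    rw [ofReal_sqrt_succ_mul_self]

end Excited

theorem RapidDecay.pow {ι : Type*} [HasSize ι] {T : Module.End ℂ (ι → ℂ)} (hT : T ∈ tempered ι)
    {f : ι → ℂ} (hf : RapidDecay f) (n : ℕ) : RapidDecay ((T ^ n) f) :=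
  hf.map (pow_mem hT n)

/-- Moving one `C` across the pairing turns it into `A`, which lowers the other index; the square
roots cancel and both indices drop by one until one of them is zero. -/
theorem pair_excited {ι : Type*} [HasSize ι] {A C : Module.End ℂ (ι → ℂ)} (hA : IsAdj A C)
    (h : A * C - C * A = 1) {v : ι → ℂ} (hr : RapidDecay v) (hv : A v = 0) (h1 : pair v v = 1)
    (m n : ℕ) : pair (excited C v m) (excited C v n) = if m = n then 1 else 0 := by
  have hd : ∀ n, RapidDecay (excited C v n) := fun n => (hr.pow hA.right n).smul _
  have hs := ofReal_sqrt_succ_ne_zero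
  have key : ∀ m n : ℕ, (Real.sqrt ((n : ℝ) + 1) : ℂ) * pair (excited C v m) (excited C v (n + 1)) =
      (Real.sqrt m : ℂ) * pair (excited C v (m - 1)) (excited C v n) := fun m n => by
    rw [← pair_smul_right, ← create_excited, hA.symm.pair_eq _ _ (hd m) (hd n),
      annihilate_excited h hv, pair_smul_left, Complex.conj_ofReal]
  have h0 : ∀ n, pair (excited C v 0) (excited C v (n + 1)) = 0 := fun n => by
    have := key 0 n
    simpa [hs n] using this
  induction n generalizing m with
  | zero =>
    cases m with
    | zero => simpa [excited_zero] using h1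
    | succ m => rw [← pair_conj, h0, map_zero, if_neg (Nat.succ_ne_zero m)]
  | succ n ih =>
    cases m with
    | zero => rw [h0, if_neg (Nat.succ_ne_zero n).symm]
    | succ m =>
      have := key (m + 1) n
      rw [Nat.add_sub_cancel, ih m] at this
      refine mul_left_cancel₀ (hs n) (this.trans ?_)
      by_cases hmn : m = n
      · simp [hmn]
      · simp [hmn]

end OneMode

end CavityQED

namespace CavityQED

/-! ### Completeness of the excited states of one oscillator. -/

section Completeness

open scoped ComplexConjugate

/-- A square-summable sequence as an element of `ℓ²`. -/
def toL2 {ι : Type*} (f : ι → ℂ) (hf : Summable fun i => ‖f i‖ ^ 2) : lp (fun _ : ι => ℂ) 2 :=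
  ⟨f, memℓp_gen (by simpa using hf)⟩

theorem inner_toL2 {ι : Type*} {f g : ι → ℂ} (hf : Summable fun i => ‖f i‖ ^ 2)
    (hg : Summable fun i => ‖g i‖ ^ 2) : inner ℂ (toL2 f hf) (toL2 g hg) = pair f g := by
  rw [lp.inner_eq_tsum, pair]
  exact tsum_congr fun i => by simp [toL2, mul_comm]

theorem norm_toL2_sq {ι : Type*} {f : ι → ℂ} (hf : Summable fun i => ‖f i‖ ^ 2) :
    ‖toL2 f hf‖ ^ 2 = ∑' i, ‖f i‖ ^ 2 := by
  have := lp.norm_rpow_eq_tsum (p := 2) (by norm_num) (toL2 f hf)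
  simpa [toL2] using this

theorem pair_zero_right {ι : Type*} (f : ι → ℂ) : pair f 0 = 0 := by simp [pair]

theorem norm_pair_sq_le {ι : Type*} {f g : ι → ℂ} (hf : Summable fun i => ‖f i‖ ^ 2)
    (hg : Summable fun i => ‖g i‖ ^ 2) :
    ‖pair f g‖ ^ 2 ≤ (∑' i, ‖f i‖ ^ 2) * ∑' i, ‖g i‖ ^ 2 := by
  rw [← inner_toL2 hf hg, ← norm_toL2_sq hf, ← norm_toL2_sq hg, ← mul_pow]
  gcongr
  exact norm_inner_le_norm _ _

theorem norm_le_one_of_pair_self {ι : Type*} [HasSize ι] {f : ι → ℂ} (hf : RapidDecay f)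
    (h : pair f f = 1) (i : ι) : ‖f i‖ ≤ 1 := by
  rw [pair_self_eq, Complex.ofReal_eq_one] at h
  have h1 : ‖f i‖ ^ 2 ≤ 1 := h ▸ hf.summable_sq.le_tsum i fun j _ => by positivity
  exact (sq_le_one_iff₀ (norm_nonneg _)).1 h1

theorem _root_.HasSum.of_eq {ι : Type*} {f g : ι → ℂ} {a b : ℂ} (h : HasSum f a)
    (hf : ∀ n, g n = f n) (hb : b = a) : HasSum g b := by
  rw [hb, funext hf]; exact h

/-- The superposition `∑ w n D n`, formed amplitude by amplitude. -/
noncomputable def superpose (D : ℕ → ℕ → ℂ) (w : ℕ → ℂ) : ℕ → ℂ := fun i => ∑' n, w n * D n i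

theorem hasSum_superpose {D : ℕ → ℕ → ℂ} (hD : ∀ n i, ‖D n i‖ ≤ 1) {w : ℕ → ℂ}
    (hw : RapidDecay w) (i : ℕ) : HasSum (fun n => w n * D n i) (superpose D w i) := by
  refine Summable.hasSum (Summable.of_norm_bounded hw.summable fun n => ?_)
  rw [norm_mul]
  exact mul_le_of_le_one_right (norm_nonneg _) (hD n i)

/-- An amplitude of the image involves at most three amplitudes of the argument, so the operator
passes through the amplitudewise series without any continuity in norm. -/
theorem hasSum_squeeze_superpose {D : ℕ → ℕ → ℂ} (hD : ∀ n i, ‖D n i‖ ≤ 1) {w : ℕ → ℂ}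
    (hw : RapidDecay w) (x y s : ℝ) (i : ℕ) :
    HasSum (fun n => w n * squeeze x y s (D n) i) (squeeze x y s (superpose D w) i) := by
  have h := ((((hasSum_superpose hD hw (i + 1)).mul_left (Real.sqrt (i + 1) : ℂ)).mul_left
    (x : ℂ)).add (((hasSum_superpose hD hw (i - 1)).mul_left (Real.sqrt i : ℂ)).mul_left
    (y : ℂ))).sub ((hasSum_superpose hD hw i).mul_left (s : ℂ))
  refine h.of_eq (fun n => ?_) rfl
  rw [squeeze_apply]
  ring

section

variable {x y s : ℝ} {v : ℕ → ℂ}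

theorem squeeze_commutator (h : x ^ 2 - y ^ 2 = 1) :
    squeeze x y s * squeeze y x s - squeeze y x s * squeeze x y s = 1 := by
  rw [squeeze_mul_sub, show x * x - y * y = 1 by linarith]
  simp

theorem annihilate_superpose (h : x ^ 2 - y ^ 2 = 1) (hv : squeeze x y s v = 0)
    (hD : ∀ n i, ‖excited (squeeze y x s) v n i‖ ≤ 1) {w : ℕ → ℂ} (hw : RapidDecay w) (i : ℕ) :
    HasSum (fun n => ann w n * excited (squeeze y x s) v n i)
      (squeeze x y s (superpose (excited (squeeze y x s) v) w) i) := by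
  have h1 := hasSum_squeeze_superpose hD hw x y s i
  rw [← hasSum_nat_add_iff' 1] at h1
  simp only [annihilate_excited (squeeze_commutator h) hv] at h1
  refine h1.of_eq (fun n => ?_) ?_
  · simp [ann_apply]
    ring
  · simp

theorem create_superpose
    (hD : ∀ n i, ‖excited (squeeze y x s) v n i‖ ≤ 1) {w : ℕ → ℂ} (hw : RapidDecay w) (i : ℕ) :
    HasSum (fun n => cre w n * excited (squeeze y x s) v n i)
      (squeeze y x s (superpose (excited (squeeze y x s) v) w) i) := by
  have h1 := hasSum_squeeze_superpose hD hw y x s i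
  simp only [create_excited] at h1
  rw [← hasSum_nat_add_iff' 1]
  refine h1.of_eq (fun n => ?_) ?_
  · simp [cre_apply]
    ring
  · simp [cre_apply]

/-- In the coordinates given by the excited states, `squeeze x y s` acts as `ann` and `squeeze y x
s` as `cre`. Any combination of them is therefore again a `squeeze`, now acting on the coefficients.
-/
theorem squeeze_superpose (h : x ^ 2 - y ^ 2 = 1) (hv : squeeze x y s v = 0)
    (hD : ∀ n i, ‖excited (squeeze y x s) v n i‖ ≤ 1) {w : ℕ → ℂ} (hw : RapidDecay w)
    (p q t : ℝ) :
    ((p : ℂ) • squeeze x y s + (q : ℂ) • squeeze y x s - (t : ℂ) • 1)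
      (superpose (excited (squeeze y x s) v) w) =
    superpose (excited (squeeze y x s) v) (squeeze p q t w) := by
  funext i
  have h1 := (((annihilate_superpose h hv hD hw i).mul_left (p : ℂ)).add
    ((create_superpose hD hw i).mul_left (q : ℂ))).sub
    ((hasSum_superpose hD hw i).mul_left (t : ℂ))
  refine h1.tsum_eq.symm.trans (tsum_congr fun n => ?_)
  rw [squeeze_apply, ann_apply, cre_apply]
  ring

/-- The inverse Bogoliubov transformation: `x² - y² = 1` eliminates `a†`, and the two displacements
add up to `-(x - y) s`. -/
theorem ann_eq_squeeze (h : x ^ 2 - y ^ 2 = 1) : ann = (x : ℂ) • squeeze x y s +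
    ((-y : ℝ) : ℂ) • squeeze y x s - ((-((x - y) * s) : ℝ) : ℂ) • 1 := by
  have h' : (x : ℂ) ^ 2 - (y : ℂ) ^ 2 = 1 := by exact_mod_cast h
  simp only [squeeze]
  push_cast
  match_scalars <;> first | ring1 | linear_combination -h'

theorem cre_eq_squeeze (h : x ^ 2 - y ^ 2 = 1) : cre = ((-y : ℝ) : ℂ) • squeeze x y s +
    (x : ℂ) • squeeze y x s - ((-((x - y) * s) : ℝ) : ℂ) • 1 := by
  have h' : (x : ℂ) ^ 2 - (y : ℂ) ^ 2 = 1 := by exact_mod_cast h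
  simp only [squeeze]
  push_cast
  match_scalars <;> first | ring1 | linear_combination -h'

theorem superpose_smul (D : ℕ → ℕ → ℂ) (z : ℂ) (w : ℕ → ℂ) :
    superpose D (z • w) = z • superpose D w := by
  funext i
  rw [Pi.smul_apply, smul_eq_mul, superpose, superpose, ← tsum_mul_left]
  exact tsum_congr fun n => by simp [mul_assoc]

/-- The series converges absolutely in `ℓ²`, being a summable combination of unit vectors.
Evaluation at an index is continuous and identifies the limit with the amplitudewise sum; continuity
of the inner product gives the rest. -/
theorem pair_superpose {D : ℕ → ℕ → ℂ} (hDr : ∀ n, RapidDecay (D n))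
    (hD : ∀ m n, pair (D m) (D n) = if m = n then 1 else 0) {w : ℕ → ℂ} (hw : RapidDecay w) :
    (Summable fun i => ‖superpose D w i‖ ^ 2) ∧ ∀ g : ℕ → ℂ,
      Summable (fun i => ‖g i‖ ^ 2) → pair g (superpose D w) = ∑' n, w n * pair g (D n) := by
  let d : ℕ → lp (fun _ : ℕ => ℂ) 2 := fun n => toL2 (D n) (hDr n).summable_sq
  have hd : ∀ n, ‖d n‖ = 1 := fun n => by
    have h1 : ‖d n‖ ^ 2 = 1 := by
      have h2 := hD n n
      rw [if_pos rfl, pair_self_eq, Complex.ofReal_eq_one] at h2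
      rw [norm_toL2_sq, h2]
    exact (pow_eq_one_iff_of_nonneg (norm_nonneg _) two_ne_zero).1 h1
  have hsum : Summable fun n => w n • d n := Summable.of_norm (by
    simpa [norm_smul, hd] using hw.summable)
  have hW : ∀ i, (∑' n, w n • d n : lp (fun _ : ℕ => ℂ) 2) i = superpose D w i := fun i =>
    (lp.evalCLM ℂ (fun _ : ℕ => ℂ) 2 i).map_tsum hsum
  have hs : Summable fun i => ‖superpose D w i‖ ^ 2 := by
    have := (lp.memℓp (∑' n, w n • d n : lp (fun _ : ℕ => ℂ) 2)).summable (by norm_num)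
    simpa [hW] using this
  refine ⟨hs, fun g hg => ?_⟩
  have h1 : toL2 (superpose D w) hs = ∑' n, w n • d n := by
    ext i; exact (hW i).symm
  rw [← inner_toL2 hg hs, h1]
  refine ((innerSL ℂ (toL2 g hg)).map_tsum hsum).trans (tsum_congr fun n => ?_)
  rw [innerSL_apply_apply, inner_smul_right, inner_toL2]

/-- The roles of bare and dressed operators are exchanged: on coefficients `ann` is `squeeze x (-y)`
with a displacement, which has a rapidly decreasing vacuum of its own. This produces the bare
vacuum, and applying `cre` produces the other number states. -/
theorem exists_superpose_eq_single (h : x ^ 2 - y ^ 2 = 1) (hx : 0 < x) (hr : RapidDecay v)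
    (hv : squeeze x y s v = 0) (hvv : pair v v = 1) (m : ℕ) :
    ∃ w, RapidDecay w ∧ superpose (excited (squeeze y x s) v) w = Pi.single m 1 := by
  have hxy : |-y| < x := by
    rw [abs_neg]
    exact abs_lt_of_sq_lt_sq (by linarith) hx.le
  have hadj := isAdj_squeeze x y s
  have hDr : ∀ n, RapidDecay (excited (squeeze y x s) v n) := fun n =>
    (hr.pow hadj.right n).smul _
  have hD := pair_excited hadj (squeeze_commutator h) hr hv hvv
  have hb : ∀ n i, ‖excited (squeeze y x s) v n i‖ ≤ 1 := fun n i =>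
    norm_le_one_of_pair_self (hDr n) (by rw [hD, if_pos rfl]) i
  induction m with
  | zero =>
    obtain ⟨w, hw, hw0, hw1⟩ := exists_vacuum hxy (-((x - y) * s))
    obtain ⟨hs, hp⟩ := pair_superpose hDr hD hw
    have h1 : ann (superpose (excited (squeeze y x s) v) w) = 0 := by
      rw [ann_eq_squeeze (s := s) h, squeeze_superpose h hv hb hw, hw1]
      funext i
      simp [superpose]
    have h2 : ∀ i, superpose (excited (squeeze y x s) v) w (i + 1) = 0 := fun i => by
      have := congrFun h1 i
      rw [ann_apply] at this
      exact (mul_eq_zero.1 this).resolve_left (ofReal_sqrt_succ_ne_zero i)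
    have h3 : superpose (excited (squeeze y x s) v) w =
        superpose (excited (squeeze y x s) v) w 0 • Pi.single 0 1 := by
      funext i
      cases i with
      | zero => simp
      | succ i => simp [h2]
    -- If it vanished, so would the whole superposition; but its pairing with the zeroth excited
    -- state is `w 0 = 1`.
    have h4 : superpose (excited (squeeze y x s) v) w 0 ≠ 0 := by
      intro hc
      rw [hc, zero_smul] at h3
      have h5 := hp (excited (squeeze y x s) v 0) (hDr 0).summable_sq
      rw [h3] at h5
      simp [hD, pair_zero_right, hw0] at h5
    generalize superpose (excited (squeeze y x s) v) w 0 = z at h3 h4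
    refine ⟨z⁻¹ • w, hw.smul _, ?_⟩
    rw [superpose_smul, h3, smul_smul, inv_mul_cancel₀ h4, one_smul]
  | succ m ih =>
    obtain ⟨w, hw, hw1⟩ := ih
    -- These are the coefficients of `cre` in `cre_eq_squeeze`; dividing by `√(m + 1)` undoes the
    -- amplitude of the raising operator.
    have h1 := squeeze_superpose h hv hb hw (-y) x (-((x - y) * s))
    rw [← cre_eq_squeeze h, hw1] at h1
    refine ⟨(Real.sqrt ((m : ℝ) + 1) : ℂ)⁻¹ • squeeze (-y) x (-((x - y) * s)) w,
      (hw.map (isAdj_squeeze _ _ _).left).smul _, ?_⟩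
    rw [superpose_smul, ← h1]
    funext i
    rw [Pi.smul_apply, cre_apply]
    cases i with
    | zero => simp
    | succ i =>
      by_cases hi : i = m
      · subst hi
        have := ofReal_sqrt_succ_ne_zero i
        simp [this]
      · simp [hi]

/-- Only the zero sequence is orthogonal to all excited states. -/
theorem eq_zero_of_pair_excited (h : x ^ 2 - y ^ 2 = 1) (hx : 0 < x) (hr : RapidDecay v)
    (hv : squeeze x y s v = 0) (hvv : pair v v = 1) {g : ℕ → ℂ}
    (hg : Summable fun i => ‖g i‖ ^ 2) (hp : ∀ n, pair (excited (squeeze y x s) v n) g = 0) :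
    g = 0 := by
  funext m
  obtain ⟨w, hw, hw1⟩ := exists_superpose_eq_single h hx hr hv hvv m
  have hadj := isAdj_squeeze x y s
  obtain ⟨-, h1⟩ := pair_superpose (D := excited (squeeze y x s) v)
    (fun n => (hr.pow hadj.right n).smul _)
    (pair_excited hadj (squeeze_commutator h) hr hv hvv) hw
  have h2 := h1 g hg
  have h3 : ∀ n, pair g (excited (squeeze y x s) v n) = 0 := fun n => by
    rw [← pair_conj, hp, map_zero]
  simp only [h3, mul_zero, tsum_zero] at h2
  rw [hw1, pair, tsum_eq_single m fun i hi => by simp [hi]] at h2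
  simpa using h2

end

/-! ### Product states of two oscillators. -/

section TwoModes

instance : HasSize Occ where
  size n := n 0 + n 1
  exists_summable := by
    obtain ⟨p, hp⟩ := exists_summable_weight ℕ
    -- The weight of a pair dominates the weight of each entry, so `p` powers are spent on each
    -- polarization.
    refine ⟨p + p, ?_⟩
    have h1 : Summable fun z : ℕ × ℕ => (weight z.1 ^ p)⁻¹ * (weight z.2 ^ p)⁻¹ :=
      hp.mul_of_nonneg hp (fun i => by have := weight_pos i; positivity)
        (fun i => by have := weight_pos i; positivity)
    have h2 := (finTwoArrowEquiv ℕ).summable_iff.2 h1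
    refine Summable.of_nonneg_of_le (fun n => by positivity) (fun n => ?_) h2
    rw [pow_add, mul_inv]
    change _ ≤ (weight (n 0) ^ p)⁻¹ * (weight (n 1) ^ p)⁻¹
    simp only [weight_nat]
    push_cast
    have e0 : (0 : ℝ) ≤ n 0 := Nat.cast_nonneg _
    have e1 : (0 : ℝ) ≤ n 1 := Nat.cast_nonneg _
    gcongr <;> linarith

/-- The product of two one-oscillator states. -/
def prodState (f : Fin 2 → ℕ → ℂ) : Occ → ℂ := fun ν => ∏ l, f l (ν l)

theorem prodState_apply (f : Fin 2 → ℕ → ℂ) (ν : Occ) :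
    prodState f ν = f 0 (ν 0) * f 1 (ν 1) := Fin.prod_univ_two _

theorem weight_occ_le (ν : Occ) : weight ν ≤ weight (ν 0) * weight (ν 1) := by
  have e0 : (0 : ℝ) ≤ ν 0 := Nat.cast_nonneg _
  have e1 : (0 : ℝ) ≤ ν 1 := Nat.cast_nonneg _
  rw [weight_nat, weight_nat, weight]
  change ((ν 0 + ν 1 : ℕ) : ℝ) + 1 ≤ _
  push_cast
  nlinarith

theorem rapidDecay_prodState {f : Fin 2 → ℕ → ℂ} (hf : ∀ l, RapidDecay (f l)) :
    RapidDecay (prodState f) := by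
  intro k
  obtain ⟨B, hB⟩ := hf 0 k
  obtain ⟨D, hD⟩ := hf 1 k
  refine ⟨B * D, fun ν => ?_⟩
  rw [prodState_apply, norm_mul]
  have h0 := (weight_pos (ν 0)).le
  have h1 := (weight_pos (ν 1)).le
  have h2 := (weight_pos ν).le
  calc weight ν ^ k * (‖f 0 (ν 0)‖ * ‖f 1 (ν 1)‖)
      ≤ (weight (ν 0) * weight (ν 1)) ^ k * (‖f 0 (ν 0)‖ * ‖f 1 (ν 1)‖) := by
        have := weight_occ_le ν
        gcongr
    _ = (weight (ν 0) ^ k * ‖f 0 (ν 0)‖) * (weight (ν 1) ^ k * ‖f 1 (ν 1)‖) := by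
        rw [mul_pow]; ring
    _ ≤ B * D := mul_le_mul (hB _) (hD _) (by positivity)
        ((by positivity : 0 ≤ weight (ν 0) ^ k * ‖f 0 (ν 0)‖).trans (hB (ν 0)))

theorem pair_prodState {f g : Fin 2 → ℕ → ℂ} (hf : ∀ l, RapidDecay (f l))
    (hg : ∀ l, RapidDecay (g l)) :
    pair (prodState f) (prodState g) = pair (f 0) (g 0) * pair (f 1) (g 1) := by
  rw [pair, pair, pair, tsum_mul_tsum_of_summable_norm ((hf 0).conj.mul (hg 0)).summable
    ((hf 1).conj.mul (hg 1)).summable, ← (finTwoArrowEquiv ℕ).tsum_eq]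
  refine tsum_congr fun ν => ?_
  rw [prodState_apply, prodState_apply, finTwoArrowEquiv_apply]
  simp
  ring

/-- Completeness is applied one variable at a time. The partial pairing of `g` with a state of the
second oscillator is square-summable in the first photon number by Cauchy–Schwarz and is orthogonal
to every state of the first oscillator, hence zero; then each row of `g` vanishes. -/
theorem eq_zero_of_pair_prodState {D : Fin 2 → ℕ → ℕ → ℂ} (hr : ∀ l n, RapidDecay (D l n))
    (hD : ∀ l (g : ℕ → ℂ), Summable (fun i => ‖g i‖ ^ 2) → (∀ n, pair (D l n) g = 0) → g = 0)
    {g : Occ → ℂ} (hg : Summable fun ν => ‖g ν‖ ^ 2)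
    (hp : ∀ n : Occ, pair (prodState fun l => D l (n l)) g = 0) : g = 0 := by
  let e := finTwoArrowEquiv ℕ
  let G : ℕ → ℕ → ℂ := fun i j => g (e.symm (i, j))
  have hG : Summable fun z : ℕ × ℕ => ‖G z.1 z.2‖ ^ 2 := e.symm.summable_iff.2 hg
  have hGi : ∀ i, Summable fun j => ‖G i j‖ ^ 2 := fun i => hG.prod_factor i
  have hGs : Summable fun i => ∑' j, ‖G i j‖ ^ 2 := hG.prod
  have key : ∀ n, (fun i => pair (D 1 n) (G i)) = 0 := by
    intro n
    refine hD 0 _ ?_ fun m => ?_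
    · exact Summable.of_nonneg_of_le (fun i => by positivity)
        (fun i => norm_pair_sq_le (hr 1 n).summable_sq (hGi i)) (hGs.mul_left _)
    · have h1 := hp ![m, n]
      rw [pair, ← e.symm.tsum_eq] at h1
      -- Splitting the double sum needs absolute convergence: the two states are summable and the
      -- square-summable `G` is bounded.
      have hs : Summable fun z : ℕ × ℕ =>
          conj (D 0 m z.1) * (conj (D 1 n z.2) * G z.1 z.2) := by
        have hb : ∀ z : ℕ × ℕ, ‖G z.1 z.2‖ ≤ Real.sqrt (∑' z : ℕ × ℕ, ‖G z.1 z.2‖ ^ 2) :=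
          fun z => Real.le_sqrt_of_sq_le
            (hG.le_tsum (f := fun z : ℕ × ℕ => ‖G z.1 z.2‖ ^ 2) z fun _ _ => by positivity)
        have h2 := ((hr 0 m).conj.summable.mul_of_nonneg (hr 1 n).conj.summable
          (fun _ => norm_nonneg _) (fun _ => norm_nonneg _)).mul_right
            (Real.sqrt (∑' z : ℕ × ℕ, ‖G z.1 z.2‖ ^ 2))
        refine Summable.of_norm_bounded h2 fun z => ?_
        rw [norm_mul, norm_mul, ← mul_assoc]
        exact mul_le_mul_of_nonneg_left (hb z) (by positivity)
      have h3 : ∑' z : ℕ × ℕ, conj (D 0 m z.1) * (conj (D 1 n z.2) * G z.1 z.2) = 0 := by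
        rw [← h1]
        refine tsum_congr fun z => ?_
        rw [prodState_apply]
        simp [G, e, finTwoArrowEquiv, mul_assoc]
      rw [hs.tsum_prod] at h3
      rw [pair, ← h3]
      refine tsum_congr fun i => ?_
      exact tsum_mul_left.symm
  funext ν
  have h1 := hD 1 (G (ν 0)) (hGi _) fun n => congrFun (key n) (ν 0)
  have h3 : e.symm (ν 0, ν 1) = ν := e.symm_apply_apply ν
  rw [← h3]
  exact congrFun h1 (ν 1)

end TwoModes

end Completeness

end CavityQED

namespace CavityQED

/-! ### Lifting one-oscillator operators to the two polarizations. -/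

section OnMode

open Function

variable (l l' : Fin 2) (S T : Module.End ℂ (ℕ → ℂ))

theorem onMode_apply (f : Occ → ℂ) (n : Occ) :
    onMode l T f n = T (fun k => f (update n l k)) (n l) := rfl

theorem onMode_add : onMode l (S + T) = onMode l S + onMode l T := rfl

theorem onMode_sub : onMode l (S - T) = onMode l S - onMode l T := rfl

theorem onMode_smul (z : ℂ) : onMode l (z • T) = z • onMode l T := rfl

theorem onMode_one : onMode l 1 = 1 := by
  refine LinearMap.ext fun f => funext fun n => ?_
  simp [onMode_apply]

theorem onMode_mul : onMode l (S * T) = onMode l S * onMode l T := by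
  refine LinearMap.ext fun f => funext fun n => ?_
  simp [onMode_apply]

theorem onMode_squeeze (x y s : ℝ) : onMode l (squeeze x y s) =
    (x : ℂ) • onMode l ann + (y : ℂ) • onMode l cre - (s : ℂ) • 1 := by
  rw [squeeze, onMode_sub, onMode_add, onMode_smul, onMode_smul, onMode_smul, onMode_one]

theorem isLadder_onMode : IsLadder (fun n : Occ => update n l (n l + 1))
    (fun n => Real.sqrt (n l + 1)) (onMode l ann) (onMode l cre) where
  inj n m h := by
    funext k
    by_cases hk : k = l
    · subst hk
      have := congrFun h k
      simpa using this
    · have := congrFun h k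
      simpa [hk] using this
  size_le n := by
    change n 0 + n 1 ≤ update n l (n l + 1) 0 + update n l (n l + 1) 1
    fin_cases l <;> simp
  le_size n := by
    change update n l (n l + 1) 0 + update n l (n l + 1) 1 ≤ n 0 + n 1 + 1
    fin_cases l <;> simp <;> omega
  abs_le n := by
    refine (sqrt_le_add_one (n l)).trans ?_
    have : n l ≤ n 0 + n 1 := by fin_cases l <;> simp
    have h2 : (n l : ℝ) ≤ (n 0 + n 1 : ℕ) := by exact_mod_cast this
    exact add_le_add_left h2 1
  lower f n := by simp [onMode_apply, ann_apply]
  raise f n := by simp [onMode_apply, cre_apply]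
  raise_zero f n hn := by
    rw [onMode_apply, cre_apply]
    by_cases h : n l = 0
    · simp [h]
    · refine absurd ⟨update n l (n l - 1), ?_⟩ hn
      simp [Nat.sub_add_cancel (Nat.pos_of_ne_zero h)]

theorem isAdj_onMode_squeeze (x y s : ℝ) :
    IsAdj (onMode l (squeeze x y s)) (onMode l (squeeze y x s)) := by
  have h := (isLadder_onMode l).isAdj
  have e : ∀ x y : ℝ, onMode l (squeeze x y s) =
      (x : ℂ) • onMode l ann + (y : ℂ) • onMode l cre + ((-s : ℝ) : ℂ) • 1 := fun x y => by
    rw [onMode_squeeze, Complex.ofReal_neg]; module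
  rw [e, e, add_comm ((y : ℂ) • onMode l ann)]
  exact ((h.smul x).add (h.symm.smul y)).add (IsAdj.one.smul _)

variable {l l'}

theorem commute_ann_ann (h : l ≠ l') : Commute (onMode l ann) (onMode l' ann) := by
  refine LinearMap.ext fun f => funext fun n => ?_
  simp [onMode_apply, ann_apply, h, h.symm, update_comm h, mul_left_comm]

theorem commute_ann_cre (h : l ≠ l') : Commute (onMode l ann) (onMode l' cre) := by
  refine LinearMap.ext fun f => funext fun n => ?_
  simp [onMode_apply, ann_apply, cre_apply, h, h.symm, update_comm h, mul_left_comm]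

theorem commute_cre_cre (h : l ≠ l') : Commute (onMode l cre) (onMode l' cre) := by
  refine LinearMap.ext fun f => funext fun n => ?_
  simp [onMode_apply, cre_apply, h, h.symm, update_comm h, mul_left_comm]

theorem commute_squeeze (h : l ≠ l') (x y s x' y' s' : ℝ) :
    Commute (onMode l (squeeze x y s)) (onMode l' (squeeze x' y' s')) := by
  rw [onMode_squeeze, onMode_squeeze]
  have h1 : ∀ (a b c d : ℂ), Commute (a • onMode l ann + b • onMode l cre)
      (c • onMode l' ann + d • onMode l' cre) := fun a b c d =>
    ((((commute_ann_ann h).smul_left a).smul_right c).add_right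
      (((commute_ann_cre h).smul_left a).smul_right d)).add_left
    ((((commute_ann_cre h.symm).symm.smul_left b).smul_right c).add_right
      (((commute_cre_cre h).smul_left b).smul_right d))
  exact ((h1 _ _ _ _).sub_right ((Commute.one_right _).smul_right _)).sub_left
    ((Commute.one_left _).smul_left _)

theorem bosonic_relations {x y : ℝ} (h : x ^ 2 - y ^ 2 = 1) (s : Fin 2 → ℝ) (l l' : Fin 2) :
    onMode l (squeeze x y (s l)) * onMode l' (squeeze y x (s l'))
        - onMode l' (squeeze y x (s l')) * onMode l (squeeze x y (s l))
      = (if l = l' then 1 else 0) ∧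
    onMode l (squeeze x y (s l)) * onMode l' (squeeze x y (s l'))
      = onMode l' (squeeze x y (s l')) * onMode l (squeeze x y (s l)) ∧
    onMode l (squeeze y x (s l)) * onMode l' (squeeze y x (s l'))
      = onMode l' (squeeze y x (s l')) * onMode l (squeeze y x (s l)) := by
  by_cases hl : l = l'
  · subst hl
    refine ⟨?_, rfl, rfl⟩
    rw [← onMode_mul, ← onMode_mul, ← onMode_sub, squeeze_commutator h, onMode_one, if_pos rfl]
  · refine ⟨?_, (commute_squeeze hl _ _ _ _ _ _).eq, (commute_squeeze hl _ _ _ _ _ _).eq⟩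
    rw [(commute_squeeze hl _ _ _ _ _ _).eq, sub_self, if_neg hl]

theorem onMode_prodState (l : Fin 2) (T : Module.End ℂ (ℕ → ℂ)) (f : Fin 2 → ℕ → ℂ) :
    onMode l T (prodState f) = prodState (update f l (T (f l))) := by
  funext ν
  rw [onMode_apply]
  fin_cases l
  · have : (fun k => prodState f (update ν 0 k)) = f 1 (ν 1) • f 0 := by
      funext k; simp [prodState_apply, mul_comm]
    change T (fun k => prodState f (update ν 0 k)) (ν 0) = _
    rw [this, map_smul]
    simp [prodState_apply, mul_comm]
  · have : (fun k => prodState f (update ν 1 k)) = f 0 (ν 0) • f 1 := by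
      funext k; simp [prodState_apply]
    change T (fun k => prodState f (update ν 1 k)) (ν 1) = _
    rw [this, map_smul]
    simp [prodState_apply]

theorem onMode_prodState_of_eigen (l : Fin 2) {T : Module.End ℂ (ℕ → ℂ)} {f : Fin 2 → ℕ → ℂ}
    {z : ℂ} (h : T (f l) = z • f l) : onMode l T (prodState f) = z • prodState f := by
  rw [onMode_prodState, h]
  funext ν
  fin_cases l <;> simp [prodState_apply, mul_assoc, mul_left_comm]

end OnMode

/-! ### Dressed frequency, Bogoliubov coefficients and the reduced photon Hamiltonian. -/

namespace Params

variable (P : Params)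

theorem V_pos : 0 < P.V := mul_pos (pow_pos P.L_pos 2) P.Lz_pos

theorem plasmaFreq_sq :
    P.plasmaFreq ^ 2 = P.charge ^ 2 * P.N / (P.mass * P.eps0 * P.V) := by
  have := P.V_pos
  have := P.mass_pos
  have := P.eps0_pos
  exact Real.sq_sqrt (by positivity)

theorem dressedFreq_sq : P.dressedFreq ^ 2 = P.freq ^ 2 + P.plasmaFreq ^ 2 :=
  Real.sq_sqrt (by positivity)

theorem dressedFreq_pos : 0 < P.dressedFreq := by
  have := P.freq_pos
  exact Real.sqrt_pos.2 (by positivity)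

theorem N_cast_pos : (0 : ℝ) < P.N := by exact_mod_cast P.N_pos

theorem g0_sq : P.g0 ^ 2 = (P.charge * P.hbar / P.mass) ^ 2 *
    (P.hbar / (P.eps0 * P.V * (2 * P.dressedFreq))) := by
  have := P.V_pos
  have := P.hbar_pos
  have := P.eps0_pos
  have := P.dressedFreq_pos
  rw [g0, mul_pow, Real.sq_sqrt (by positivity)]

theorem gamma_eq_div : P.gamma = P.plasmaFreq ^ 2 / P.dressedFreq ^ 2 := by
  rw [dressedFreq_sq, gamma]

theorem gamma_eq : P.gamma =
    2 * P.mass * P.N / P.hbar ^ 2 * (P.g0 ^ 2 / (P.hbar * P.dressedFreq)) := by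
  have := P.V_pos.ne'
  have := P.hbar_pos.ne'
  have := P.eps0_pos.ne'
  have := P.mass_pos.ne'
  have := P.dressedFreq_pos.ne'
  rw [gamma_eq_div, g0_sq, plasmaFreq_sq]
  field_simp

theorem gamma_nonneg : 0 ≤ P.gamma := by rw [gamma]; positivity

theorem gamma_lt_one : P.gamma < 1 := by
  have := P.freq_pos
  rw [gamma, div_lt_one (by positivity)]
  exact lt_add_of_pos_left _ (by positivity)

/-- The coefficient `(ω̃ + ω) / (2 √(ω ω̃))` of the Bogoliubov transformation. -/
noncomputable def bogX : ℝ := (P.dressedFreq + P.freq) / (2 * Real.sqrt (P.freq * P.dressedFreq))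

/-- The coefficient `(ω̃ - ω) / (2 √(ω ω̃))` of the Bogoliubov transformation. -/
noncomputable def bogY : ℝ := (P.dressedFreq - P.freq) / (2 * Real.sqrt (P.freq * P.dressedFreq))

theorem sqrt_freq_pos : 0 < Real.sqrt (P.freq * P.dressedFreq) :=
  Real.sqrt_pos.2 (mul_pos P.freq_pos P.dressedFreq_pos)

theorem sqrt_freq_sq : Real.sqrt (P.freq * P.dressedFreq) ^ 2 = P.freq * P.dressedFreq :=
  Real.sq_sqrt (mul_pos P.freq_pos P.dressedFreq_pos).le

theorem bogX_pos : 0 < P.bogX :=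
  div_pos (add_pos P.dressedFreq_pos P.freq_pos) (mul_pos two_pos P.sqrt_freq_pos)

theorem bogX_sq : P.bogX ^ 2 =
    (P.dressedFreq + P.freq) ^ 2 / (4 * (P.freq * P.dressedFreq)) := by
  rw [bogX, div_pow, mul_pow, sqrt_freq_sq]; norm_num

theorem bogY_sq : P.bogY ^ 2 =
    (P.dressedFreq - P.freq) ^ 2 / (4 * (P.freq * P.dressedFreq)) := by
  rw [bogY, div_pow, mul_pow, sqrt_freq_sq]; norm_num

theorem bogX_mul_bogY : P.bogX * P.bogY =
    P.plasmaFreq ^ 2 / (4 * (P.freq * P.dressedFreq)) := by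
  have h : P.plasmaFreq ^ 2 = (P.dressedFreq + P.freq) * (P.dressedFreq - P.freq) := by
    linarith [P.dressedFreq_sq]
  rw [bogX, bogY, div_mul_div_comm, mul_mul_mul_comm, ← sq (Real.sqrt _), sqrt_freq_sq, h]
  norm_num

/-- With this normalization all general results on `squeeze` apply to `b` (zero displacement) and to
`c`. -/
theorem bog_sq_sub : P.bogX ^ 2 - P.bogY ^ 2 = 1 := by
  have := P.freq_pos.ne'
  have := P.dressedFreq_pos.ne'
  rw [bogX_sq, bogY_sq]
  field_simp
  ring

theorem bAnn_eq : P.bAnn = squeeze P.bogX P.bogY 0 := by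
  simp only [bAnn, squeeze, bogX, bogY]
  push_cast
  module

theorem bCre_eq : P.bCre = squeeze P.bogY P.bogX 0 := by
  simp only [bCre, squeeze, bogX, bogY]
  push_cast
  module

theorem cAnn_eq (κ : ℝ) : P.cAnn κ = squeeze P.bogX P.bogY (P.shift κ) := by
  rw [cAnn, bAnn_eq, squeeze, squeeze]; simp

theorem cCre_eq (κ : ℝ) : P.cCre κ = squeeze P.bogY P.bogX (P.shift κ) := by
  rw [cCre, bCre_eq, squeeze, squeeze]; simp

theorem vecPot_eq (i : Fin 2) : P.vecPot i =
    ((Real.sqrt (P.hbar / (P.eps0 * P.V)) / Real.sqrt (2 * P.freq) : ℝ) : ℂ) •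
      (onMode i ann + onMode i cre) := by
  rw [vecPot, Finset.sum_eq_single i (fun l _ hl => by simp [pol, hl.symm])
    (fun h => absurd (Finset.mem_univ i) h), smul_smul]
  simp [pol, div_eq_mul_inv]

theorem bAnn_add_bCre : P.bAnn + P.bCre =
    ((Real.sqrt (2 * P.dressedFreq) / Real.sqrt (2 * P.freq) : ℝ) : ℂ) • (ann + cre) := by
  have h1 : P.bogX + P.bogY = Real.sqrt (2 * P.dressedFreq) / Real.sqrt (2 * P.freq) := by
    have h2 := P.sqrt_freq_pos
    have h3 : 0 < Real.sqrt (2 * P.freq) := Real.sqrt_pos.2 (mul_pos two_pos P.freq_pos)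
    have h4 : Real.sqrt (2 * P.dressedFreq) * Real.sqrt (P.freq * P.dressedFreq) =
        P.dressedFreq * Real.sqrt (2 * P.freq) := by
      rw [← Real.sqrt_mul (by have := P.dressedFreq_pos; positivity),
        show 2 * P.dressedFreq * (P.freq * P.dressedFreq) = P.dressedFreq ^ 2 * (2 * P.freq) by
          ring, Real.sqrt_mul (sq_nonneg _), Real.sqrt_sq P.dressedFreq_pos.le]
    rw [bogX, bogY, ← add_div, div_eq_div_iff (by positivity) h3.ne']
    linarith
  rw [bAnn_eq, bCre_eq, ← h1, squeeze, squeeze]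
  push_cast
  module

theorem vecPot_eq_dressed (i : Fin 2) : P.vecPot i =
    ((Real.sqrt (P.hbar / (P.eps0 * P.V)) / Real.sqrt (2 * P.dressedFreq) : ℝ) : ℂ) •
      (onMode i P.bAnn + onMode i P.bCre) := by
  have h : Real.sqrt (2 * P.dressedFreq) ≠ 0 :=
    (Real.sqrt_pos.2 (mul_pos two_pos P.dressedFreq_pos)).ne'
  rw [vecPot_eq, ← onMode_add, ← onMode_add, bAnn_add_bCre, onMode_smul, smul_smul,
    ← Complex.ofReal_mul, div_mul_div_cancel₀ h]

theorem vecPot_eq_sum_dressed (i : Fin 2) :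
    P.vecPot i = ((Real.sqrt (P.hbar / (P.eps0 * P.V)) : ℝ) : ℂ) •
      ∑ l : Fin 2, ((pol l i / Real.sqrt (2 * P.dressedFreq) : ℝ) : ℂ) •
        (onMode l P.bAnn + onMode l P.bCre) := by
  rw [vecPot_eq_dressed,
    Finset.sum_eq_single i (fun l _ hl => by simp [pol, hl.symm])
    (fun h => absurd (Finset.mem_univ i) h), smul_smul]
  simp [pol, div_eq_mul_inv]

theorem photonHam_eq : P.photonHam = ∑ l : Fin 2,
    (((P.hbar * P.freq : ℝ) : ℂ) • (onMode l cre * onMode l ann + (1 / 2 : ℂ) • 1)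
      + ((P.hbar * P.plasmaFreq ^ 2 / (4 * P.freq) : ℝ) : ℂ) •
          (onMode l ann + onMode l cre) ^ 2) := by
  have h1 := P.V_pos
  have h2 := P.hbar_pos
  have h3 := P.eps0_pos
  have h4 := P.mass_pos
  have h5 := P.freq_pos
  have hc : P.N * P.charge ^ 2 / (2 * P.mass) *
      ((Real.sqrt (P.hbar / (P.eps0 * P.V)) / Real.sqrt (2 * P.freq)) *
        (Real.sqrt (P.hbar / (P.eps0 * P.V)) / Real.sqrt (2 * P.freq))) =
      P.hbar * P.plasmaFreq ^ 2 / (4 * P.freq) := by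
    rw [div_mul_div_comm, Real.mul_self_sqrt (by positivity), Real.mul_self_sqrt (by positivity),
      plasmaFreq_sq]
    field_simp
    ring
  rw [photonHam, Finset.sum_add_distrib, add_comm, Finset.smul_sum]
  congr 1
  refine Finset.sum_congr rfl fun i _ => ?_
  rw [vecPot_eq, smul_mul_smul_comm, smul_smul, ← hc, sq]
  push_cast
  rfl

/-- Both sides are put in normal order and the coefficients of `a†a`, of `1` and of `aa + a†a†` are
compared, using `ω_p² = ω̃² - ω²`. These comparisons are `e2`, `e3` and `e1`. -/
theorem cre_mul_ann_dressed :
    ((P.hbar * P.freq : ℝ) : ℂ) • (cre * ann + (1 / 2 : ℂ) • 1)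
      + ((P.hbar * P.plasmaFreq ^ 2 / (4 * P.freq) : ℝ) : ℂ) • (ann + cre) ^ 2 =
    ((P.hbar * P.dressedFreq : ℝ) : ℂ) • (P.bCre * P.bAnn + (1 / 2 : ℂ) • 1) := by
  have h : ann * cre = cre * ann + 1 := by rw [← ann_mul_cre]; abel
  have hf := P.freq_pos.ne'
  have hd := P.dressedFreq_pos.ne'
  have hp : P.plasmaFreq ^ 2 = P.dressedFreq ^ 2 - P.freq ^ 2 := by linarith [P.dressedFreq_sq]
  have e1 : P.hbar * P.plasmaFreq ^ 2 / (4 * P.freq) =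
      P.hbar * P.dressedFreq * (P.bogX * P.bogY) := by
    rw [bogX_mul_bogY]; field_simp
  have e2 : P.hbar * P.freq + 2 * (P.hbar * P.plasmaFreq ^ 2 / (4 * P.freq)) =
      P.hbar * P.dressedFreq * (P.bogX ^ 2 + P.bogY ^ 2) := by
    rw [bogX_sq, bogY_sq, hp]; field_simp; ring
  have e3 : P.hbar * P.freq / 2 + P.hbar * P.plasmaFreq ^ 2 / (4 * P.freq) =
      P.hbar * P.dressedFreq * (P.bogY ^ 2 + 1 / 2) := by
    rw [bogY_sq, hp]; field_simp; ring
  have hb : P.bCre * P.bAnn = ((P.bogX * P.bogY : ℝ) : ℂ) • (ann * ann + cre * cre) +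
      ((P.bogX ^ 2 + P.bogY ^ 2 : ℝ) : ℂ) • (cre * ann) + ((P.bogY ^ 2 : ℝ) : ℂ) • 1 := by
    rw [bCre_eq, bAnn_eq, squeeze, squeeze]
    simp only [Complex.ofReal_zero, zero_smul, sub_zero, mul_add, add_mul, smul_mul_assoc,
      mul_smul_comm, h]
    push_cast
    module
  have hs : (ann + cre) ^ 2 = (ann * ann + cre * cre) + (2 : ℂ) • (cre * ann) + 1 := by
    rw [sq, mul_add, add_mul, add_mul, h]; module
  rw [hb, hs]
  generalize hk : P.hbar * P.plasmaFreq ^ 2 / (4 * P.freq) = k at *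
  have e1' : (k : ℂ) = ((P.hbar * P.dressedFreq : ℝ) : ℂ) * ((P.bogX * P.bogY : ℝ) : ℂ) := by
    exact_mod_cast e1
  have e2' : ((P.hbar * P.freq : ℝ) : ℂ) + 2 * k =
      ((P.hbar * P.dressedFreq : ℝ) : ℂ) * ((P.bogX ^ 2 + P.bogY ^ 2 : ℝ) : ℂ) := by
    exact_mod_cast e2
  have e3' : ((P.hbar * P.freq : ℝ) : ℂ) / 2 + k =
      ((P.hbar * P.dressedFreq : ℝ) : ℂ) * (((P.bogY ^ 2 : ℝ) : ℂ) + 1 / 2) := by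
    have := congrArg (fun x : ℝ => (x : ℂ)) e3
    push_cast at this ⊢
    exact this
  push_cast at e1' e2' e3'
  match_scalars
  · linear_combination e2'
  · linear_combination e3'
  · linear_combination e1'
  · linear_combination e1'

theorem photonHam_eq_dressed : P.photonHam = ∑ l : Fin 2, ((P.hbar * P.dressedFreq : ℝ) : ℂ) •
    (onMode l P.bCre * onMode l P.bAnn + (1 / 2 : ℂ) • 1) := by
  rw [photonHam_eq]
  refine Finset.sum_congr rfl fun l _ => ?_
  have h := congrArg (onMode l) P.cre_mul_ann_dressed
  simpa only [onMode_add, onMode_smul, onMode_mul, onMode_one, sq] using h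

/-- Completing the square: `shift κ` is the displacement at which the linear terms of `c†c`
reproduce the coupling to `K`. -/
theorem number_shift (κ : ℝ) :
    ((P.hbar * P.dressedFreq : ℝ) : ℂ) • (P.bCre * P.bAnn + (1 / 2 : ℂ) • 1)
      - ((P.g0 * κ : ℝ) : ℂ) • (P.bAnn + P.bCre) =
    ((P.hbar * P.dressedFreq : ℝ) : ℂ) • (P.cCre κ * P.cAnn κ + (1 / 2 : ℂ) • 1)
      - ((P.g0 ^ 2 / (P.hbar * P.dressedFreq) * κ ^ 2 : ℝ) : ℂ) • 1 := by
  have hf := P.hbar_pos.ne'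
  have hd := P.dressedFreq_pos.ne'
  have e1 : P.g0 * κ = P.hbar * P.dressedFreq * P.shift κ := by rw [shift]; field_simp
  have e2 : P.g0 ^ 2 / (P.hbar * P.dressedFreq) * κ ^ 2 =
      P.hbar * P.dressedFreq * P.shift κ ^ 2 := by rw [shift]; field_simp
  rw [e1, e2, cCre, cAnn]
  simp only [mul_sub, sub_mul, smul_mul_assoc, mul_smul_comm, one_mul, mul_one]
  push_cast
  module

theorem projHam_eq (q : Fin P.N → Orbital) :
    P.projHam q = (∑ l : Fin 2, (((P.hbar * P.dressedFreq : ℝ) : ℂ) •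
          (onMode l (P.cCre (P.polK q l)) * onMode l (P.cAnn (P.polK q l)) + (1 / 2 : ℂ) • 1)
        - ((P.g0 ^ 2 / (P.hbar * P.dressedFreq) * P.polK q l ^ 2 : ℝ) : ℂ) • 1))
      + (P.kinetic q : ℂ) • 1 := by
  rw [projHam]
  congr 1
  refine Finset.sum_congr rfl fun l _ => ?_
  have h := congrArg (onMode l) (P.number_shift (P.polK q l))
  simpa only [onMode_add, onMode_sub, onMode_smul, onMode_mul, onMode_one] using h

/-- All coefficients are real, and `b†b`, `b + b†` and `1` are formally self-adjoint on rapidly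
decreasing sequences. -/
theorem isAdj_projHam (q : Fin P.N → Orbital) : IsAdj (P.projHam q) (P.projHam q) := by
  have e : P.projHam q = (∑ l : Fin 2, (((P.hbar * P.dressedFreq : ℝ) : ℂ) •
        (onMode l (squeeze P.bogY P.bogX 0) * onMode l (squeeze P.bogX P.bogY 0)
          + ((1 / 2 : ℝ) : ℂ) • 1)
      + ((-(P.g0 * P.polK q l) : ℝ) : ℂ) •
        (onMode l (squeeze P.bogX P.bogY 0) + onMode l (squeeze P.bogY P.bogX 0))))
    + (P.kinetic q : ℂ) • 1 := by
    rw [projHam, bAnn_eq, bCre_eq]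
    congr 1
    refine Finset.sum_congr rfl fun l _ => ?_
    push_cast
    module
  rw [e]
  refine IsAdj.add (IsAdj.sum _ fun l => ?_) (IsAdj.one.smul _)
  have h := isAdj_onMode_squeeze l P.bogX P.bogY 0
  refine IsAdj.add (((h.symm.mul h).add (IsAdj.one.smul _)).smul _) ?_
  refine IsAdj.smul _ ?_
  have h2 := h.add h.symm
  rwa [add_comm (onMode l (squeeze P.bogY P.bogX 0))] at h2

end Params

end CavityQED

namespace CavityQED

namespace Params

open scoped ComplexConjugate

variable (P : Params)

/-! ### Fourier modes on the configuration torus. -/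

section Modes

/-- The Fourier mode `∏ e^{2πi p x / L}` on the configuration torus. -/
noncomputable def mode (p : Fin P.N → Fin 2 → ℤ) : C(P.Pos, ℂ) where
  toFun x := ∏ j, ∏ i, fourier (p j i) (x j i)
  continuous_toFun := by fun_prop

theorem mode_apply (p : Fin P.N → Fin 2 → ℤ) (x : P.Pos) :
    P.mode p x = ∏ j, ∏ i, fourier (p j i) (x j i) := rfl

theorem mode_neg (p : Fin P.N → Fin 2 → ℤ) (x : P.Pos) : P.mode (-p) x = conj (P.mode p x) := by
  simp only [mode_apply, Pi.neg_apply, fourier_neg, map_prod]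

theorem mode_add (p p' : Fin P.N → Fin 2 → ℤ) (x : P.Pos) :
    P.mode (p + p') x = P.mode p x * P.mode p' x := by
  simp only [mode_apply, Pi.add_apply, fourier_add, ← Finset.prod_mul_distrib]

theorem mode_zero : P.mode 0 = 1 := by
  ext x
  simp [mode_apply]

theorem mode_single (j : Fin P.N) (i : Fin 2) (x : P.Pos) :
    P.mode (Pi.single j (Pi.single i 1)) x = fourier 1 (x j i) := by
  rw [mode_apply, Finset.prod_eq_single j, Finset.prod_eq_single i]
  · simp
  · intro b _ hb
    simp [hb]
  · simp
  · intro b _ hb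
    simp [hb]
  · simp

/-- The star subalgebra of continuous functions generated by the Fourier modes. -/
noncomputable def modeSubalgebra : StarSubalgebra ℂ C(P.Pos, ℂ) where
  toSubalgebra := Algebra.adjoin ℂ (Set.range P.mode)
  star_mem' := by
    change Algebra.adjoin ℂ (Set.range P.mode) ≤ star (Algebra.adjoin ℂ (Set.range P.mode))
    refine Algebra.adjoin_le ?_
    rintro _ ⟨n, rfl⟩
    refine Algebra.subset_adjoin ⟨-n, ?_⟩
    ext1 x
    simp only [mode_neg, starRingEnd_apply, ContinuousMap.star_apply]

/-- Modes are closed under multiplication and contain `1`, so the algebra they generate is just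
their linear span. -/
theorem modeSubalgebra_coe :
    P.modeSubalgebra.toSubalgebra.toSubmodule = Submodule.span ℂ (Set.range P.mode) := by
  apply Algebra.adjoin_eq_span_of_subset
  refine .trans (fun x ↦ Submonoid.closure_induction (fun _ ↦ id) ⟨0, P.mode_zero⟩ ?_)
    Submodule.subset_span
  rintro _ _ _ _ ⟨m, rfl⟩ ⟨n, rfl⟩
  refine ⟨m + n, ?_⟩
  ext z
  exact P.mode_add m n z

theorem modeSubalgebra_separatesPoints : P.modeSubalgebra.SeparatesPoints := by
  intro x y hxy
  obtain ⟨j, hj⟩ := Function.ne_iff.1 hxy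
  obtain ⟨i, hi⟩ := Function.ne_iff.1 hj
  refine ⟨_, ⟨P.mode (Pi.single j (Pi.single i 1)), Algebra.subset_adjoin ⟨_, rfl⟩, rfl⟩, ?_⟩
  intro h
  refine hi (AddCircle.injective_toCircle P.L_pos.ne' ?_)
  have h1 := (P.mode_single j i x).symm.trans (Eq.trans h (P.mode_single j i y))
  rw [fourier_one, fourier_one] at h1
  exact Subtype.coe_injective h1

/-- Stone–Weierstrass: conjugation sends a mode to a mode, and the modes `e^{2πi x / L}` in single
coordinates separate points. -/
theorem span_mode_closure_eq_top :
    (Submodule.span ℂ (Set.range P.mode)).topologicalClosure = ⊤ := by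
  rw [← modeSubalgebra_coe]
  exact congrArg (Subalgebra.toSubmodule <| StarSubalgebra.toSubalgebra ·)
    (ContinuousMap.starSubalgebra_topologicalClosure_eq_top_of_separatesPoints _
      P.modeSubalgebra_separatesPoints)

theorem ae_eq_zero_of_integral_mode {g : P.Pos → ℂ} (hg : MemLp g 2)
    (h : ∀ p, ∫ x, conj (P.mode p x) * g x = 0) : g =ᵐ[volume] 0 := by
  have hd : (Submodule.span ℂ (Set.range fun p =>
      (ContinuousMap.toLp (E := ℂ) 2 volume ℂ (P.mode p) : Lp ℂ 2 (volume : Measure P.Pos)))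
      ).topologicalClosure = ⊤ := by
    simpa only [Submodule.map_span, ContinuousLinearMap.coe_coe, ← Set.range_comp,
      Function.comp_def] using
      (ContinuousMap.toLp_denseRange ℂ (volume : Measure P.Pos) ℂ
        (p := 2) (by simp)).topologicalClosure_map_submodule P.span_mode_closure_eq_top
  have h0 : hg.toLp g = 0 := by
    refine Dense.eq_zero_of_inner_right ℂ
      (Submodule.dense_iff_topologicalClosure_eq_top.2 hd) fun v hv => ?_
    induction hv using Submodule.span_induction with
    | mem v hv =>
      obtain ⟨p, rfl⟩ := hv
      rw [L2.inner_def, ← h p]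
      refine integral_congr_ae ?_
      filter_upwards [hg.coeFn_toLp, ContinuousMap.coeFn_toLp (p := 2) (𝕜 := ℂ)
        (volume : Measure P.Pos) (P.mode p)] with x h1 h2
      rw [h1, h2, RCLike.inner_apply, mul_comm]
    | zero => exact inner_zero_left _
    | add v w _ _ h1 h2 => rw [inner_add_left, h1, h2, add_zero]
    | smul z v _ h1 => rw [inner_smul_left, h1, mul_zero]
  exact (hg.coeFn_toLp).symm.trans (h0 ▸ Lp.coeFn_zero ℂ 2 volume)

theorem integral_conj_fourier_mul (m n : ℤ) :
    ∫ x : AddCircle P.L, conj (fourier m x) * fourier n x = if m = n then (P.L : ℂ) else 0 := by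
  have h := congrFun (fourierCoeff_fourier (T := P.L) n) m
  rw [fourierCoeff, AddCircle.integral_haarAddCircle] at h
  have hL : (P.L : ℂ) ≠ 0 := by exact_mod_cast P.L_pos.ne'
  simp only [fourier_neg, smul_eq_mul, Complex.real_smul, Complex.ofReal_inv] at h
  rw [inv_mul_eq_iff_eq_mul₀ hL] at h
  rw [h, Pi.single_apply]
  split_ifs <;> simp

theorem integral_conj_mode_mul (p p' : Fin P.N → Fin 2 → ℤ) :
    ∫ x : P.Pos, conj (P.mode p x) * P.mode p' x =
      if p = p' then ((P.L : ℂ) ^ 2) ^ P.N else 0 := by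
  have h1 : ∀ x : P.Pos, conj (P.mode p x) * P.mode p' x =
      ∏ j, ∏ i, conj (fourier (p j i) (x j i)) * fourier (p' j i) (x j i) := fun x => by
    simp only [mode_apply, map_prod, ← Finset.prod_mul_distrib]
  simp only [h1]
  rw [integral_fintype_prod_volume_eq_prod (fun (j : Fin P.N) (y : Fin 2 → AddCircle P.L) =>
    ∏ i, conj (fourier (p j i) (y i)) * fourier (p' j i) (y i))]
  have h2 : ∀ j, ∫ y : Fin 2 → AddCircle P.L,
      ∏ i, conj (fourier (p j i) (y i)) * fourier (p' j i) (y i) =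
      ∏ i, if p j i = p' j i then (P.L : ℂ) else 0 := fun j => by
    rw [integral_fintype_prod_volume_eq_prod (fun i (z : AddCircle P.L) =>
      conj (fourier (p j i) z) * fourier (p' j i) z)]
    simp only [integral_conj_fourier_mul]
  simp only [h2]
  split_ifs with h
  · subst h; simp
  · obtain ⟨j, hj⟩ := Function.ne_iff.1 h
    obtain ⟨i, hi⟩ := Function.ne_iff.1 hj
    exact Finset.prod_eq_zero (Finset.mem_univ j)
      (Finset.prod_eq_zero (Finset.mem_univ i) (if_neg hi))

end Modes

/-! ### Configuration space as a countable union of copies of the torus. -/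

section Slices

/-- Each discrete configuration has mass one, so the torus embeds measure-preservingly as a slice.
The other slice lemmas transfer almost-everywhere statements, integrals and integrability through
this identity. -/
theorem map_slice (d : P.Spins × Occ) : Measure.map (fun x : P.Pos => (x, d)) volume =
    P.confMeasure.restrict (Set.univ ×ˢ {d}) := by
  rw [confMeasure, ← Measure.prod_restrict, Measure.restrict_univ, Measure.restrict_singleton,
    Measure.count_singleton, one_smul, Measure.prod_dirac]

theorem measurableEmbedding_slice (d : P.Spins × Occ) :
    MeasurableEmbedding fun x : P.Pos => (x, d) :=
  measurableEmbedding_prod_mk_right d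

theorem ae_slice {p : P.Conf → Prop} (h : ∀ᵐ z ∂P.confMeasure, p z) (d : P.Spins × Occ) :
    ∀ᵐ x : P.Pos, p (x, d) := by
  have h1 : ∀ᵐ z ∂Measure.map (fun x : P.Pos => (x, d)) volume, p z := by
    rw [map_slice]; exact ae_restrict_of_ae h
  exact (P.measurableEmbedding_slice d).ae_map_iff.1 h1

theorem ae_of_slices {p : P.Conf → Prop} (h : ∀ d, ∀ᵐ x : P.Pos, p (x, d)) :
    ∀ᵐ z ∂P.confMeasure, p z := by
  have h1 : ∀ᵐ z ∂P.confMeasure.restrict (⋃ d, (Set.univ : Set P.Pos) ×ˢ {d}), p z := by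
    rw [ae_restrict_iUnion_iff]
    intro d
    rw [← map_slice, (P.measurableEmbedding_slice d).ae_map_iff]
    exact h d
  have h2 : (⋃ d, (Set.univ : Set P.Pos) ×ˢ {d}) = (Set.univ : Set P.Conf) := by
    ext z; simp
  rwa [h2, Measure.restrict_univ] at h1

theorem integral_slice (d : P.Spins × Occ) {g : P.Conf → ℂ} (hg : ∀ z, z.2 ≠ d → g z = 0) :
    ∫ z, g z ∂P.confMeasure = ∫ x : P.Pos, g (x, d) := by
  rw [← (P.measurableEmbedding_slice d).integral_map, map_slice]
  refine (setIntegral_eq_integral_of_forall_compl_eq_zero fun z hz => hg z fun h => hz ?_).symm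
  exact ⟨trivial, h⟩

theorem memLp_slice {g : P.Conf → ℂ} (hg : MemLp g 2 P.confMeasure) (d : P.Spins × Occ) :
    MemLp (fun x : P.Pos => g (x, d)) 2 := by
  have h1 := hg.restrict (Set.univ ×ˢ {d})
  rw [← map_slice] at h1
  exact (P.measurableEmbedding_slice d).memLp_map_measure_iff.1 h1

end Slices

end Params

end CavityQED

namespace CavityQED

namespace Params

open scoped ComplexConjugate

variable (P : Params)

/-! ### The product basis of plane waves and photon number states. -/

section ProductWaves

/-- The product of plane waves. -/
noncomputable def prodWave (q : Fin P.N → Orbital) (x : P.Pos) (s : P.Spins) : ℂ :=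
  ∏ j, P.planeWave (q j) (x j) (s j)

/-- The spins of a list of orbitals. -/
def spinOf (q : Fin P.N → Orbital) : P.Spins := fun j => (q j).2

/-- The integer wave vectors of a list of orbitals. -/
def modeOf (q : Fin P.N → Orbital) : Fin P.N → Fin 2 → ℤ := fun j => (q j).1

theorem prodWave_eq (q : Fin P.N → Orbital) (x : P.Pos) (s : P.Spins) : P.prodWave q x s =
    if s = P.spinOf q then P.mode (P.modeOf q) x / (P.L : ℂ) ^ P.N else 0 := by
  split_ifs with h
  · subst h
    simp only [prodWave, planeWave, spinOf, if_true, Finset.prod_div_distrib, mode_apply, modeOf,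
      Real.sqrt_sq P.L_pos.le, Finset.prod_const, Finset.card_univ, Fintype.card_fin]
  · obtain ⟨j, hj⟩ := Function.ne_iff.1 h
    exact Finset.prod_eq_zero (Finset.mem_univ j) (if_neg hj)

theorem contDiff_fourier (n : ℤ) : ContDiff ℝ ∞ fun y : ℝ => fourier n (y : AddCircle P.L) := by
  simp only [fourier_coe_apply]
  have : ContDiff ℝ ∞ fun y : ℝ => (y : ℂ) := Complex.ofRealCLM.contDiff
  fun_prop

theorem contDiff_prodWave (q : Fin P.N → Orbital) (s : P.Spins) :
    ContDiff ℝ ∞ fun y => P.prodWave q (P.toPos y) s := by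
  simp only [prodWave_eq]
  split_ifs
  · refine ContDiff.div_const ?_ _
    change ContDiff ℝ ∞ fun y : Fin P.N → Fin 2 → ℝ =>
      ∏ j, ∏ i, fourier (P.modeOf q j i) ((y j i : ℝ) : AddCircle P.L)
    refine contDiff_prod fun j _ => contDiff_prod fun i _ => ?_
    exact (P.contDiff_fourier _).comp (by fun_prop)
  · exact contDiff_const

theorem isNice_tensor {Φ : P.Pos → P.Spins → ℂ} (hΦ : ∀ s, ContDiff ℝ ∞ fun y => Φ (P.toPos y) s)
    {χ : Occ → ℂ} (hχ : {n | χ n ≠ 0}.Finite) : P.IsNice (P.tensor Φ χ) := by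
  refine ⟨fun s n => (hΦ s).mul contDiff_const, hχ.subset ?_⟩
  rintro n ⟨x, s, h⟩
  exact right_ne_zero_of_mul h

theorem finite_single (ν : Occ) : {n | (Pi.single ν (1 : ℂ) : Occ → ℂ) n ≠ 0}.Finite := by
  refine (Set.finite_singleton ν).subset fun n hn => ?_
  by_contra h
  exact hn (Pi.single_eq_of_ne h _)

theorem integral_conj_prodWave_mul (q q' : Fin P.N → Orbital) :
    ∫ x : P.Pos, conj (P.prodWave q x (P.spinOf q)) * P.prodWave q' x (P.spinOf q) =
      if q = q' then 1 else 0 := by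
  have hL : (P.L : ℂ) ≠ 0 := by exact_mod_cast P.L_pos.ne'
  by_cases hs : P.spinOf q = P.spinOf q'
  · have h1 : ∀ x, conj (P.prodWave q x (P.spinOf q)) * P.prodWave q' x (P.spinOf q) =
        (((P.L : ℂ) ^ 2) ^ P.N)⁻¹ * (conj (P.mode (P.modeOf q) x) * P.mode (P.modeOf q') x) :=
      fun x => by
        rw [prodWave_eq, prodWave_eq, if_pos rfl, if_pos hs, map_div₀, map_pow,
          Complex.conj_ofReal]
        field_simp
        ring
    simp only [h1]
    rw [integral_const_mul, integral_conj_mode_mul]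
    have h2 : P.modeOf q = P.modeOf q' ↔ q = q' := by
      refine ⟨fun h => funext fun j => Prod.ext (congrFun h j) (congrFun hs j), fun h => h ▸ rfl⟩
    simp only [h2]
    split_ifs
    · exact inv_mul_cancel₀ (by positivity)
    · simp
  · rw [if_neg (fun h => hs (congrArg P.spinOf h))]
    simp [P.prodWave_eq q', hs]

/-- The coefficient of a wave function with respect to a product of plane waves, as a photon
amplitude. -/
noncomputable def waveCoef (q : Fin P.N → Orbital) (Ψ : P.Wave) (ν : Occ) : ℂ :=
  ∫ x : P.Pos, conj (P.prodWave q x (P.spinOf q)) * Ψ x (P.spinOf q) ν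

theorem waveCoef_tensor_prodWave (q q' : Fin P.N → Orbital) (χ : Occ → ℂ) (ν : Occ) :
    P.waveCoef q (P.tensor (P.prodWave q') χ) ν = if q = q' then χ ν else 0 := by
  simp only [waveCoef, tensor, ← mul_assoc]
  rw [integral_mul_const, integral_conj_prodWave_mul]
  split_ifs <;> simp

theorem norm_le_of_contDiff {Φ : P.Pos → P.Spins → ℂ}
    (hΦ : ∀ s, ContDiff ℝ ∞ fun y => Φ (P.toPos y) s) : ∃ C, ∀ x s, ‖Φ x s‖ ≤ C := by
  have h1 := P.isNice_tensor hΦ (finite_single 0)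
  have hc : ∀ s, Continuous fun x => Φ x s := fun s => by
    simpa [tensor] using h1.continuous s 0
  have hb : ∀ s, ∃ C, ∀ x, ‖Φ x s‖ ≤ C := fun s => by
    obtain ⟨C, hC⟩ := isCompact_univ.exists_bound_of_continuousOn (hc s).continuousOn
    exact ⟨C, fun x => hC x trivial⟩
  choose C hC using hb
  refine ⟨∑ s, |C s|, fun x s => (hC s x).trans ((le_abs_self _).trans ?_)⟩
  exact Finset.single_le_sum (f := fun s => |C s|) (fun _ _ => abs_nonneg _) (Finset.mem_univ s)

theorem memLp_tensor {Φ : P.Pos → P.Spins → ℂ} (hΦ : ∀ s, ContDiff ℝ ∞ fun y => Φ (P.toPos y) s)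
    {χ : Occ → ℂ} (hχ : Summable fun n => ‖χ n‖ ^ 2) :
    MemLp (P.onConf (P.tensor Φ χ)) 2 P.confMeasure := by
  have hm : Measurable (P.onConf (P.tensor Φ χ)) := by
    refine measurable_from_prod_countable_left fun d => ?_
    have h1 := P.isNice_tensor hΦ (finite_single 0)
    have h2 : Continuous fun x => Φ x d.1 := by
      simpa [tensor] using h1.continuous d.1 0
    have h3 : Continuous fun x => Φ x d.1 * χ d.2 := h2.mul continuous_const
    exact h3.measurable
  obtain ⟨C, hC⟩ := P.norm_le_of_contDiff hΦ
  rw [memLp_two_iff_integrable_sq_norm hm.aestronglyMeasurable]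
  have h1 : Summable fun d : P.Spins × Occ => (1 : ℝ) * ‖χ d.2‖ ^ 2 :=
    Summable.mul_of_nonneg (f := fun _ : P.Spins => (1 : ℝ)) (hasSum_fintype _).summable hχ
      (fun _ => zero_le_one) (fun _ => by positivity)
  have h2 : Integrable (fun d : P.Spins × Occ => (1 : ℝ) * ‖χ d.2‖ ^ 2) Measure.count :=
    integrable_count_iff.2 h1.norm
  have h3 : Integrable (fun z : P.Conf => C ^ 2 * ((1 : ℝ) * ‖χ z.2.2‖ ^ 2)) P.confMeasure :=
    (integrable_const (C ^ 2)).mul_prod h2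
  refine h3.mono' (hm.norm.pow_const 2).aestronglyMeasurable (Filter.Eventually.of_forall ?_)
  rintro ⟨x, s, n⟩
  have := hC x s
  rw [Real.norm_of_nonneg (by positivity), one_mul, ← mul_pow]
  simp only [onConf, tensor, norm_mul]
  gcongr

/-- The product of plane waves and a square-summable photon state as an element of `L²`. -/
noncomputable def prodVec (q : Fin P.N → Orbital) {χ : Occ → ℂ}
    (hχ : Summable fun n => ‖χ n‖ ^ 2) : Lp ℂ 2 P.confMeasure :=
  (P.memLp_tensor (P.contDiff_prodWave q) hχ).toLp _

theorem coeFn_prodVec (q : Fin P.N → Orbital) {χ : Occ → ℂ} (hχ : Summable fun n => ‖χ n‖ ^ 2) :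
    P.prodVec q hχ =ᵐ[P.confMeasure] P.onConf (P.tensor (P.prodWave q) χ) :=
  MemLp.coeFn_toLp _

theorem summable_single (ν : Occ) : Summable fun n => ‖(Pi.single ν (1 : ℂ) : Occ → ℂ) n‖ ^ 2 := by
  refine summable_of_ne_finset_zero (s := {ν}) fun n hn => ?_
  rw [Pi.single_eq_of_ne (by simpa using hn)]
  simp

/-- The product of plane waves with a photon number state. -/
noncomputable def basisVec (z : (Fin P.N → Orbital) × Occ) : Lp ℂ 2 P.confMeasure :=
  P.prodVec z.1 (summable_single z.2)

/-- A basis vector is supported on the slice with the spins of `z.1` and photon numbers `z.2`, so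
the inner product is a single Fourier coefficient there. -/
theorem inner_basisVec (z : (Fin P.N → Orbital) × Occ) {f : Lp ℂ 2 P.confMeasure} {Ψ : P.Wave}
    (h : f =ᵐ[P.confMeasure] P.onConf Ψ) : inner ℂ (P.basisVec z) f = P.waveCoef z.1 Ψ z.2 := by
  have h1 : inner ℂ (P.basisVec z) f =
      ∫ w, conj (P.onConf (P.tensor (P.prodWave z.1) (Pi.single z.2 1)) w) * P.onConf Ψ w
        ∂P.confMeasure := by
    rw [L2.inner_def]
    refine integral_congr_ae ?_
    filter_upwards [P.coeFn_prodVec z.1 (summable_single z.2), h] with w h1 h2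
    rw [RCLike.inner_apply, basisVec, h1, h2, mul_comm]
  rw [h1, P.integral_slice (P.spinOf z.1, z.2)]
  · simp [onConf, tensor, waveCoef]
  · rintro ⟨x, s, n⟩ hn
    have : P.tensor (P.prodWave z.1) (Pi.single z.2 1) x s n = 0 := by
      rw [tensor, prodWave_eq]
      by_cases hs : s = P.spinOf z.1
      · have : n ≠ z.2 := fun h => hn (by rw [hs, h])
        simp [this]
      · simp [hs]
    simp [onConf, this]

theorem inner_basisVec_prodVec (z : (Fin P.N → Orbital) × Occ) (q : Fin P.N → Orbital)
    {χ : Occ → ℂ} (hχ : Summable fun n => ‖χ n‖ ^ 2) :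
    inner ℂ (P.basisVec z) (P.prodVec q hχ) = if z.1 = q then χ z.2 else 0 := by
  rw [P.inner_basisVec z (P.coeFn_prodVec q hχ), waveCoef_tensor_prodWave]

theorem orthonormal_basisVec : Orthonormal ℂ P.basisVec := by
  classical
  rw [orthonormal_iff_ite]
  rintro ⟨q, ν⟩ ⟨q', ν'⟩
  change inner ℂ _ (P.prodVec q' (summable_single ν')) = _
  rw [inner_basisVec_prodVec]
  by_cases h : q = q' <;> by_cases h' : ν = ν' <;> simp [h, h']

theorem eq_zero_of_inner_basisVec {f : Lp ℂ 2 P.confMeasure}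
    (h : ∀ z, inner ℂ (P.basisVec z) f = 0) : f = 0 := by
  rw [Lp.eq_zero_iff_ae_eq_zero]
  refine P.ae_of_slices fun ⟨s, n⟩ => ?_
  refine P.ae_eq_zero_of_integral_mode (P.memLp_slice (Lp.memLp f) (s, n)) fun p => ?_
  have hL : (P.L : ℂ) ≠ 0 := by exact_mod_cast P.L_pos.ne'
  have h1 := h (fun j => (p j, s j), n)
  rw [P.inner_basisVec (Ψ := fun x s n => f (x, s, n)) _ (Filter.EventuallyEq.refl _ _)] at h1
  have h2 : ∀ x, conj (P.mode p x) * f (x, s, n) = (P.L : ℂ) ^ P.N *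
      (conj (P.prodWave (fun j => (p j, s j)) x (P.spinOf fun j => (p j, s j))) *
        f (x, s, n)) := fun x => by
    rw [prodWave_eq, if_pos rfl, map_div₀, map_pow, Complex.conj_ofReal]
    change _ = _ * (conj (P.mode p x) / _ * _)
    field_simp
  simp only [h2]
  rw [integral_const_mul]
  refine mul_eq_zero_of_right _ h1

/-- The Hilbert basis of all products of plane waves and photon number states. -/
noncomputable def prodBasis :
    HilbertBasis ((Fin P.N → Orbital) × Occ) ℂ (Lp ℂ 2 P.confMeasure) :=
  HilbertBasis.mkOfOrthogonalEqBot P.orthonormal_basisVec (by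
    rw [Submodule.eq_bot_iff]
    intro f hf
    exact P.eq_zero_of_inner_basisVec fun z =>
      (Submodule.mem_orthogonal _ _).1 hf _ (Submodule.subset_span ⟨z, rfl⟩))

theorem coe_prodBasis : ⇑P.prodBasis = P.basisVec := HilbertBasis.coe_mkOfOrthogonalEqBot _ _

/-- The photon amplitudes of `f` along a product of plane waves. -/
noncomputable def coef (f : Lp ℂ 2 P.confMeasure) (q : Fin P.N → Orbital) (ν : Occ) : ℂ :=
  inner ℂ (P.basisVec (q, ν)) f

theorem coef_eq {f : Lp ℂ 2 P.confMeasure} {Ψ : P.Wave} (h : f =ᵐ[P.confMeasure] P.onConf Ψ)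
    (q : Fin P.N → Orbital) : P.coef f q = P.waveCoef q Ψ :=
  funext fun ν => P.inner_basisVec (q, ν) h

theorem summable_coef (f : Lp ℂ 2 P.confMeasure) (q : Fin P.N → Orbital) :
    Summable fun ν => ‖P.coef f q ν‖ ^ 2 := by
  have h1 := (lp.memℓp (P.prodBasis.repr f)).summable (by norm_num)
  have h2 := h1.comp_injective (i := fun ν : Occ => (q, ν)) fun a b h => (Prod.ext_iff.1 h).2
  simpa [Function.comp_def, P.prodBasis.repr_apply_apply, coe_prodBasis, coef] using h2

/-- By Parseval in the product basis, only the basis vectors with electron part `q` contribute. -/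
theorem inner_prodVec (q : Fin P.N → Orbital) {χ : Occ → ℂ} (hχ : Summable fun n => ‖χ n‖ ^ 2)
    (f : Lp ℂ 2 P.confMeasure) : inner ℂ (P.prodVec q hχ) f = pair χ (P.coef f q) := by
  rw [← P.prodBasis.tsum_inner_mul_inner, coe_prodBasis, pair]
  have h1 : ∀ z, inner ℂ (P.prodVec q hχ) (P.basisVec z) =
      if z.1 = q then conj (χ z.2) else 0 := fun z => by
    rw [← inner_conj_symm, inner_basisVec_prodVec]
    split_ifs <;> simp
  simp only [h1]
  have hi : Function.Injective fun ν : Occ => (q, ν) := fun a b h => (Prod.ext_iff.1 h).2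
  rw [← hi.tsum_eq]
  · exact tsum_congr fun ν => by simp [coef]
  · rintro ⟨q', ν⟩ hz
    by_cases h : q' = q
    · exact ⟨ν, by rw [h]⟩
    · simp [h] at hz

end ProductWaves

/-! ### Slater determinants and antisymmetric coefficients. -/

section Slater

theorem slater_eq_sum (q : Fin P.N → Orbital) (x : P.Pos) (s : P.Spins) :
    P.slater q x s = ∑ π : Equiv.Perm (Fin P.N), (1 / (Real.sqrt (P.N.factorial) : ℂ)) *
      ((Equiv.Perm.sign π : ℤ) : ℂ) * P.prodWave (q ∘ π) x s := by
  rw [slater, Matrix.det_apply', Finset.mul_sum]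
  refine Finset.sum_congr rfl fun π _ => ?_
  rw [mul_assoc]
  rfl

theorem contDiff_slater (q : Fin P.N → Orbital) (s : P.Spins) :
    ContDiff ℝ ∞ fun y => P.slater q (P.toPos y) s := by
  simp only [slater_eq_sum]
  exact ContDiff.sum fun π _ => contDiff_const.mul (P.contDiff_prodWave _ s)

theorem slater_perm (q : Fin P.N → Orbital) (π : Equiv.Perm (Fin P.N)) (x : P.Pos)
    (s : P.Spins) : P.slater q (fun j => x (π j)) (fun j => s (π j)) =
      ((Equiv.Perm.sign π : ℤ) : ℂ) * P.slater q x s := by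
  rw [slater, slater, mul_left_comm, ← Matrix.det_permute']
  rfl

theorem isAntisymm_tensor_slater (q : Fin P.N → Orbital) (χ : Occ → ℂ) :
    P.IsAntisymm (P.tensor (P.slater q) χ) := fun π x s n => by
  rw [tensor, tensor, slater_perm, mul_assoc]

/-- The product of a Slater determinant and a square-summable photon state. -/
noncomputable def slaterVec (q : Fin P.N → Orbital) {χ : Occ → ℂ}
    (hχ : Summable fun n => ‖χ n‖ ^ 2) : P.hilbert :=
  ⟨(P.memLp_tensor (P.contDiff_slater q) hχ).toLp _, fun π => by
    have h0 := (P.memLp_tensor (P.contDiff_slater q) hχ).coeFn_toLp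
    filter_upwards [h0, (P.measurePreserving_permConf π).quasiMeasurePreserving.ae h0] with z h1 h2
    rw [h1, h2]
    exact P.isAntisymm_tensor_slater q χ π z.1 z.2.1 z.2.2⟩

theorem represents_slaterVec (q : Fin P.N → Orbital) {χ : Occ → ℂ}
    (hχ : Summable fun n => ‖χ n‖ ^ 2) :
    P.Represents (P.slaterVec q hχ) (P.tensor (P.slater q) χ) :=
  (P.memLp_tensor (P.contDiff_slater q) hχ).coeFn_toLp

theorem Represents.unique {P : Params} {f g : P.hilbert} {Ψ : P.Wave} (hf : P.Represents f Ψ)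
    (hg : P.Represents g Ψ) : f = g :=
  Subtype.ext (Lp.ext (hf.trans hg.symm))

theorem coe_slaterVec (q : Fin P.N → Orbital) {χ : Occ → ℂ} (hχ : Summable fun n => ‖χ n‖ ^ 2) :
    (P.slaterVec q hχ : Lp ℂ 2 P.confMeasure) = ∑ π : Equiv.Perm (Fin P.N),
      ((1 / (Real.sqrt (P.N.factorial) : ℂ)) * ((Equiv.Perm.sign π : ℤ) : ℂ)) •
        P.prodVec (q ∘ π) hχ := by
  refine P.prodBasis.eq_of_inner_eq fun z => ?_
  rw [coe_prodBasis, P.inner_basisVec z (P.represents_slaterVec q hχ), inner_sum]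
  simp only [inner_smul_right, P.inner_basisVec z (P.coeFn_prodVec _ hχ), waveCoef]
  simp only [← integral_const_mul]
  rw [← integral_finsetSum]
  · refine integral_congr_ae (Filter.Eventually.of_forall fun x => ?_)
    simp only [tensor, slater_eq_sum, Finset.sum_mul, Finset.mul_sum]
    exact Finset.sum_congr rfl fun π _ => by ring
  · intro π _
    have hc : ∀ q s, Continuous fun x => P.prodWave q x s := fun q s => by
      simp only [prodWave_eq]
      split_ifs <;> fun_prop
    refine Continuous.integrable_of_hasCompactSupport ?_ (HasCompactSupport.of_compactSpace _)
    have h1 := hc z.1 (P.spinOf z.1)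
    have h2 := hc (q ∘ π) (P.spinOf z.1)
    simp only [tensor]
    fun_prop

theorem integral_perm (π : Equiv.Perm (Fin P.N)) (g : P.Pos → ℂ) :
    ∫ x : P.Pos, g (fun j => x (π j)) = ∫ x, g x := by
  have h := (volume_measurePreserving_piCongrLeft
    (fun _ : Fin P.N => Fin 2 → AddCircle P.L) π.symm).integral_comp' g
  rw [← h]
  refine integral_congr_ae (Filter.Eventually.of_forall fun x => congrArg g ?_)
  funext j
  conv_rhs => rw [← π.symm_apply_apply j, MeasurableEquiv.coe_piCongrLeft,
    Equiv.piCongrLeft_apply_apply]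

/-- Permuting the integration variables undoes the permutation in the product of plane waves and
moves it onto `f`, where antisymmetry yields the sign. -/
theorem coef_perm (f : P.hilbert) (π : Equiv.Perm (Fin P.N)) (q : Fin P.N → Orbital) (ν : Occ) :
    P.coef f (q ∘ π) ν = ((Equiv.Perm.sign π : ℤ) : ℂ) * P.coef f q ν := by
  have e := fun q => P.coef_eq (f := f) (Ψ := fun x s n => (f : Lp ℂ 2 P.confMeasure) (x, s, n))
    (Filter.EventuallyEq.refl _ _) q
  rw [e, e, waveCoef, waveCoef, ← P.integral_perm π, ← integral_const_mul]
  refine integral_congr_ae ?_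
  filter_upwards [P.ae_slice (f.2 π) (P.spinOf q, ν)] with x hx
  have h1 : P.prodWave (q ∘ π) (fun j => x (π j)) (P.spinOf (q ∘ π)) =
      P.prodWave q x (P.spinOf q) :=
    Equiv.prod_comp π fun j => P.planeWave (q j) (x j) (P.spinOf q j)
  rw [h1, mul_left_comm]
  exact congrArg _ hx

/-- Pauli's principle: swapping two equal orbitals fixes `q` but reverses the sign of the
coefficient. -/
theorem coef_eq_zero_of_not_injective (f : P.hilbert) {q : Fin P.N → Orbital}
    (hq : ¬ Function.Injective q) (ν : Occ) : P.coef f q ν = 0 := by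
  rw [Function.Injective] at hq
  push Not at hq
  obtain ⟨a, b, hab, hne⟩ := hq
  have h1 := P.coef_perm f (Equiv.swap a b) q ν
  have h2 : q ∘ Equiv.swap a b = q := by
    funext j
    by_cases ha : j = a
    · subst ha; simp [hab]
    · by_cases hb : j = b
      · subst hb; simp [hab]
      · simp [Equiv.swap_apply_of_ne_of_ne ha hb]
  rw [h2, Equiv.Perm.sign_swap hne] at h1
  simpa [self_eq_neg] using h1

/-- The sign in the determinant cancels the sign from `coef_perm`, so the `N!` terms are equal;
against the normalization `1/√N!` this leaves `√N!`. Questions about `f` thus reduce to its photon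
amplitudes along one ordering. -/
theorem inner_slaterVec (q : Fin P.N → Orbital) {χ : Occ → ℂ} (hχ : Summable fun n => ‖χ n‖ ^ 2)
    (f : P.hilbert) : inner ℂ (P.slaterVec q hχ) f =
      (Real.sqrt (P.N.factorial) : ℂ) * pair χ (P.coef f q) := by
  rw [Submodule.coe_inner, coe_slaterVec, sum_inner]
  have h1 : ∀ π : Equiv.Perm (Fin P.N), P.coef f (q ∘ π) =
      ((Equiv.Perm.sign π : ℤ) : ℂ) • P.coef f q := fun π => funext (P.coef_perm f π q)
  have hp : (0 : ℝ) < Real.sqrt (P.N.factorial) := Real.sqrt_pos.2 (by positivity)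
  have h2 : (Real.sqrt (P.N.factorial) : ℂ) ≠ 0 := by exact_mod_cast hp.ne'
  have h3 : (P.N.factorial : ℂ) =
      (Real.sqrt (P.N.factorial) : ℂ) * (Real.sqrt (P.N.factorial) : ℂ) := by
    rw [← Complex.ofReal_mul, Real.mul_self_sqrt (by positivity)]; simp
  have h4 : ∀ π : Equiv.Perm (Fin P.N), ((Equiv.Perm.sign π : ℤ) : ℂ) *
      ((Equiv.Perm.sign π : ℤ) : ℂ) = 1 := fun π => by
    rw [← Int.cast_mul, ← Units.val_mul, Int.units_mul_self]; simp
  have h5 : ∀ π : Equiv.Perm (Fin P.N), inner ℂ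
      (((1 / (Real.sqrt (P.N.factorial) : ℂ)) * ((Equiv.Perm.sign π : ℤ) : ℂ)) •
        P.prodVec (q ∘ π) hχ) (f : Lp ℂ 2 P.confMeasure) =
      (1 / (Real.sqrt (P.N.factorial) : ℂ)) * pair χ (P.coef f q) := fun π => by
    rw [inner_smul_left, inner_prodVec, h1, pair_smul_right, map_mul, map_div₀, map_one,
      Complex.conj_ofReal, map_intCast]
    linear_combination (1 / (Real.sqrt (P.N.factorial) : ℂ)) * pair χ (P.coef f q) * h4 π
  simp only [h5, Finset.sum_const, Finset.card_univ, Fintype.card_perm, Fintype.card_fin,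
    nsmul_eq_mul]
  rw [h3]
  field_simp

theorem coef_slaterVec (q q' : Fin P.N → Orbital) {χ : Occ → ℂ}
    (hχ : Summable fun n => ‖χ n‖ ^ 2) : P.coef (P.slaterVec q' hχ) q =
      ((1 / (Real.sqrt (P.N.factorial) : ℂ)) * ∑ π : Equiv.Perm (Fin P.N),
        if q = q' ∘ π then ((Equiv.Perm.sign π : ℤ) : ℂ) else 0) • χ := by
  funext ν
  rw [coef, coe_slaterVec, inner_sum, Pi.smul_apply, Finset.mul_sum, smul_eq_mul, Finset.sum_mul]
  refine Finset.sum_congr rfl fun π _ => ?_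
  rw [inner_smul_right, inner_basisVec_prodVec]
  split_ifs <;> simp

theorem inner_slaterVec_slaterVec (q q' : Fin P.N → Orbital) {χ χ' : Occ → ℂ}
    (hχ : Summable fun n => ‖χ n‖ ^ 2) (hχ' : Summable fun n => ‖χ' n‖ ^ 2) :
    inner ℂ (P.slaterVec q hχ) (P.slaterVec q' hχ') = (∑ π : Equiv.Perm (Fin P.N),
        if q = q' ∘ π then ((Equiv.Perm.sign π : ℤ) : ℂ) else 0) * pair χ χ' := by
  have hp : (0 : ℝ) < Real.sqrt (P.N.factorial) := Real.sqrt_pos.2 (by positivity)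
  have h2 : (Real.sqrt (P.N.factorial) : ℂ) ≠ 0 := by exact_mod_cast hp.ne'
  rw [inner_slaterVec, coef_slaterVec, pair_smul_right]
  field_simp

theorem inner_slaterVec_self {q : Fin P.N → Orbital} (hq : Function.Injective q) {χ χ' : Occ → ℂ}
    (hχ : Summable fun n => ‖χ n‖ ^ 2) (hχ' : Summable fun n => ‖χ' n‖ ^ 2) :
    inner ℂ (P.slaterVec q hχ) (P.slaterVec q hχ') = pair χ χ' := by
  rw [inner_slaterVec_slaterVec, Finset.sum_eq_single 1]
  · simp
  · intro π _ hπ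
    refine if_neg fun h => hπ (Equiv.ext fun j => ?_)
    exact (hq (congrFun h j)).symm
  · simp

theorem inner_slaterVec_of_range_ne {q q' : Fin P.N → Orbital} (h : Set.range q ≠ Set.range q')
    {χ χ' : Occ → ℂ} (hχ : Summable fun n => ‖χ n‖ ^ 2) (hχ' : Summable fun n => ‖χ' n‖ ^ 2) :
    inner ℂ (P.slaterVec q hχ) (P.slaterVec q' hχ') = 0 := by
  rw [inner_slaterVec_slaterVec, Finset.sum_eq_zero, zero_mul]
  intro π _
  refine if_neg fun hc => h ?_
  rw [hc, Set.range_comp, π.surjective.range_eq, Set.image_univ]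

theorem norm_slaterVec_sq {q : Fin P.N → Orbital} (hq : Function.Injective q) {χ : Occ → ℂ}
    (hχ : Summable fun n => ‖χ n‖ ^ 2) : ‖P.slaterVec q hχ‖ ^ 2 = ∑' n, ‖χ n‖ ^ 2 := by
  have h1 := P.inner_slaterVec_self hq hχ hχ
  have h2 : (‖P.slaterVec q hχ‖ : ℂ) ^ 2 = ((∑' n, ‖χ n‖ ^ 2 : ℝ) : ℂ) :=
    (inner_self_eq_norm_sq_to_K (𝕜 := ℂ) (P.slaterVec q hχ)).symm.trans
    (h1.trans (pair_self_eq χ))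
  exact_mod_cast h2

/-- An injective list is a permutation of the chosen list with the same range, so its coefficient
agrees up to sign; all other lists have zero coefficient. One ordering per set of orbitals therefore
suffices. -/
theorem eq_zero_of_coef (f : P.hilbert)
    (h : ∀ Q : Finset Orbital, Q.card = P.N → ∃ q : Fin P.N → Orbital,
      Function.Injective q ∧ Set.range q = (Q : Set Orbital) ∧ P.coef f q = 0) : f = 0 := by
  classical
  refine Subtype.ext (P.eq_zero_of_inner_basisVec ?_)
  rintro ⟨q, ν⟩
  change P.coef f q ν = 0
  by_cases hq : Function.Injective q
  · obtain ⟨q', hq', hr, h0⟩ := h (Finset.univ.image q) (by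
      rw [Finset.card_image_of_injective _ hq, Finset.card_univ, Fintype.card_fin])
    have hr' : Set.range q = Set.range q' := by simp [hr]
    let π : Equiv.Perm (Fin P.N) := (Equiv.ofInjective q hq).trans
      ((Equiv.setCongr hr').trans (Equiv.ofInjective q' hq').symm)
    have hπ : q = q' ∘ π := by
      funext j
      have h1 := Equiv.apply_ofInjective_symm hq' (Equiv.setCongr hr' (Equiv.ofInjective q hq j))
      exact h1.symm
    rw [hπ, coef_perm, h0, Pi.zero_apply, mul_zero]
  · exact P.coef_eq_zero_of_not_injective f hq ν

end Slater

end Params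

end CavityQED

namespace CavityQED

namespace Params

open scoped ComplexConjugate

variable (P : Params)

/-- The translation by `t` of the coordinate `i` of the electron `j`. -/
noncomputable def translation (j : Fin P.N) (i : Fin 2) (t : ℝ) : P.Pos :=
  Pi.single j (Pi.single i (t : AddCircle P.L))

theorem continuous_translation (j : Fin P.N) (i : Fin 2) : Continuous (P.translation j i) :=
  (continuous_single j).comp ((continuous_single i).comp (AddCircle.continuous_mk' P.L))

theorem translation_add (j : Fin P.N) (i : Fin 2) (t u : ℝ) :
    P.translation j i (t + u) = P.translation j i t + P.translation j i u := by
  rw [translation, translation, translation, ← Pi.single_add, ← Pi.single_add]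
  rfl

theorem translation_period (j : Fin P.N) (i : Fin 2) : P.translation j i P.L = 0 := by
  rw [translation, AddCircle.coe_period, Pi.single_zero, Pi.single_zero]

/-! ### The differential expression on Slater determinants. -/

section SlaterAction

theorem mode_add_translation (p : Fin P.N → Fin 2 → ℤ) (x : P.Pos) (j : Fin P.N) (i : Fin 2)
    (t : ℝ) : P.mode p (x + P.translation j i t) =
      P.mode p x * fourier (p j i) (t : AddCircle P.L) := by
  have h1 : ∀ a b, fourier (p a b) ((x + P.translation j i t) a b) =
      fourier (p a b) (x a b) * fourier (p a b) (P.translation j i t a b) := fun a b => by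
    rw [fourier_apply, fourier_apply, fourier_apply, Pi.add_apply, Pi.add_apply, smul_add,
      AddCircle.toCircle_add, Circle.coe_mul]
  simp only [mode_apply, h1, Finset.prod_mul_distrib]
  congr 1
  rw [Finset.prod_eq_single j, Finset.prod_eq_single i]
  · simp [translation]
  · intro b _ hb
    simp [translation, hb]
  · simp
  · intro a _ ha
    simp [translation, ha]
  · simp

theorem prodWave_add_translation (q : Fin P.N → Orbital) (x : P.Pos) (s : P.Spins) (j : Fin P.N)
    (i : Fin 2) (t : ℝ) : P.prodWave q (x + P.translation j i t) s =
      P.prodWave q x s * fourier ((q j).1 i) (t : AddCircle P.L) := by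
  rw [prodWave_eq, prodWave_eq]
  split_ifs
  · rw [mode_add_translation, mul_div_right_comm]; rfl
  · rw [zero_mul]

theorem hasDerivAt_prodWave (q : Fin P.N → Orbital) (x : P.Pos) (s : P.Spins) (j : Fin P.N)
    (i : Fin 2) : HasDerivAt (fun t : ℝ => P.prodWave q (x + P.translation j i t) s)
      (Complex.I * P.waveVec (q j) i * P.prodWave q x s) 0 := by
  simp only [prodWave_add_translation]
  refine ((hasDerivAt_fourier P.L ((q j).1 i) 0).const_mul (P.prodWave q x s)).congr_deriv ?_
  rw [waveVec]
  simp
  ring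

/-- Arbitrary coefficients `c` keep the class of sums closed under differentiation, so the second
derivatives follow by applying the lemma twice. A Slater determinant alone would not stay in its
class under the derivative in one electron. -/
theorem partialD_sum_tensor {α : Type*} [Fintype α] (c : α → ℂ) (q : α → Fin P.N → Orbital)
    (χ : Occ → ℂ) (j : Fin P.N) (i : Fin 2) :
    P.partialD j i (P.tensor (fun x s => ∑ a, c a * P.prodWave (q a) x s) χ) =
      P.tensor (fun x s => ∑ a, (c a * (Complex.I * P.waveVec (q a j) i)) *
        P.prodWave (q a) x s) χ := by
  funext x s n
  refine HasDerivAt.deriv ?_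
  simp only [tensor]
  refine HasDerivAt.mul_const ?_ _
  refine (HasDerivAt.fun_sum fun a _ =>
    (P.hasDerivAt_prodWave (q a) x s j i).const_mul (c a)).congr_deriv ?_
  exact Finset.sum_congr rfl fun a _ => by ring

theorem act_tensor (T : Module.End ℂ (Occ → ℂ)) (Φ : P.Pos → P.Spins → ℂ) (χ : Occ → ℂ) :
    P.act T (P.tensor Φ χ) = P.tensor Φ (T χ) := by
  funext x s n
  have : P.tensor Φ χ x s = Φ x s • χ := rfl
  rw [act, this, map_smul]
  rfl

theorem polK_eq (q : Fin P.N → Orbital) (l : Fin 2) : P.polK q l = P.totalWaveVec q l := by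
  simp [polK, pol, Pi.single_apply]

theorem g0_eq : P.g0 = P.charge * P.hbar / P.mass *
    (Real.sqrt (P.hbar / (P.eps0 * P.V)) / Real.sqrt (2 * P.dressedFreq)) := by
  have := P.V_pos
  have := P.hbar_pos
  have := P.eps0_pos
  rw [g0, ← div_div, Real.sqrt_div (by positivity)]

/-- `g₀` is `eħ/m` times the amplitude of the dressed vector potential, so the coupling to `b + b†`
is `A · K` up to that charge factor. -/
theorem projHam_eq_vecPot (q : Fin P.N → Orbital) : P.projHam q = P.photonHam
    - ((P.charge * P.hbar / P.mass : ℝ) : ℂ) •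
      ∑ i, (P.totalWaveVec q i : ℂ) • P.vecPot i + (P.kinetic q : ℂ) • 1 := by
  rw [projHam, photonHam_eq_dressed, Finset.sum_sub_distrib, Finset.smul_sum]
  congr 2
  refine Finset.sum_congr rfl fun l _ => ?_
  rw [vecPot_eq_dressed, g0_eq, polK_eq, smul_smul, smul_smul]
  push_cast
  congr 1
  ring

theorem sum_waveVec_sq (q : Fin P.N → Orbital) :
    ∑ j, ((-(P.hbar ^ 2 / (2 * P.mass)) : ℝ) : ℂ) *
      ∑ i, (Complex.I * P.waveVec (q j) i) * (Complex.I * P.waveVec (q j) i) =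
    (P.kinetic q : ℂ) := by
  have h1 : ∀ j i, (Complex.I * P.waveVec (q j) i) * (Complex.I * P.waveVec (q j) i) =
      -(P.waveVec (q j) i : ℂ) ^ 2 := fun j i => by
    rw [mul_mul_mul_comm, Complex.I_mul_I]; ring
  simp only [h1, kinetic]
  push_cast
  refine Finset.sum_congr rfl fun j _ => ?_
  rw [Finset.sum_neg_distrib]
  ring

theorem projHam_apply (q : Fin P.N → Orbital) (χ : Occ → ℂ) (n : Occ) :
    P.projHam q χ n =
    ∑ j, (((-(P.hbar ^ 2 / (2 * P.mass)) : ℝ) : ℂ) *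
        ∑ i, (Complex.I * P.waveVec (q j) i) * (Complex.I * P.waveVec (q j) i) * χ n
      + (Complex.I * ((P.charge * P.hbar / P.mass : ℝ) : ℂ)) *
          ∑ i, (Complex.I * P.waveVec (q j) i) * P.vecPot i χ n) + P.photonHam χ n := by
  have h1 : ∑ j, (Complex.I * ((P.charge * P.hbar / P.mass : ℝ) : ℂ)) *
          ∑ i, (Complex.I * P.waveVec (q j) i) * P.vecPot i χ n =
      -(((P.charge * P.hbar / P.mass : ℝ) : ℂ) *
        ∑ i, (P.totalWaveVec q i : ℂ) * P.vecPot i χ n) := by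
    rw [← Finset.mul_sum, Finset.sum_comm, mul_comm Complex.I, mul_assoc, ← mul_neg]
    congr 1
    rw [Finset.mul_sum, ← Finset.sum_neg_distrib]
    refine Finset.sum_congr rfl fun i _ => ?_
    rw [← Finset.sum_mul, ← Finset.mul_sum, totalWaveVec, ← mul_assoc, ← mul_assoc,
      Complex.I_mul_I]
    push_cast
    ring
  have h2 : ∑ j, ((-(P.hbar ^ 2 / (2 * P.mass)) : ℝ) : ℂ) *
      ∑ i, (Complex.I * P.waveVec (q j) i) * (Complex.I * P.waveVec (q j) i) * χ n =
      (P.kinetic q : ℂ) * χ n := by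
    rw [← sum_waveVec_sq, Finset.sum_mul]
    refine Finset.sum_congr rfl fun j _ => ?_
    rw [mul_assoc, Finset.sum_mul]
  rw [Finset.sum_add_distrib, h1, h2, projHam_eq_vecPot]
  simp only [LinearMap.add_apply, LinearMap.sub_apply, LinearMap.smul_apply, LinearMap.sum_apply,
    Module.End.one_apply, Pi.add_apply, Pi.sub_apply, Pi.smul_apply, Finset.sum_apply,
    smul_eq_mul]
  ring

/-- The orbitals enter only through sums over all electrons. Hence every term of a Slater
determinant sees the same photon operator, which can be factored out. -/
theorem projHam_comp_perm (q : Fin P.N → Orbital) (π : Equiv.Perm (Fin P.N)) :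
    P.projHam (q ∘ π) = P.projHam q := by
  have h1 : P.kinetic (q ∘ π) = P.kinetic q :=
    Equiv.sum_comp π fun j => P.hbar ^ 2 * (∑ i, P.waveVec (q j) i ^ 2) / (2 * P.mass)
  have h2 : P.totalWaveVec (q ∘ π) = P.totalWaveVec q :=
    funext fun i => Equiv.sum_comp π fun j => P.waveVec (q j) i
  rw [projHam_eq_vecPot, projHam_eq_vecPot, h1, h2]

theorem sum_sum_mul_comm {α β : Type*} [Fintype α] [Fintype β] (c W : α → ℂ) (k : α → β → ℂ)
    (y : β → ℂ) : ∑ i, (∑ a, c a * k a i * W a) * y i = ∑ a, c a * W a * ∑ i, k a i * y i := by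
  simp only [Finset.sum_mul, Finset.mul_sum]
  rw [Finset.sum_comm]
  exact Finset.sum_congr rfl fun a _ => Finset.sum_congr rfl fun i _ => by ring

theorem sum_sum_add_comm {α β : Type*} [Fintype α] [Fintype β] (d : α → ℂ) (y z : α → β → ℂ)
    (u v p : ℂ) : ∑ j, (u * ∑ a, d a * y a j + v * ∑ a, d a * z a j) + (∑ a, d a) * p =
      ∑ a, d a * (∑ j, (u * y a j + v * z a j) + p) := by
  simp only [Finset.mul_sum, mul_add, Finset.sum_add_distrib, Finset.sum_mul]
  rw [Finset.sum_comm, Finset.sum_comm (f := fun j a => v * (d a * z a j))]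
  simp only [mul_left_comm]

theorem ham_sum_tensor {α : Type*} [Fintype α] (c : α → ℂ) (q : α → Fin P.N → Orbital)
    (χ : Occ → ℂ) (x : P.Pos) (s : P.Spins) (n : Occ) :
    P.ham (P.tensor (fun x s => ∑ a, c a * P.prodWave (q a) x s) χ) x s n =
      ∑ a, c a * P.prodWave (q a) x s * P.projHam (q a) χ n := by
  simp only [ham, partialD_sum_tensor, act_tensor]
  simp only [Pi.add_apply, Finset.sum_apply, Pi.smul_apply, smul_eq_mul, tensor]
  simp only [mul_assoc (c _) (Complex.I * _) (Complex.I * _), sum_sum_mul_comm, projHam_apply]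
  rw [← sum_sum_add_comm]

theorem ham_tensor_slater (q : Fin P.N → Orbital) (χ : Occ → ℂ) :
    P.ham (P.tensor (P.slater q) χ) = P.tensor (P.slater q) (P.projHam q χ) := by
  funext x s n
  have hs : P.slater q = _ := funext fun x => funext fun s => P.slater_eq_sum q x s
  rw [hs, ham_sum_tensor]
  simp only [projHam_comp_perm, tensor, Finset.sum_mul]

end SlaterAction

/-! ### Integration by parts: Fourier coefficients of `H Ψ`. -/

section FourierCoefficients

variable {P}

theorem hasDerivAt_translation {Ψ : P.Wave} (h : P.IsNice Ψ) (j : Fin P.N) (i : Fin 2)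
    (x : P.Pos) (s : P.Spins) (n : Occ) (t : ℝ) :
    HasDerivAt (fun t : ℝ => Ψ (x + P.translation j i t) s n)
      (P.partialD j i Ψ (x + P.translation j i t) s n) t := by
  have h0 : HasDerivAt
      (fun u : ℝ => Ψ ((x + P.translation j i t) + P.translation j i u) s n)
      (P.partialD j i Ψ (x + P.translation j i t) s n) (t - t) := by
    obtain ⟨y, hy⟩ := toPos_surjective (x + P.translation j i t)
    rw [← hy, partialD_eq h, sub_self]
    exact partialD_toPos h j i y s n
  have h1 := h0.comp_sub_const t t
  refine h1.congr_of_eventuallyEq (Filter.Eventually.of_forall fun u => ?_)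
  dsimp only
  rw [add_assoc, ← translation_add, add_sub_cancel]

/-- Along any translation orbit the derivative integrates to zero over a full period. Averaging this
over the torus and exchanging the integrals, translation invariance gives `L` times the desired
integral. -/
theorem integral_partialD {Ψ : P.Wave} (h : P.IsNice Ψ) (j : Fin P.N) (i : Fin 2)
    (s : P.Spins) (n : Occ) : ∫ x, P.partialD j i Ψ x s n = 0 := by
  set g : P.Pos → ℂ := fun x => P.partialD j i Ψ x s n with hg
  have hgc : Continuous g := (h.partialD j i).continuous s n
  have h1 : ∀ x, ∫ t in (0 : ℝ)..P.L, g (x + P.translation j i t) = 0 := fun x => by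
    rw [intervalIntegral.integral_eq_sub_of_hasDerivAt
      (fun t _ => hasDerivAt_translation h j i x s n t)
      ((hgc.comp (continuous_const.add (P.continuous_translation j i))).intervalIntegrable _ _)]
    have h0 : P.translation j i 0 = 0 := by simp [translation]
    rw [translation_period, h0, sub_self]
  have h2 : ∫ x, ∫ t in (0 : ℝ)..P.L, g (x + P.translation j i t) = 0 := by simp [h1]
  simp only [intervalIntegral.integral_of_le P.L_pos.le] at h2
  obtain ⟨C, hC⟩ := isCompact_univ.exists_bound_of_continuousOn hgc.continuousOn
  have hi : Integrable (Function.uncurry fun (x : P.Pos) (t : ℝ) => g (x + P.translation j i t))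
      ((volume : Measure P.Pos).prod (volume.restrict (Set.Ioc 0 P.L))) := by
    refine Integrable.of_bound ?_ C (Filter.Eventually.of_forall fun z => hC _ trivial)
    exact (hgc.comp (continuous_fst.add
      ((P.continuous_translation j i).comp continuous_snd))).aestronglyMeasurable
  rw [integral_integral_swap hi] at h2
  have h3 : ∀ t, ∫ x, g (x + P.translation j i t) = ∫ x, g x := fun t =>
    (by simpa only [add_comm] using integral_add_left_eq_self g (P.translation j i t))
  simp only [h3] at h2
  rw [setIntegral_const] at h2
  have h4 : volume.real (Set.Ioc 0 P.L) = P.L := by simp [P.L_pos.le]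
  rw [h4] at h2
  exact (smul_eq_zero.1 h2).resolve_left P.L_pos.ne'

theorem contDiff_conj_prodWave (q : Fin P.N → Orbital) (s : P.Spins) :
    ContDiff ℝ ∞ fun y => conj (P.prodWave q (P.toPos y) s) :=
  Complex.conjCLE.contDiff.comp (P.contDiff_prodWave q s)

theorem IsNice.conj_prodWave_mul {Ψ : P.Wave} (h : P.IsNice Ψ) (q : Fin P.N → Orbital) :
    P.IsNice fun x s n => conj (P.prodWave q x s) * Ψ x s n := by
  refine ⟨fun s n => (contDiff_conj_prodWave q s).mul (h.1 s n), h.2.subset ?_⟩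
  rintro n ⟨x, s, hn⟩
  exact ⟨x, s, right_ne_zero_of_mul hn⟩

theorem IsNice.integrable {Ψ : P.Wave} (h : P.IsNice Ψ) (s : P.Spins) (n : Occ) :
    Integrable fun x => Ψ x s n :=
  (h.continuous s n).integrable_of_hasCompactSupport (HasCompactSupport.of_compactSpace _)

/-- Integration by parts: the product of `Ψ` with the conjugate plane wave has a derivative of
integral zero, and the plane wave contributes `-i k`. -/
theorem waveCoef_partialD {Ψ : P.Wave} (h : P.IsNice Ψ) (q : Fin P.N → Orbital) (j : Fin P.N)
    (i : Fin 2) : P.waveCoef q (P.partialD j i Ψ) =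
      (Complex.I * P.waveVec (q j) i) • P.waveCoef q Ψ := by
  funext ν
  have h1 := integral_partialD (h.conj_prodWave_mul q) j i (P.spinOf q) ν
  have h2 : ∀ x s n, P.partialD j i (fun x s n => conj (P.prodWave q x s) * Ψ x s n) x s n =
      conj (P.prodWave q x s) * P.partialD j i Ψ x s n -
        (Complex.I * P.waveVec (q j) i) * (conj (P.prodWave q x s) * Ψ x s n) := fun x s n => by
    have h3 := (P.hasDerivAt_prodWave q x s j i).star
    have h4 : HasDerivAt (fun t : ℝ => Ψ (x + P.translation j i t) s n)
        (P.partialD j i Ψ x s n) 0 := by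
      have := hasDerivAt_translation h j i x s n 0
      simpa [translation] using this
    refine (h3.mul h4).deriv.trans ?_
    have h5 : P.translation j i 0 = 0 := by simp [translation]
    simp [h5]
    ring
  simp only [h2] at h1
  rw [integral_sub (((h.partialD j i).conj_prodWave_mul q).integrable _ _)
    (((h.conj_prodWave_mul q).integrable _ _).const_mul _), integral_const_mul, sub_eq_zero] at h1
  exact h1

theorem waveCoef_add {Ψ Φ : P.Wave} (h : P.IsNice Ψ) (k : P.IsNice Φ) (q : Fin P.N → Orbital) :
    P.waveCoef q (Ψ + Φ) = P.waveCoef q Ψ + P.waveCoef q Φ := by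
  funext ν
  rw [Pi.add_apply, waveCoef, waveCoef, waveCoef,
    ← integral_add ((h.conj_prodWave_mul q).integrable _ _)
      ((k.conj_prodWave_mul q).integrable _ _)]
  exact integral_congr_ae (Filter.Eventually.of_forall fun x => mul_add _ _ _)

theorem waveCoef_smul (z : ℂ) (Ψ : P.Wave) (q : Fin P.N → Orbital) :
    P.waveCoef q (z • Ψ) = z • P.waveCoef q Ψ := by
  funext ν
  rw [Pi.smul_apply, waveCoef, waveCoef, smul_eq_mul, ← integral_const_mul]
  exact integral_congr_ae (Filter.Eventually.of_forall fun x => mul_left_comm _ _ _)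

theorem waveCoef_sum {α : Type*} (F : Finset α) {Ψ : α → P.Wave} (h : ∀ a, P.IsNice (Ψ a))
    (q : Fin P.N → Orbital) : P.waveCoef q (∑ a ∈ F, Ψ a) = ∑ a ∈ F, P.waveCoef q (Ψ a) := by
  classical
  induction F using Finset.induction_on with
  | empty => funext ν; simp [waveCoef]
  | insert a F ha ih =>
    rw [Finset.sum_insert ha, Finset.sum_insert ha, waveCoef_add (h a) (IsNice.sum F h), ih]

variable (P) in
/-- The photonic operators that preserve nice wave functions and commute with taking
coefficients. -/
def coefCommuting : Subalgebra ℂ (Module.End ℂ (Occ → ℂ)) where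
  carrier := {T | ∀ Ψ, P.IsNice Ψ → P.IsNice (P.act T Ψ) ∧
    ∀ q, P.waveCoef q (P.act T Ψ) = T (P.waveCoef q Ψ)}
  mul_mem' {S _} hS hT Ψ h := ⟨(hS _ (hT Ψ h).1).1, fun q =>
    ((hS _ (hT Ψ h).1).2 q).trans (congrArg S ((hT Ψ h).2 q))⟩
  add_mem' hS hT Ψ h := ⟨(hS Ψ h).1.add (hT Ψ h).1, fun q =>
    (waveCoef_add (hS Ψ h).1 (hT Ψ h).1 q).trans
      (congrArg₂ (· + ·) ((hS Ψ h).2 q) ((hT Ψ h).2 q))⟩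
  algebraMap_mem' z _ h := ⟨h.smul z, fun q => waveCoef_smul z _ q⟩

theorem onMode_ann_mem_coefCommuting (l : Fin 2) : onMode l ann ∈ P.coefCommuting :=
  fun Ψ h => ⟨onMode_ann_mem l Ψ h, fun q => funext fun ν => by
    rw [onMode_apply, ann_apply, waveCoef, waveCoef, ← integral_const_mul]
    exact integral_congr_ae (Filter.Eventually.of_forall fun x => mul_left_comm _ _ _)⟩

theorem onMode_cre_mem_coefCommuting (l : Fin 2) : onMode l cre ∈ P.coefCommuting :=
  fun Ψ h => ⟨onMode_cre_mem l Ψ h, fun q => funext fun ν => by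
    rw [onMode_apply, cre_apply, waveCoef, waveCoef, ← integral_const_mul]
    exact integral_congr_ae (Filter.Eventually.of_forall fun x => mul_left_comm _ _ _)⟩

theorem vecPot_mem_coefCommuting (i : Fin 2) : P.vecPot i ∈ P.coefCommuting :=
  Subalgebra.smul_mem _ (Subalgebra.sum_mem _ fun l _ => Subalgebra.smul_mem _
    (Subalgebra.add_mem _ (onMode_ann_mem_coefCommuting l) (onMode_cre_mem_coefCommuting l)) _) _

theorem photonHam_mem_coefCommuting : P.photonHam ∈ P.coefCommuting :=
  Subalgebra.add_mem _
    (Subalgebra.smul_mem _ (Subalgebra.sum_mem _ fun i _ =>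
      Subalgebra.mul_mem _ (vecPot_mem_coefCommuting i) (vecPot_mem_coefCommuting i)) _)
    (Subalgebra.sum_mem _ fun l _ => Subalgebra.smul_mem _ (Subalgebra.add_mem _
      (Subalgebra.mul_mem _ (onMode_cre_mem_coefCommuting l) (onMode_ann_mem_coefCommuting l))
      (Subalgebra.smul_mem _ (Subalgebra.one_mem _) _)) _)

/-- Derivatives become the numbers `i k`, and the photon operators commute with the position
integral, so `H` acts on each coefficient sequence as `projHam q`. -/
theorem waveCoef_ham {Ψ : P.Wave} (h : P.IsNice Ψ) (q : Fin P.N → Orbital) :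
    P.waveCoef q (P.ham Ψ) = P.projHam q (P.waveCoef q Ψ) := by
  have hd := fun j i => h.partialD j i
  have hdd := fun j i => (hd j i).partialD j i
  have hA := fun j i => vecPot_mem_coefCommuting i _ (hd j i)
  have hK := fun j => (IsNice.sum Finset.univ fun i => hdd j i).smul
    ((-(P.hbar ^ 2 / (2 * P.mass)) : ℝ) : ℂ)
  have hM := fun j => (IsNice.sum Finset.univ fun i => (hA j i).1).smul
    (Complex.I * ((P.charge * P.hbar / P.mass : ℝ) : ℂ))
  rw [ham, waveCoef_add (IsNice.sum _ fun j => (hK j).add (hM j)) (photonHam_mem_coefCommuting _ h).1,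
    waveCoef_sum _ fun j => (hK j).add (hM j)]
  simp only [fun j => waveCoef_add (hK j) (hM j) q, waveCoef_smul,
    fun j => waveCoef_sum Finset.univ (fun i => hdd j i) q,
    fun j => waveCoef_sum Finset.univ (fun i => (hA j i).1) q,
    fun j i => (hA j i).2 q, (photonHam_mem_coefCommuting _ h).2 q,
    fun j i => waveCoef_partialD (hd j i) q j i, fun j i => waveCoef_partialD h q j i]
  funext ν
  rw [projHam_apply]
  simp only [map_smul, Pi.add_apply, Finset.sum_apply, Pi.smul_apply, smul_eq_mul, mul_assoc]

theorem rapidDecay_waveCoef {Ψ : P.Wave} (h : P.IsNice Ψ) (q : Fin P.N → Orbital) :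
    RapidDecay (P.waveCoef q Ψ) := by
  refine RapidDecay.of_finite (h.2.subset fun n hn => ?_)
  by_contra hc
  simp only [Set.mem_ofPred_eq, not_exists, not_not] at hc
  exact hn (by simp [waveCoef, hc])

theorem coef_toHilbert (Ψ : P.core) (q : Fin P.N → Orbital) :
    P.coef (P.toHilbert Ψ) q = P.waveCoef q Ψ :=
  P.coef_eq Ψ.2.1.memLp.coeFn_toLp q

/-- The weak eigenvalue equation against the core. On the core the coefficient sequences are
finitely supported, so the formal adjointness of `projHam q` moves it onto `χ`. -/
theorem inner_slaterVec_hamCore {q : Fin P.N → Orbital} {χ : Occ → ℂ} (hχ : RapidDecay χ) {E : ℝ}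
    (hE : P.projHam q χ = (E : ℂ) • χ) (Ψ : P.core) :
    inner ℂ (P.slaterVec q hχ.summable_sq) (P.toHilbert (P.hamCore Ψ)) =
      E * inner ℂ (P.slaterVec q hχ.summable_sq) (P.toHilbert Ψ) := by
  rw [inner_slaterVec, inner_slaterVec, coef_toHilbert, coef_toHilbert]
  have h1 : P.waveCoef q (P.hamCore Ψ) = P.projHam q (P.waveCoef q Ψ) := waveCoef_ham Ψ.2.1 q
  rw [h1, (P.isAdj_projHam q).pair_eq _ _ hχ (rapidDecay_waveCoef Ψ.2.1 q), hE, pair_smul_left,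
    Complex.conj_ofReal, mul_left_comm]

end FourierCoefficients

end Params

end CavityQED

namespace CavityQED

namespace Params

variable (P : Params)

/-! ### Approximation of eigenstates by core elements in the graph norm. -/

section Approximation

theorem slaterVec_sub (q : Fin P.N → Orbital) {χ χ' : Occ → ℂ} (hχ : Summable fun n => ‖χ n‖ ^ 2)
    (hχ' : Summable fun n => ‖χ' n‖ ^ 2) (h : Summable fun n => ‖(χ - χ') n‖ ^ 2) :
    P.slaterVec q hχ - P.slaterVec q hχ' = P.slaterVec q h := by
  refine Represents.unique (Ψ := P.tensor (P.slater q) (χ - χ')) ?_ (P.represents_slaterVec q h)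
  have h0 := Lp.coeFn_sub (P.slaterVec q hχ : Lp ℂ 2 P.confMeasure) (P.slaterVec q hχ')
  filter_upwards [h0, P.represents_slaterVec q hχ, P.represents_slaterVec q hχ'] with z h1 h2 h3
  refine h1.trans ?_
  rw [Pi.sub_apply, h2, h3]
  simp [onConf, tensor, mul_sub]

theorem smul_slaterVec (q : Fin P.N → Orbital) {χ : Occ → ℂ} (hχ : Summable fun n => ‖χ n‖ ^ 2)
    (z : ℂ) (h : Summable fun n => ‖(z • χ) n‖ ^ 2) :
    z • P.slaterVec q hχ = P.slaterVec q h := by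
  refine Represents.unique (Ψ := P.tensor (P.slater q) (z • χ)) ?_ (P.represents_slaterVec q h)
  have h0 := Lp.coeFn_smul z (P.slaterVec q hχ : Lp ℂ 2 P.confMeasure)
  filter_upwards [h0, P.represents_slaterVec q hχ] with x h1 h2
  refine h1.trans ?_
  rw [Pi.smul_apply, h2]
  simp [onConf, tensor, mul_left_comm]

theorem tendsto_slaterVec {q : Fin P.N → Orbital} (hq : Function.Injective q) {χ : Occ → ℂ}
    (hχ : RapidDecay χ) {φ : ℕ → Occ → ℂ} (hφ : ∀ M, RapidDecay (φ M))
    (h : Filter.Tendsto (fun M => ∑' n, ‖(χ - φ M) n‖ ^ 2) Filter.atTop (nhds 0)) :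
    Filter.Tendsto (fun M => P.slaterVec q (hφ M).summable_sq) Filter.atTop
      (nhds (P.slaterVec q hχ.summable_sq)) := by
  have hs : ∀ M, RapidDecay (χ - φ M) := fun M => by
    rw [sub_eq_add_neg, ← neg_one_smul ℂ (φ M)]
    exact hχ.add ((hφ M).smul _)
  rw [tendsto_iff_norm_sub_tendsto_zero]
  have h1 := h.sqrt
  rw [Real.sqrt_zero] at h1
  refine h1.congr fun M => ?_
  rw [norm_sub_rev, P.slaterVec_sub q hχ.summable_sq (hφ M).summable_sq (hs M).summable_sq,
    ← P.norm_slaterVec_sq hq (hs M).summable_sq, Real.sqrt_sq (norm_nonneg _)]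

theorem finite_truncate (M : ℕ) (χ : Occ → ℂ) : {n | truncate M χ n ≠ 0}.Finite := by
  refine (Set.finite_Iic (fun _ : Fin 2 => M)).subset fun n hn => ?_
  have h1 : n 0 + n 1 ≤ M := by
    by_contra hc
    exact hn (if_neg hc)
  intro l
  fin_cases l <;> simp <;> omega

theorem mem_graph_hamMin (Ψ : P.core) :
    (P.toHilbert Ψ, P.toHilbert (P.hamCore Ψ)) ∈ P.hamMin.graph := by
  rw [LinearPMap.mem_graph_iff]
  refine ⟨⟨P.toHilbert Ψ, Ψ, rfl⟩, rfl, ?_⟩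
  change P.toHilbert (P.hamCore ((LinearEquiv.ofInjective P.toHilbert P.toHilbert_injective).symm
    ⟨P.toHilbert Ψ, Ψ, rfl⟩)) = _
  congr 2
  exact (LinearEquiv.symm_apply_eq _).2 rfl

theorem exists_of_mem_graph_hamMin {p : P.hilbert × P.hilbert} (hp : p ∈ P.hamMin.graph) :
    ∃ Ψ : P.core, p = (P.toHilbert Ψ, P.toHilbert (P.hamCore Ψ)) := by
  rw [LinearPMap.mem_graph_iff] at hp
  obtain ⟨⟨_, Ψ, rfl⟩, h1, h2⟩ := hp
  refine ⟨Ψ, Prod.ext h1.symm ?_⟩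
  rw [← h2]
  exact (LinearPMap.mem_graph_iff _).1 (P.mem_graph_hamMin Ψ) |>.elim fun y hy => by
    rw [← hy.2]
    congr 1
    exact Subtype.ext hy.1.symm

/-- Truncating the photon state puts the product in the core, where `H` acts as `projHam q` on the
photon factor. Both the truncated states and their images converge, as `χ` decreases rapidly and
`projHam q` is tempered. -/
theorem mem_closure_graph_hamMin {q : Fin P.N → Orbital} (hq : Function.Injective q)
    {χ : Occ → ℂ} (hχ : RapidDecay χ) {E : ℝ} (hE : P.projHam q χ = (E : ℂ) • χ) :
    (P.slaterVec q hχ.summable_sq, (E : ℂ) • P.slaterVec q hχ.summable_sq) ∈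
      P.hamMin.graph.topologicalClosure := by
  have hT := (P.isAdj_projHam q).left
  have h1 : ∀ M, RapidDecay (truncate M χ) := fun M => .of_finite (finite_truncate M χ)
  have h2 : ∀ M, RapidDecay (P.projHam q (truncate M χ)) := fun M => (h1 M).map hT
  have hEχ : RapidDecay (P.projHam q χ) := hχ.map hT
  have e : (E : ℂ) • P.slaterVec q hχ.summable_sq = P.slaterVec q hEχ.summable_sq := by
    rw [P.smul_slaterVec q hχ.summable_sq _ (hχ.smul _).summable_sq]
    congr 1
    exact hE.symm
  have t1 := P.tendsto_slaterVec hq hχ h1 (tendsto_map_truncate (one_mem (tempered Occ)) hχ)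
  have t2 := P.tendsto_slaterVec hq hEχ h2 (by
    simpa only [map_sub] using tendsto_map_truncate hT hχ)
  rw [e]
  refine (Submodule.isClosed_topologicalClosure _).mem_of_tendsto (t1.prodMk_nhds t2)
    (Filter.Eventually.of_forall fun M => Submodule.le_topologicalClosure _ ?_)
  let Ψ : P.core := ⟨P.tensor (P.slater q) (truncate M χ),
    P.isNice_tensor (P.contDiff_slater q) (finite_truncate M χ),
    P.isAntisymm_tensor_slater q _⟩
  have e1 : P.slaterVec q (h1 M).summable_sq = P.toHilbert Ψ :=
    (P.represents_slaterVec q (h1 M).summable_sq).unique Ψ.2.1.memLp.coeFn_toLp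
  have e2 : P.slaterVec q (h2 M).summable_sq = P.toHilbert (P.hamCore Ψ) := by
    refine (P.represents_slaterVec q (h2 M).summable_sq).unique ?_
    rw [← ham_tensor_slater]
    exact (P.hamCore Ψ).2.1.memLp.coeFn_toLp
  rw [e1, e2]
  exact P.mem_graph_hamMin Ψ

end Approximation

/-! ### Displaced vacua and the dressed number states. -/

section Vacua

theorem abs_bogY_lt : |P.bogY| < P.bogX := by
  have h := P.bog_sq_sub
  exact abs_lt_of_sq_lt_sq (by linarith) P.bogX_pos.le

theorem squeeze_dressed_commutator (κ : ℝ) : P.cAnn κ * P.cCre κ - P.cCre κ * P.cAnn κ = 1 := by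
  rw [cAnn_eq, cCre_eq, squeeze_commutator P.bog_sq_sub]

theorem exists_isDressedVacuum (κ : ℝ) :
    ∃ v, P.IsDressedVacuum κ v ∧ RapidDecay v ∧ ∀ w, P.cAnn κ w = 0 → ∃ z : ℂ, w = z • v := by
  obtain ⟨v, hr, hv0, hv⟩ := exists_vacuum P.abs_bogY_lt (P.shift κ)
  have hS : 0 < ∑' n, ‖v n‖ ^ 2 :=
    hr.summable_sq.tsum_pos (fun _ => by positivity) 0 (by simp [hv0])
  set S := ∑' n, ‖v n‖ ^ 2
  have hs : 0 < Real.sqrt S := Real.sqrt_pos.2 hS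
  refine ⟨((Real.sqrt S)⁻¹ : ℂ) • v, ⟨?_, ?_⟩, hr.smul _, fun w hw => ?_⟩
  · have h1 := hr.summable_sq.hasSum.mul_left S⁻¹
    rw [inv_mul_cancel₀ hS.ne'] at h1
    have e : (fun n => ‖(((Real.sqrt S)⁻¹ : ℂ) • v) n‖ ^ 2) = fun n => S⁻¹ * ‖v n‖ ^ 2 :=
      funext fun n => by
        rw [Pi.smul_apply, norm_smul, mul_pow, norm_inv, Complex.norm_real, Real.norm_eq_abs,
          inv_pow, sq_abs, Real.sq_sqrt hS.le]
    rw [e]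
    exact h1
  · rw [map_smul, cAnn_eq, hv, smul_zero]
  · rw [cAnn_eq] at hw
    exact exists_eq_smul_vacuum P.bogX_pos.ne' (by rw [map_smul, hv, smul_zero])
      (by simp [hv0, hs.ne']) hw

variable {P} {κ : ℝ} {v : ℕ → ℂ}

/-- By uniqueness any vacuum is a multiple of the constructed one. This is why the choice of phases
does not matter. -/
theorem IsDressedVacuum.rapidDecay (h : P.IsDressedVacuum κ v) : RapidDecay v := by
  obtain ⟨w, -, hr, hw⟩ := P.exists_isDressedVacuum κ
  obtain ⟨z, rfl⟩ := hw v h.2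
  exact hr.smul z

theorem IsDressedVacuum.pair_self (h : P.IsDressedVacuum κ v) : pair v v = 1 := by
  rw [pair_self_eq, h.1.tsum_eq, Complex.ofReal_one]

theorem isAdj_cAnn (κ : ℝ) : IsAdj (P.cAnn κ) (P.cCre κ) := by
  rw [cAnn_eq, cCre_eq]
  exact isAdj_squeeze _ _ _

theorem IsDressedVacuum.number (h : P.IsDressedVacuum κ v) (n : ℕ) :
    (P.cCre κ * P.cAnn κ) (P.dressedState κ v n) = (n : ℂ) • P.dressedState κ v n :=
  number_excited (P.squeeze_dressed_commutator κ) h.2 n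

theorem IsDressedVacuum.rapidDecay_dressedState (h : P.IsDressedVacuum κ v) (n : ℕ) :
    RapidDecay (P.dressedState κ v n) :=
  (h.rapidDecay.pow (isAdj_cAnn κ).right n).smul _

theorem IsDressedVacuum.pair_dressedState (h : P.IsDressedVacuum κ v) (m n : ℕ) :
    pair (P.dressedState κ v m) (P.dressedState κ v n) = if m = n then 1 else 0 :=
  pair_excited (isAdj_cAnn κ) (P.squeeze_dressed_commutator κ) h.rapidDecay h.2 h.pair_self m n

theorem IsDressedVacuum.eq_zero_of_pair (h : P.IsDressedVacuum κ v) {g : ℕ → ℂ}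
    (hg : Summable fun i => ‖g i‖ ^ 2) (hp : ∀ n, pair (P.dressedState κ v n) g = 0) : g = 0 := by
  have h2 := h.2
  rw [cAnn_eq] at h2
  refine eq_zero_of_pair_excited P.bog_sq_sub P.bogX_pos h.rapidDecay h2 h.pair_self hg fun n => ?_
  rw [← cCre_eq]
  exact hp n

end Vacua

/-! ### Eigenbasis, self-adjointness and eigenvalues. -/

section Eigenstates

variable {P} {vac : ℝ → ℕ → ℂ}

theorem rapidDecay_photonState (hvac : ∀ κ, P.IsDressedVacuum κ (vac κ)) (q : Fin P.N → Orbital)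
    (n : Occ) : RapidDecay (P.photonState vac q n) :=
  rapidDecay_prodState fun l => (hvac (P.polK q l)).rapidDecay_dressedState (n l)

theorem pair_photonState (hvac : ∀ κ, P.IsDressedVacuum κ (vac κ)) (q : Fin P.N → Orbital)
    (m n : Occ) :
    pair (P.photonState vac q m) (P.photonState vac q n) = if m = n then 1 else 0 := by
  have h := pair_prodState (fun l => (hvac (P.polK q l)).rapidDecay_dressedState (m l))
    (fun l => (hvac (P.polK q l)).rapidDecay_dressedState (n l))
  refine h.trans ?_
  rw [(hvac _).pair_dressedState, (hvac _).pair_dressedState]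
  have : m = n ↔ m 0 = n 0 ∧ m 1 = n 1 := by rw [funext_iff, Fin.forall_fin_two]
  by_cases h0 : m 0 = n 0 <;> by_cases h1 : m 1 = n 1 <;> simp [this, h0, h1]

theorem eq_zero_of_pair_photonState (hvac : ∀ κ, P.IsDressedVacuum κ (vac κ))
    (q : Fin P.N → Orbital) {g : Occ → ℂ} (hg : Summable fun ν => ‖g ν‖ ^ 2)
    (hp : ∀ n : Occ, pair (P.photonState vac q n) g = 0) : g = 0 :=
  eq_zero_of_pair_prodState
    (D := fun l n => P.dressedState (P.polK q l) (vac (P.polK q l)) n)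
    (fun _ n => (hvac _).rapidDecay_dressedState n)
    (fun _ _ hg hp => (hvac _).eq_zero_of_pair hg hp) hg hp

theorem projHam_photonState (hvac : ∀ κ, P.IsDressedVacuum κ (vac κ)) (q : Fin P.N → Orbital)
    (n : Occ) : P.projHam q (P.photonState vac q n) =
      (P.energy q n : ℂ) • P.photonState vac q n := by
  have key : ∀ l, (onMode l (P.cCre (P.polK q l)) * onMode l (P.cAnn (P.polK q l)))
      (P.photonState vac q n) = (n l : ℂ) • P.photonState vac q n := fun l => by
    rw [← onMode_mul]
    exact onMode_prodState_of_eigen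
      (f := fun l => P.dressedState (P.polK q l) (vac (P.polK q l)) (n l)) l ((hvac _).number (n l))
  have hg : ∀ κ : ℝ, P.gamma / P.N * ((P.hbar * κ) ^ 2 / (2 * P.mass)) =
      P.g0 ^ 2 / (P.hbar * P.dressedFreq) * κ ^ 2 := fun κ => by
    have := P.N_cast_pos.ne'
    have := P.hbar_pos.ne'
    have := P.mass_pos.ne'
    have := P.dressedFreq_pos.ne'
    rw [gamma_eq]
    field_simp
  rw [projHam_eq, energy]
  simp only [LinearMap.add_apply, LinearMap.sub_apply, LinearMap.smul_apply,
    key, Module.End.one_apply, hg, Fin.sum_univ_two]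
  push_cast
  module

theorem isEigen_iff (hc : P.hamMin.IsClosable) {z : ℂ} {f : P.hilbert} :
    P.IsEigen z f ↔ (f, z • f) ∈ P.hamMin.graph.topologicalClosure := by
  rw [hc.graph_closure_eq_closure_graph, LinearPMap.mem_graph_iff]
  constructor
  · rintro ⟨h, e⟩
    exact ⟨⟨f, h⟩, rfl, e⟩
  · rintro ⟨⟨x, hx⟩, rfl, e⟩
    exact ⟨hx, e⟩

variable (P) in
/-- The eigenstate with electrons in the orbitals `q` and dressed photon numbers `n`. -/
noncomputable def eigenVec (hvac : ∀ κ, P.IsDressedVacuum κ (vac κ)) (q : Fin P.N → Orbital)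
    (n : Occ) : P.hilbert :=
  P.slaterVec q (rapidDecay_photonState hvac q n).summable_sq

theorem represents_eigenVec (hvac : ∀ κ, P.IsDressedVacuum κ (vac κ)) (q : Fin P.N → Orbital)
    (n : Occ) :
    P.Represents (P.eigenVec hvac q n) (P.tensor (P.slater q) (P.photonState vac q n)) :=
  P.represents_slaterVec q _

theorem norm_eigenVec (hvac : ∀ κ, P.IsDressedVacuum κ (vac κ)) {q : Fin P.N → Orbital}
    (hq : Function.Injective q) (n : Occ) : ‖P.eigenVec hvac q n‖ = 1 := by
  have h1 := P.norm_slaterVec_sq hq (rapidDecay_photonState hvac q n).summable_sq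
  have h2 := pair_photonState hvac q n n
  rw [pair_self_eq, if_pos rfl] at h2
  rw [show ∑' ν, ‖P.photonState vac q n ν‖ ^ 2 = 1 by exact_mod_cast h2] at h1
  exact (pow_eq_one_iff_of_nonneg (norm_nonneg _) two_ne_zero).1 h1

theorem eigenVec_mem_closure (hvac : ∀ κ, P.IsDressedVacuum κ (vac κ)) {q : Fin P.N → Orbital}
    (hq : Function.Injective q) (n : Occ) :
    (P.eigenVec hvac q n, (P.energy q n : ℂ) • P.eigenVec hvac q n) ∈
      P.hamMin.graph.topologicalClosure :=
  P.mem_closure_graph_hamMin hq (rapidDecay_photonState hvac q n) (projHam_photonState hvac q n)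

/-- Different orbital sets are orthogonal through the electrons, equal ones through the photons. A
vector orthogonal to all states has, for each set, a photon amplitude orthogonal to all dressed
states of that momentum, hence zero. -/
theorem exists_eigenbasis (hvac : ∀ κ, P.IsDressedVacuum κ (vac κ))
    (enum : {Q : Finset Orbital // Q.card = P.N} → Fin P.N → Orbital)
    (henum : ∀ Q, Function.Injective (enum Q) ∧ Set.range (enum Q) = (Q.1 : Set Orbital)) :
    ∃ B : HilbertBasis ({Q : Finset Orbital // Q.card = P.N} × Occ) ℂ P.hilbert,
      ∀ Q n, B (Q, n) = P.eigenVec hvac (enum Q) n := by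
  classical
  let b : {Q : Finset Orbital // Q.card = P.N} × Occ → P.hilbert :=
    fun p => P.eigenVec hvac (enum p.1) p.2
  have hb : Orthonormal ℂ b := by
    rw [orthonormal_iff_ite]
    rintro ⟨Q, m⟩ ⟨Q', n⟩
    by_cases hQ : Q = Q'
    · subst hQ
      refine (P.inner_slaterVec_self (henum Q).1 _ _).trans ((pair_photonState hvac _ m n).trans ?_)
      simp
    · rw [if_neg fun h => hQ (Prod.ext_iff.1 h).1]
      refine P.inner_slaterVec_of_range_ne (fun h => hQ (Subtype.ext ?_)) _ _
      rw [(henum Q).2, (henum Q').2] at h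
      exact_mod_cast h
  have hs : (Submodule.span ℂ (Set.range b))ᗮ = ⊥ := by
    rw [eq_bot_iff]
    intro f hf
    refine P.eq_zero_of_coef f fun Q hQ => ⟨enum ⟨Q, hQ⟩, (henum _).1, (henum _).2, ?_⟩
    refine eq_zero_of_pair_photonState hvac (enum ⟨Q, hQ⟩) (P.summable_coef _ _) fun n => ?_
    have h1 : inner ℂ (b (⟨Q, hQ⟩, n)) f = 0 :=
      (Submodule.mem_orthogonal _ _).1 hf _ (Submodule.subset_span ⟨_, rfl⟩)
    have h2 := (P.inner_slaterVec _ _ f).symm.trans h1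
    have hp : (Real.sqrt (P.N.factorial) : ℂ) ≠ 0 := by
      exact_mod_cast (Real.sqrt_pos.2 (by positivity : (0 : ℝ) < P.N.factorial)).ne'
    exact (mul_eq_zero.1 h2).resolve_left hp
  refine ⟨HilbertBasis.mkOfOrthogonalEqBot hb hs, fun Q n => ?_⟩
  rw [HilbertBasis.coe_mkOfOrthogonalEqBot]

theorem hamMin_graph_le_diagonalGraph (hvac : ∀ κ, P.IsDressedVacuum κ (vac κ))
    {ι : Type*} (B : HilbertBasis ι ℂ P.hilbert) (q : ι → Fin P.N → Orbital) (n : ι → Occ)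
    (hB : ∀ i, B i = P.eigenVec hvac (q i) (n i)) :
    P.hamMin.graph ≤ diagonalGraph B fun i => P.energy (q i) (n i) := by
  intro p hp i
  obtain ⟨Ψ, rfl⟩ := P.exists_of_mem_graph_hamMin hp
  rw [hB]
  exact inner_slaterVec_hamCore (rapidDecay_photonState hvac (q i) (n i)) (projHam_photonState hvac (q i) (n i)) Ψ

variable (P) in
theorem exists_dressedVacua : ∃ vac : ℝ → ℕ → ℂ, ∀ κ, P.IsDressedVacuum κ (vac κ) :=
  ⟨fun κ => (P.exists_isDressedVacuum κ).choose,
    fun κ => (P.exists_isDressedVacuum κ).choose_spec.1⟩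

theorem exists_diagonalization (hvac : ∀ κ, P.IsDressedVacuum κ (vac κ)) :
    ∃ (ι : Type) (B : HilbertBasis ι ℂ P.hilbert) (q : ι → Fin P.N → Orbital) (n : ι → Occ),
      (∀ i, Function.Injective (q i)) ∧ ∀ i, B i = P.eigenVec hvac (q i) (n i) := by
  let enum : {Q : Finset Orbital // Q.card = P.N} → Fin P.N → Orbital :=
    fun Q j => ((Q.1.equivFinOfCardEq Q.2).symm j : Orbital)
  have henum : ∀ Q, Function.Injective (enum Q) ∧ Set.range (enum Q) = (Q.1 : Set Orbital) :=
    fun Q => ⟨Subtype.val_injective.comp (Equiv.injective _), by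
      change Set.range (Subtype.val ∘ (Q.1.equivFinOfCardEq Q.2).symm) = _
      rw [Set.range_comp, Equiv.range_eq_univ, Set.image_univ, Subtype.range_coe_subtype]
      rfl⟩
  obtain ⟨B, hB⟩ := exists_eigenbasis hvac enum henum
  exact ⟨_, B, fun i => enum i.1, fun i => i.2, fun i => (henum _).1, fun i => hB i.1 i.2⟩

variable (P)

/-- Needed for `hamOp` to be a genuine closure: `LinearPMap.closure` returns the operator itself
when it is not closable. -/
theorem isClosable_hamMin : P.hamMin.IsClosable := by
  obtain ⟨vac, hvac⟩ := P.exists_dressedVacua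
  obtain ⟨ι, B, q, n, -, hB⟩ := exists_diagonalization hvac
  exact isClosable_of_diagonal (hamMin_graph_le_diagonalGraph hvac B q n hB)

theorem exists_graph_hamOp_eq : ∃ (ι : Type) (B : HilbertBasis ι ℂ P.hilbert)
    (q : ι → Fin P.N → Orbital) (n : ι → Occ), (∀ i, Function.Injective (q i)) ∧
      P.hamOp.graph = diagonalGraph B fun i => P.energy (q i) (n i) := by
  obtain ⟨vac, hvac⟩ := P.exists_dressedVacua
  obtain ⟨ι, B, q, n, hq, hB⟩ := exists_diagonalization hvac
  refine ⟨ι, B, q, n, hq, graph_closure_eq_diagonalGraph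
    (hamMin_graph_le_diagonalGraph hvac B q n hB) fun i => ?_⟩
  rw [hB]
  exact eigenVec_mem_closure hvac (hq i) (n i)

theorem isSelfAdjoint_hamOp : IsSelfAdjoint P.hamOp := by
  obtain ⟨ι, B, q, n, -, h⟩ := P.exists_graph_hamOp_eq
  exact isSelfAdjoint_of_graph_eq_diagonalGraph h

variable {P}

theorem isEigen_eigenVec (hvac : ∀ κ, P.IsDressedVacuum κ (vac κ)) {q : Fin P.N → Orbital}
    (hq : Function.Injective q) (n : Occ) :
    P.IsEigen (P.energy q n) (P.eigenVec hvac q n) :=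
  (isEigen_iff P.isClosable_hamMin).2 (eigenVec_mem_closure hvac hq n)

variable (P)

/-- A diagonal operator has no eigenvalues besides its diagonal entries. Conversely every injective
`q` gives a unit eigenvector, whether or not `q` is an ordering used in the basis. -/
theorem eigenvalues_hamOp : {z : ℂ | ∃ f : P.hilbert, f ≠ 0 ∧ P.IsEigen z f} =
    {z : ℂ | ∃ (q : Fin P.N → Orbital) (n : Occ),
      Function.Injective q ∧ z = (P.energy q n : ℂ)} := by
  ext z
  constructor
  · rintro ⟨f, hf, h⟩
    obtain ⟨ι, B, q, n, hq, hg⟩ := P.exists_graph_hamOp_eq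
    rw [isEigen_iff P.isClosable_hamMin,
      P.isClosable_hamMin.graph_closure_eq_closure_graph] at h
    obtain ⟨i, hi⟩ := exists_eq_of_smul_mem_diagonalGraph hf (hg ▸ h :)
    exact ⟨q i, n i, hq i, hi⟩
  · rintro ⟨q, n, hq, rfl⟩
    obtain ⟨vac, hvac⟩ := P.exists_dressedVacua
    refine ⟨P.eigenVec hvac q n, fun h => ?_, isEigen_eigenVec hvac hq n⟩
    have := norm_eigenVec hvac hq n
    rw [h, norm_zero] at this
    exact zero_ne_one this

end Eigenstates

end Params

end CavityQED

/-! ### The main theorem, assembled. -/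

theorem mainTheorem2 (P : Params) :
    -- the collective coupling
    (P.gamma = 2 * P.mass * P.N / P.hbar ^ 2 * (P.g0 ^ 2 / (P.hbar * P.dressedFreq)) ∧
      P.gamma = P.plasmaFreq ^ 2 / P.dressedFreq ^ 2 ∧ 0 ≤ P.gamma ∧ P.gamma < 1) ∧
    -- the Bogoliubov transformation
    (∀ l l' : Fin 2,
      onMode l P.bAnn * onMode l' P.bCre - onMode l' P.bCre * onMode l P.bAnn
        = (if l = l' then 1 else 0) ∧
      onMode l P.bAnn * onMode l' P.bAnn = onMode l' P.bAnn * onMode l P.bAnn ∧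
      onMode l P.bCre * onMode l' P.bCre = onMode l' P.bCre * onMode l P.bCre) ∧
    (P.photonHam = ∑ l : Fin 2,
      (((P.hbar * P.freq : ℝ) : ℂ) • (onMode l cre * onMode l ann + (1 / 2 : ℂ) • 1)
        + ((P.hbar * P.plasmaFreq ^ 2 / (4 * P.freq) : ℝ) : ℂ) •
            (onMode l ann + onMode l cre) ^ 2)) ∧
    (P.photonHam = ∑ l : Fin 2, ((P.hbar * P.dressedFreq : ℝ) : ℂ) •
      (onMode l P.bCre * onMode l P.bAnn + (1 / 2 : ℂ) • 1)) ∧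
    (∀ i : Fin 2, P.vecPot i = ((Real.sqrt (P.hbar / (P.eps0 * P.V)) : ℝ) : ℂ) •
      ∑ l : Fin 2, ((pol l i / Real.sqrt (2 * P.dressedFreq) : ℝ) : ℂ) •
        (onMode l P.bAnn + onMode l P.bCre)) ∧
    -- the electrons in a Slater determinant, and the coherent shift
    (∀ (q : Fin P.N → Orbital) (χ : Occ → ℂ),
      P.ham (P.tensor (P.slater q) χ) = P.tensor (P.slater q) (P.projHam q χ)) ∧
    (∀ (κ : Fin 2 → ℝ) (l l' : Fin 2),
      onMode l (P.cAnn (κ l)) * onMode l' (P.cCre (κ l'))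
          - onMode l' (P.cCre (κ l')) * onMode l (P.cAnn (κ l))
        = (if l = l' then 1 else 0) ∧
      onMode l (P.cAnn (κ l)) * onMode l' (P.cAnn (κ l'))
        = onMode l' (P.cAnn (κ l')) * onMode l (P.cAnn (κ l)) ∧
      onMode l (P.cCre (κ l)) * onMode l' (P.cCre (κ l'))
        = onMode l' (P.cCre (κ l')) * onMode l (P.cCre (κ l))) ∧
    (∀ q : Fin P.N → Orbital,
      P.projHam q = (∑ l : Fin 2, (((P.hbar * P.dressedFreq : ℝ) : ℂ) •
            (onMode l (P.cCre (P.polK q l)) * onMode l (P.cAnn (P.polK q l)) + (1 / 2 : ℂ) • 1)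
          - ((P.g0 ^ 2 / (P.hbar * P.dressedFreq) * P.polK q l ^ 2 : ℝ) : ℂ) • 1))
        + (P.kinetic q : ℂ) • 1) ∧
    -- existence and uniqueness (up to a scalar) of the displaced vacua
    (∀ κ : ℝ, ∃ v, P.IsDressedVacuum κ v ∧ ∀ w, P.cAnn κ w = 0 → ∃ z : ℂ, w = z • v) ∧
    -- the eigenstates: whatever the choice of the phases of the displaced vacua
    (∀ vac : ℝ → ℕ → ℂ, (∀ κ, P.IsDressedVacuum κ (vac κ)) →
      (∀ (κ : ℝ) (n : ℕ), (P.cCre κ * P.cAnn κ) (P.dressedState κ (vac κ) n)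
        = (n : ℂ) • P.dressedState κ (vac κ) n) ∧
      (∀ q : Fin P.N → Orbital, Function.Injective q → ∀ n : Occ,
        P.ham (P.tensor (P.slater q) (P.photonState vac q n))
          = (P.energy q n : ℂ) • P.tensor (P.slater q) (P.photonState vac q n) ∧
        ∃ f : P.hilbert, P.Represents f (P.tensor (P.slater q) (P.photonState vac q n)) ∧
          ‖f‖ = 1 ∧ P.IsEigen (P.energy q n) f) ∧
      -- completeness: one state for each set of `N` orbitals, listed in any order, and each `n`
      (∀ enum : {Q : Finset Orbital // Q.card = P.N} → Fin P.N → Orbital,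
        (∀ Q, Function.Injective (enum Q) ∧ Set.range (enum Q) = (Q.1 : Set Orbital)) →
        ∃ B : HilbertBasis ({Q : Finset Orbital // Q.card = P.N} × Occ) ℂ P.hilbert,
          ∀ Q n, P.Represents (B (Q, n))
            (P.tensor (P.slater (enum Q)) (P.photonState vac (enum Q) n)))) ∧
    -- the Hamiltonian is self-adjoint, and its eigenvalues are exactly the stated energies
    IsSelfAdjoint P.hamOp ∧
    {z : ℂ | ∃ f : P.hilbert, f ≠ 0 ∧ P.IsEigen z f} =
      {z : ℂ | ∃ (q : Fin P.N → Orbital) (n : Occ),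
        Function.Injective q ∧ z = (P.energy q n : ℂ)} := by
  refine ⟨⟨P.gamma_eq, P.gamma_eq_div, P.gamma_nonneg, P.gamma_lt_one⟩, ?_, P.photonHam_eq,
    P.photonHam_eq_dressed, P.vecPot_eq_sum_dressed, P.ham_tensor_slater, ?_, P.projHam_eq, ?_, ?_,
    P.isSelfAdjoint_hamOp, P.eigenvalues_hamOp⟩
  · intro l l'
    rw [bAnn_eq, bCre_eq]
    exact bosonic_relations P.bog_sq_sub (fun _ => 0) l l'
  · intro κ l l'
    simp only [cAnn_eq, cCre_eq]
    exact bosonic_relations P.bog_sq_sub (fun l => P.shift (κ l)) l l'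
  · intro κ
    obtain ⟨v, hv, -, hw⟩ := P.exists_isDressedVacuum κ
    exact ⟨v, hv, hw⟩
  · intro vac hvac
    refine ⟨fun κ n => (hvac κ).number n, fun q hq n => ⟨?_, P.eigenVec hvac q n,
      represents_eigenVec hvac q n, norm_eigenVec hvac hq n, isEigen_eigenVec hvac hq n⟩, ?_⟩
    · rw [ham_tensor_slater, projHam_photonState hvac]
      funext x s ν
      simp [tensor, mul_left_comm]
    · intro enum henum
      obtain ⟨B, hB⟩ := exists_eigenbasis hvac enum henum
      refine ⟨B, fun Q n => ?_⟩
      rw [hB]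
      exact represents_eigenVec hvac (enum Q) n
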